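/- Let $\mathbb T=\mathbb R/2\pi\mathbb Z$. For $f\in L^2(\mathbb T\times\mathbb R)$ (real-valued) let $\tilde f(k,\xi)$, $k\in\mathbb Z$, $\xi\in\mathbb R$, be its Fourier transform, and $$\|f\|_{H^N}^2=\sum_{k}\int(1+k^2+\xi^2)^N|\tilde f(k,\xi)|^2\,d\xi,\qquad \|\nabla f\|_{H^N}^2=\sum_k\int (k^2+\xi^2)(1+k^2+\xi^2)^N|\tilde f(k,\xi)|^2\,d\xi .$$ Let $\alpha>0$, $\beta\in\mathbb R$, $N\in\mathbb N_0$, and consider for $t\ge 0$ the inviscid Boussinesq equations linearized around $v=(\beta y,0)$, $\theta=\alpha y$, $$\partial_t\omega+\beta y\,\partial_x\omega=\partial_x\theta,\qquad \partial_t\theta+\beta y\,\partial_x\theta+\alpha\,\partial_x\Delta^{-1}\omega=0\quad\text{on }\mathbb T\times\mathbb R,$$ with initial data $(\omega_0,\theta_0)\in H^N\times H^{N+1}$; here $\partial_x\Delta^{-1}$ is the Fourier multiplier $-ik/(k^2+\xi^2)$ (equal to $0$ for $k=0$), and solutions are understood in the weak sense, with $L^2$ norms of $\omega(t),\theta(t)$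 bounded on bounded time intervals. For all such data there is exactly one solution (up to null sets, at each time $t\ge0$), and the following holds. (i) If $\beta=0$, then the evolution $(\omega_0,\theta_0)\mapsto(\omega(t),\theta(t))$ is stable on $H^N\times H^{N+1}$: for all $t\ge0$, $$\|\omega(t)\|_{H^N}\le\|\omega_0\|_{H^N}+\tfrac1{\sqrt\alpha}\|\nabla\theta_0\|_{H^N},\qquad \|\nabla\theta(t)\|_{H^N}\le\sqrt\alpha\,\|\omega_0\|_{H^N}+\|\nabla\theta_0\|_{H^N},$$ $$\|\theta(t)\|_{H^{N+1}}\le\sqrt{2\alpha}\,\|\omega_0\|_{H^N}+\|\theta_0\|_{H^{N+1}} .$$ (ii) If $\beta\neq0$, then the evolution of $W(t,x,y)=\omega(t,x+\beta ty,y)$, $\Theta(t,x,y)=\theta(t,x+\beta ty,y)$ is unstable in $H^N\times H^{N+1}$ with the algebraic growth rate $t^\gamma$, where $$\gamma=\gamma(\alpha,\beta)=\operatorname{Re}\frac{1+\sqrt{1-4\alpha/\beta^2}}2\in[\tfrac12,1)$$ (with an additional logarithm in the borderline case $4\alpha=\beta^2$). Precisely, let $g(t)=(1+t)^\gamma$ if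 $4\alpha\ne\beta^2$ and $g(t)=(1+t)^{1/2}(1+\log(1+t))$ if $4\alpha=\beta^2$. There is $C=C(\alpha,\beta,N)$ such that for all data in $H^N\times H^{N+1}$ and all $t\ge0$ $$\|W(t)\|_{H^N}+\|\Theta(t)\|_{H^{N+1}}\le C\,g(t)\,\bigl(\|\omega_0\|_{H^N}+\|\theta_0\|_{H^{N+1}}\bigr),$$ and there are data $(\omega_0,\theta_0)\in H^N\times H^{N+1}$, $c>0$ and $T\ge0$ such that $\|W(t)\|_{H^N}\ge c\,g(t)$ for all $t\ge T$. -/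

import Mathlib

open MeasureTheory Set Filter Topology FourierTransform
open scoped Real ENNReal NNReal

namespace BoussinesqLinear

noncomputable section

instance factTwoPiPos : Fact (0 < 2 * π) := ⟨Real.two_pi_pos⟩

/-- The infinite periodic channel `𝕋 × ℝ` with `𝕋 = ℝ / 2πℤ`; its `volume` is `dx dy`. -/
abbrev Channel : Type := AddCircle (2 * π) × ℝ

/-- The `k`-th Fourier coefficient in `x`:
`f_k(y) = (2π)⁻¹ ∫_𝕋 f(x, y) exp(-ikx) dx`. -/
def modeCoeff (f : Channel → ℝ) (k : ℤ) (y : ℝ) : ℂ :=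
  fourierCoeff (fun x : AddCircle (2 * π) => (f (x, y) : ℂ)) k

/-- The Fourier coefficients in `x` of an `L²` function on the channel are in `L²(ℝ)`. -/
theorem memLp_modeCoeff {f : Channel → ℝ} (hf : MemLp f 2 volume) (k : ℤ) :
    MemLp (modeCoeff f k) 2 volume := by
  have hsq : Integrable (fun p : Channel => f p ^ 2) volume := hf.integrable_sq
  have hmeas : AEStronglyMeasurable
      (fun q : ℝ × AddCircle (2 * π) => fourier (-k) q.2 • ((f (q.2, q.1) : ℝ) : ℂ))
      ((volume : Measure ℝ).prod AddCircle.haarAddCircle) := by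
    have h1 : AEStronglyMeasurable (fun q : ℝ × AddCircle (2 * π) => f (q.2, q.1))
        ((volume : Measure ℝ).prod (volume : Measure (AddCircle (2 * π)))) :=
      hf.aestronglyMeasurable.prod_swap
    have hac : ((volume : Measure ℝ).prod AddCircle.haarAddCircle) ≪
        ((volume : Measure ℝ).prod (volume : Measure (AddCircle (2 * π)))) := by
      refine Measure.AbsolutelyContinuous.rfl.prod ?_
      rw [AddCircle.volume_eq_smul_haarAddCircle]
      refine Measure.absolutelyContinuous_smul ?_
      simp [Real.pi_pos]
    have h2 := h1.mono_ac hac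
    refine AEStronglyMeasurable.smul (Continuous.aestronglyMeasurable
      (f := fun q : ℝ × AddCircle (2 * π) => (fourier (-k) q.2 : ℂ)) ?_)
      (Complex.continuous_ofReal.comp_aestronglyMeasurable h2)
    exact (fourier (-k)).continuous.comp continuous_snd
  have hF : AEStronglyMeasurable (modeCoeff f k) volume := hmeas.integral_prod_right'
  refine (memLp_two_iff_integrable_sq_norm hF).2 ?_
  have hint : Integrable (fun y : ℝ => ∫ x, f (x, y) ^ 2) volume := hsq.integral_prod_right
  have hslice : ∀ᵐ y : ℝ, Integrable (fun x => f (x, y) ^ 2) volume := hsq.prod_left_ae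
  have hslm : ∀ᵐ y : ℝ, AEStronglyMeasurable (fun x => f (x, y)) volume :=
    hf.aestronglyMeasurable.prod_swap.prodMk_left
  refine (hint.const_mul ((2 * π)⁻¹)).mono' (hF.norm.pow 2) ?_
  filter_upwards [hslice, hslm] with y hy hm
  have hm' : MemLp (fun x => (f (x, y) : ℂ)) 2 (volume : Measure (AddCircle (2 * π))) :=
    ((memLp_two_iff_integrable_sq hm).2 hy).ofReal
  have hh : MemLp (fun x => (f (x, y) : ℂ)) 2 (@AddCircle.haarAddCircle (2 * π) _) :=
    memLp_haarAddCircle_iff.2 hm'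
  rw [Real.norm_of_nonneg (by positivity)]
  have hb : ‖modeCoeff f k y‖ ≤ ∫ x, ‖(f (x, y) : ℂ)‖ ∂(@AddCircle.haarAddCircle (2 * π) _) := by
    refine (norm_integral_le_integral_norm _).trans (le_of_eq ?_)
    refine integral_congr_ae (Eventually.of_forall fun x => ?_)
    have h1 : ‖(fourier (-k) x : ℂ)‖ = 1 := Circle.norm_coe _
    simp only [norm_smul, h1, one_mul]
  have hj : (∫ x, ‖(f (x, y) : ℂ)‖ ∂(@AddCircle.haarAddCircle (2 * π) _)) ^ 2 ≤
      ∫ x, ‖(f (x, y) : ℂ)‖ ^ 2 ∂(@AddCircle.haarAddCircle (2 * π) _) :=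
    (convexOn_pow 2).map_integral_le (continuous_pow 2).continuousOn isClosed_Ici
      (Eventually.of_forall fun x => norm_nonneg _) (hh.integrable one_le_two).norm
      hh.integrable_norm_pow'
  refine (pow_le_pow_left₀ (norm_nonneg _) hb 2).trans (hj.trans (le_of_eq ?_))
  rw [AddCircle.integral_haarAddCircle]
  simp

open scoped Classical in
/-- The Fourier transform in both variables of `f ∈ L²(𝕋 × ℝ)`,
`f~(k, ξ) = (2π)⁻¹ ∫∫ f(x, y) exp(-ikx - iξy) dx dy` in the `L²` (Plancherel) sense,
determined for almost every `ξ`. Mathlib's transform on `L²(ℝ)` has the kernel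
`exp(-2πiηy)`, hence `η = ξ / 2π`. (Functions that are not in `L²` get the value `0`.) -/
def channelFourier (f : Channel → ℝ) (k : ℤ) (ξ : ℝ) : ℂ :=
  if hf : MemLp f 2 volume then
    (𝓕 ((memLp_modeCoeff hf k).toLp (modeCoeff f k)) : Lp ℂ 2 (volume : Measure ℝ)) (ξ / (2 * π))
  else 0

/-- `(∑ₖ ∫ m(k, ξ) |f~(k, ξ)|² dξ)^{1/2}` for a nonnegative weight `m`. For `m = 1` this is
the `L²(𝕋 × ℝ)` norm. -/
def weightedNorm (m : ℤ → ℝ → ℝ) (f : Channel → ℝ) : ℝ≥0∞ :=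
  (∑' k : ℤ, ∫⁻ ξ : ℝ, ENNReal.ofReal (m k ξ * ‖channelFourier f k ξ‖ ^ 2)) ^ (1 / 2 : ℝ)

/-- The norm of `H^N(𝕋 × ℝ)`. -/
def sobolevNorm (N : ℕ) (f : Channel → ℝ) : ℝ≥0∞ :=
  weightedNorm (fun k ξ => (1 + (k : ℝ) ^ 2 + ξ ^ 2) ^ N) f

/-- The norm `‖∇f‖_{H^N}` of the gradient, whose Fourier symbol is `i(k, ξ)`. -/
def gradSobolevNorm (N : ℕ) (f : Channel → ℝ) : ℝ≥0∞ :=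
  weightedNorm (fun k ξ => ((k : ℝ) ^ 2 + ξ ^ 2) * (1 + (k : ℝ) ^ 2 + ξ ^ 2) ^ N) f

/-- Membership in `H^N(𝕋 × ℝ)`. -/
def MemSobolev (N : ℕ) (f : Channel → ℝ) : Prop :=
  MemLp f 2 volume ∧ sobolevNorm N f < ∞

/-- `ψ = ∂ₓ Δ⁻¹ f` in `L²(𝕋 × ℝ)`: the Fourier multiplier `-ik / (k² + ξ²)`, which vanishes
for `k = 0`. -/
def IsDxInvLaplacian (f ψ : Channel → ℝ) : Prop :=
  MemLp f 2 volume ∧ MemLp ψ 2 volume ∧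
    ∀ k : ℤ, ∀ᵐ ξ : ℝ, channelFourier ψ k ξ =
      -(Complex.I * (k : ℂ)) / ((k : ℂ) ^ 2 + (ξ : ℂ) ^ 2) * channelFourier f k ξ

/-- Test functions `φ ∈ C_c^∞(𝕋 × ℝ)`; smoothness is that of the `2π`-periodic lift to `ℝ²`. -/
def IsTestFunction (φ : Channel → ℝ) : Prop :=
  ContDiff ℝ ((⊤ : ℕ∞) : WithTop ℕ∞) (fun p : ℝ × ℝ => φ ((p.1 : AddCircle (2 * π)), p.2)) ∧ HasCompactSupport φ

/-- The partial derivative `∂ₓ φ` on `𝕋 × ℝ`. -/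
def dx (φ : Channel → ℝ) (p : Channel) : ℝ :=
  deriv (fun h : ℝ => φ (p.1 + (h : AddCircle (2 * π)), p.2)) 0

/-- A family of `L²` functions whose norms are bounded on bounded intervals of times `t ≥ 0`. -/
def LocallyBoundedInL2 (u : ℝ → Channel → ℝ) : Prop :=
  (∀ t, 0 ≤ t → MemLp (u t) 2 volume) ∧
    ∀ T : ℝ, ∃ M : ℝ≥0, ∀ t ∈ Icc 0 T, eLpNorm (u t) 2 volume ≤ M

/-- `(ω, θ)` is a weak solution for `t ≥ 0` of the inviscid linearized Boussinesq equations
`∂ₜω + βy ∂ₓω = ∂ₓθ`, `∂ₜθ + βy ∂ₓθ + α ∂ₓΔ⁻¹ω = 0` on `𝕋 × ℝ` with initial data `(ω₀, θ₀)`. -/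
structure IsSolution (α β : ℝ) (ω₀ θ₀ : Channel → ℝ) (ω θ : ℝ → Channel → ℝ) : Prop where
  bounded_vorticity : LocallyBoundedInL2 ω
  bounded_temperature : LocallyBoundedInL2 θ
  initial_vorticity : ω 0 =ᵐ[volume] ω₀
  initial_temperature : θ 0 =ᵐ[volume] θ₀
  vorticity_eq : ∀ φ : Channel → ℝ, IsTestFunction φ → ∀ t : ℝ, 0 ≤ t →
    HasDerivWithinAt (fun s => ∫ p, ω s p * φ p)
      ((∫ p, ω t p * (β * p.2 * dx φ p)) - ∫ p, θ t p * dx φ p) (Ici 0) t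
  temperature_eq : ∀ t : ℝ, 0 ≤ t → ∃ ψ : Channel → ℝ, IsDxInvLaplacian (ω t) ψ ∧
    ∀ φ : Channel → ℝ, IsTestFunction φ →
      HasDerivWithinAt (fun s => ∫ p, θ s p * φ p)
        ((∫ p, θ t p * (β * p.2 * dx φ p)) - α * ∫ p, ψ p * φ p) (Ici 0) t

/-- Coordinates moving with the shear: `(x, y) ↦ u(t, x + βty, y)`. -/
def sheared (β : ℝ) (u : ℝ → Channel → ℝ) (t : ℝ) : Channel → ℝ :=
  fun p => u t (p.1 + ((β * t * p.2 : ℝ) : AddCircle (2 * π)), p.2)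

/-- The exponent `γ(α, β) = Re (1 + √(1 - 4α/β²)) / 2`; the square root is imaginary, so that
`γ = 1/2`, if `4α > β²`, and accordingly `Real.sqrt` is `0` there. -/
def growthExponent (α β : ℝ) : ℝ :=
  (1 + √(1 - 4 * α / β ^ 2)) / 2

open scoped Classical in
/-- The growth `t^γ`, written as `(1 + t)^γ`, with an additional logarithm in the borderline case
`4α = β²`. -/
def growthRate (α β t : ℝ) : ℝ :=
  if 4 * α = β ^ 2 then (1 + t) ^ growthExponent α β * (1 + Real.log (1 + t))
  else (1 + t) ^ growthExponent α β

end

end BoussinesqLinear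

open BoussinesqLinear

namespace BoussinesqLinear
noncomputable section

/-! In the coordinates `(x + βty, y)` the transport term disappears, and the Fourier transform turns
the system into an ODE at each frequency `(k, ξ)`: `Ŵ' = ik Θ̂` and `Θ̂' = iαk / (k² + (ξ - βtk)²)
Ŵ`. The mode `k = 0` is constant in time. For `k ≠ 0` and `η = ξ / k` this gives `Ŵ'' = -α / (1 + (η
- βt)²) Ŵ`.

Well-posedness. The coefficient depends on the frequency only through `η`, and it is bounded and
Lipschitz in `t` in the supremum norm. Hence the fundamental solutions exist for all frequencies at
once as curves in the Banach algebra `Symbols`. They act on `L²` as Fourier multipliers, and undoing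
the shear gives a weak solution (`exists_isSolution`). Uniqueness is a Picard iteration on pairings
with sheared test functions, which closes because `∂ₓ²Δ⁻¹` is bounded on `L²` (`isSolution_unique`).
So every solution obeys the explicit formula (`IsSolution.channelFourier_sheared`), and norm
estimates follow from pointwise ones at each frequency (`weightedNorm_le`). The link between the ODE
and the norms is `|k|⟨η⟩ = √(k² + ξ²)`.

No shear. The quantity `⟨η⟩² w'² + α w²` is conserved (`IsMode.energy`), which gives the bounds with
their stated constants.

Shear, upper bound. With `s = s₀ + |β|t`, `|s₀| = |η|` and `a = α / β²`, the equation is `u'' = -a u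
/ (1 + s²)`. In the variable `τ = arsinh s` the function `v = ⟨s⟩^{-1/2} u` satisfies `v_ττ = (1/4 -
a - 3/(4⟨s⟩²)) v`, an integrable perturbation of an equation with constant coefficients. An energy
in `v` and `v_τ` therefore grows like that of the unperturbed equation (`sq_scaleSize_le_of_ne`),
with a logarithm at `a = 1/4` (`sq_scaleSize_le_of_eq`). Constants have to be uniform in `η`, so
growth over `[s₀, s₁]` must be bounded by a function of `s₁ - s₀` alone. When the interval crosses
`s = 0`, the loss at `s₀` is absorbed by the factor `1 / ⟨s₀⟩` (`exists_growth_bound`).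

Shear, lower bound. For `s ≥ 1` one compares with the Euler equation `u'' = -a u / s²` if `a ≤ 1/4`.
If `a > 1/4`, a constant Wronskian together with the decay of the derivatives bounds a pair of
solutions from below (`exists_lower_bound`). Data concentrated at `k = ±1` on a unit interval of `ξ`
make both solutions visible in the modulus of `Ŵ` (`exists_shear_lower_bound`). -/

/-! ### Modulation and conjugation under the Fourier transform of `L²(ℝ)` -/

theorem fourier_compSubConst_apply (h : SchwartzMap ℝ ℂ) (a y : ℝ) :
    (𝓕⁻ (h.compSubConstCLM ℂ a) : SchwartzMap ℝ ℂ) y =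
      Complex.exp (2 * π * Complex.I * (a * y : ℝ)) * (𝓕⁻ h : SchwartzMap ℝ ℂ) y := by
  rw [SchwartzMap.fourierInv_coe, SchwartzMap.fourierInv_coe, Real.fourierInv_eq',
    Real.fourierInv_eq', ← integral_const_mul, ← integral_add_right_eq_self _ a]
  refine integral_congr_ae (Eventually.of_forall fun v => ?_)
  simp only [SchwartzMap.compSubConstCLM_apply, add_sub_cancel_right, smul_eq_mul, ← mul_assoc,
    ← Complex.exp_add]
  congr 2
  simp [inner]
  ring

theorem memLp_unimodular_mul {e : ℝ → ℂ} (he : Measurable e) (h1 : ∀ y, ‖e y‖ = 1)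
    (g : Lp ℂ 2 (volume : Measure ℝ)) : MemLp (fun y => e y * g y) 2 volume :=
  (Lp.memLp g).of_le (he.aestronglyMeasurable.mul (Lp.aestronglyMeasurable g))
    (Eventually.of_forall fun y => by simp [h1])

/-- Multiplication by a unimodular measurable function on `L²(ℝ)`. -/
def unimodularMul (e : ℝ → ℂ) (he : Measurable e) (h1 : ∀ y, ‖e y‖ = 1)
    (g : Lp ℂ 2 (volume : Measure ℝ)) : Lp ℂ 2 (volume : Measure ℝ) :=
  (memLp_unimodular_mul he h1 g).toLp _

theorem coeFn_unimodularMul (e : ℝ → ℂ) (he : Measurable e) (h1 : ∀ y, ‖e y‖ = 1)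
    (g : Lp ℂ 2 (volume : Measure ℝ)) : unimodularMul e he h1 g =ᵐ[volume] fun y => e y * g y :=
  MemLp.coeFn_toLp _

theorem continuous_unimodularMul (e : ℝ → ℂ) (he : Measurable e) (h1 : ∀ y, ‖e y‖ = 1) :
    Continuous (unimodularMul e he h1) := by
  refine Isometry.continuous (Isometry.of_dist_eq fun f g => ?_)
  rw [dist_eq_norm, dist_eq_norm, Lp.norm_def, Lp.norm_def]
  congr 1
  refine eLpNorm_congr_norm_ae ?_
  filter_upwards [Lp.coeFn_sub (unimodularMul e he h1 f) (unimodularMul e he h1 g),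
    Lp.coeFn_sub f g, coeFn_unimodularMul e he h1 f, coeFn_unimodularMul e he h1 g]
    with y h2 h3 h4 h5
  rw [h2, h3, Pi.sub_apply, Pi.sub_apply, h4, h5, ← mul_sub, norm_mul, h1, one_mul]

/-- For Schwartz functions this is the usual integral identity, and both sides are continuous on
`L²`. The density argument is run for `𝓕⁻`, where the Schwartz function is only translated, and is
then applied to `𝓕 g`. -/
theorem fourier_modulate {g h : Lp ℂ 2 (volume : Measure ℝ)} {a : ℝ}
    (hh : h =ᵐ[volume] fun y => Complex.exp (2 * π * Complex.I * (a * y : ℝ)) * g y) :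
    (𝓕 h : Lp ℂ 2 (volume : Measure ℝ)) =ᵐ[volume]
      fun η => (𝓕 g : Lp ℂ 2 (volume : Measure ℝ)) (η - a) := by
  have hmp : MeasurePreserving (fun x : ℝ => x - a) volume volume := measurePreserving_sub_right _ a
  have hem : Measurable fun y : ℝ => Complex.exp (2 * π * Complex.I * (a * y : ℝ)) := by fun_prop
  have he1 : ∀ y : ℝ, ‖Complex.exp (2 * π * Complex.I * (a * y : ℝ))‖ = 1 := fun y => by
    rw [show 2 * π * Complex.I * ((a * y : ℝ) : ℂ) = ((2 * π * (a * y) : ℝ) : ℂ) * Complex.I by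
      push_cast; ring, Complex.norm_exp_ofReal_mul_I]
  have key : ∀ u : Lp ℂ 2 (volume : Measure ℝ),
      (𝓕⁻ (Lp.compMeasurePreserving _ hmp u) : Lp ℂ 2 (volume : Measure ℝ)) =
        unimodularMul _ hem he1 (𝓕⁻ u : Lp ℂ 2 (volume : Measure ℝ)) := by
    intro u
    refine DenseRange.induction_on
      (SchwartzMap.denseRange_toLpCLM (p := 2) ENNReal.ofNat_ne_top)
      (p := fun u : Lp ℂ 2 (volume : Measure ℝ) =>
        (𝓕⁻ (Lp.compMeasurePreserving _ hmp u) : Lp ℂ 2 (volume : Measure ℝ)) =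
        unimodularMul _ hem he1 (𝓕⁻ u : Lp ℂ 2 (volume : Measure ℝ))) u ?_ ?_
    · refine isClosed_eq ?_ ?_
      · exact (Lp.fourierTransformₗᵢ ℝ ℂ).symm.continuous.comp
          (Lp.isometry_compMeasurePreserving hmp).continuous
      · exact (continuous_unimodularMul _ hem he1).comp
          (Lp.fourierTransformₗᵢ ℝ ℂ).symm.continuous
    · intro s
      simp only [SchwartzMap.toLpCLM_apply]
      have e1 : Lp.compMeasurePreserving _ hmp (s.toLp 2 volume) =
          (s.compSubConstCLM ℂ a).toLp 2 volume := by
        refine Lp.ext ?_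
        filter_upwards [Lp.coeFn_compMeasurePreserving (s.toLp 2 volume) hmp,
          hmp.quasiMeasurePreserving.ae_eq_comp (SchwartzMap.coeFn_toLp s 2 volume),
          SchwartzMap.coeFn_toLp (s.compSubConstCLM ℂ a) 2 volume] with y h1 h2 h3
        rw [h1, h2, h3]; rfl
      rw [e1, SchwartzMap.toLp_fourierInv_eq, SchwartzMap.toLp_fourierInv_eq]
      refine Lp.ext ?_
      filter_upwards [SchwartzMap.coeFn_toLp (𝓕⁻ (s.compSubConstCLM ℂ a)) 2 volume,
        coeFn_unimodularMul _ hem he1 ((𝓕⁻ s).toLp 2 volume),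
        SchwartzMap.coeFn_toLp (𝓕⁻ s) 2 volume] with y h1 h2 h3
      rw [h1, h2, h3, fourier_compSubConst_apply]
  have h1 : h = unimodularMul _ hem he1 g :=
    Lp.ext (hh.trans (coeFn_unimodularMul _ hem he1 g).symm)
  have h2 := key (𝓕 g)
  rw [FourierTransform.fourierInv_fourier_eq, ← h1] at h2
  rw [← h2, FourierTransform.fourier_fourierInv_eq]
  exact Lp.coeFn_compMeasurePreserving _ hmp

/-- Density of Schwartz functions again. Conjugation is only real linear, so it is carried as a
continuous `ℝ`-linear map `S`. -/
theorem fourier_conj {g h : Lp ℂ 2 (volume : Measure ℝ)}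
    (hh : h =ᵐ[volume] fun y => starRingEnd ℂ (g y)) :
    (𝓕 h : Lp ℂ 2 (volume : Measure ℝ)) =ᵐ[volume]
      fun η => starRingEnd ℂ ((𝓕 g : Lp ℂ 2 (volume : Measure ℝ)) (-η)) := by
  have hmp : MeasurePreserving (fun x : ℝ => -x) volume volume := Measure.measurePreserving_neg _
  let S : ℂ →L[ℝ] ℂ := Complex.conjCLE.toContinuousLinearMap
  have key : ∀ u : Lp ℂ 2 (volume : Measure ℝ),
      (𝓕 (S.compLp u) : Lp ℂ 2 (volume : Measure ℝ)) =
        S.compLp (Lp.compMeasurePreserving _ hmp (𝓕 u : Lp ℂ 2 (volume : Measure ℝ))) := by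
    intro u
    refine DenseRange.induction_on
      (SchwartzMap.denseRange_toLpCLM (p := 2) ENNReal.ofNat_ne_top)
      (p := fun u : Lp ℂ 2 (volume : Measure ℝ) =>
        (𝓕 (S.compLp u) : Lp ℂ 2 (volume : Measure ℝ)) =
        S.compLp (Lp.compMeasurePreserving _ hmp (𝓕 u : Lp ℂ 2 (volume : Measure ℝ)))) u ?_ ?_
    · refine isClosed_eq ?_ ?_
      · exact (Lp.fourierTransformₗᵢ ℝ ℂ).continuous.comp (S.compLpL 2 volume).continuous
      · exact (S.compLpL 2 volume).continuous.comp
          ((Lp.isometry_compMeasurePreserving hmp).continuous.comp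
            (Lp.fourierTransformₗᵢ ℝ ℂ).continuous)
    · intro s
      simp only [SchwartzMap.toLpCLM_apply]
      have e1 : S.compLp (s.toLp 2 volume) = (s.postcompCLM S).toLp 2 volume := by
        refine Lp.ext ?_
        filter_upwards [S.coeFn_compLp (s.toLp 2 volume), SchwartzMap.coeFn_toLp s 2 volume,
          SchwartzMap.coeFn_toLp (s.postcompCLM S) 2 volume] with y h1 h2 h3
        rw [h1, h2, h3]; rfl
      rw [e1, SchwartzMap.toLp_fourier_eq, SchwartzMap.toLp_fourier_eq]
      refine Lp.ext ?_
      filter_upwards [SchwartzMap.coeFn_toLp (𝓕 (s.postcompCLM S)) 2 volume,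
        S.coeFn_compLp (Lp.compMeasurePreserving _ hmp ((𝓕 s).toLp 2 volume)),
        Lp.coeFn_compMeasurePreserving ((𝓕 s).toLp 2 volume) hmp,
        hmp.quasiMeasurePreserving.ae_eq_comp (SchwartzMap.coeFn_toLp (𝓕 s) 2 volume)]
        with y h1 h2 h3 h4
      rw [h1, h2, h3, h4, Function.comp_apply, SchwartzMap.fourier_coe, SchwartzMap.fourier_coe,
        Real.fourier_eq', Real.fourier_eq']
      change _ = starRingEnd ℂ _
      rw [← integral_conj]
      refine integral_congr_ae (Eventually.of_forall fun v => ?_)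
      change _ * starRingEnd ℂ (s v) = _
      simp only [smul_eq_mul, map_mul, ← Complex.exp_conj]
      congr 2
      simp only [inner, neg_mul, mul_neg, neg_neg, map_neg, map_mul, Complex.conj_I,
        Complex.conj_ofReal, Complex.ofReal_neg, Complex.ofReal_mul, Complex.ofReal_ofNat,
        map_ofNat]
  have h1 : h = S.compLp g := Lp.ext (hh.trans (EventuallyEq.symm (S.coeFn_compLp g)))
  rw [h1, key]
  filter_upwards
    [S.coeFn_compLp (Lp.compMeasurePreserving _ hmp (𝓕 g : Lp ℂ 2 (volume : Measure ℝ))),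
    Lp.coeFn_compMeasurePreserving (𝓕 g : Lp ℂ 2 (volume : Measure ℝ)) hmp] with y h2 h3
  rw [h2, h3]; rfl

/-! ### Plancherel's theorem on the channel and the Fourier isometry -/

theorem ae_slice {p : Channel → Prop} (h : ∀ᵐ q : Channel, p q) :
    ∀ᵐ y : ℝ, ∀ᵐ x : AddCircle (2 * π), p (x, y) := by
  have h1 : ∀ᵐ q ∂((volume : Measure ℝ).prod (volume : Measure (AddCircle (2 * π)))), p q.swap :=
    Measure.measurePreserving_swap.quasiMeasurePreserving.ae h
  exact Measure.ae_ae_of_ae_prod h1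

theorem ae_haar_of_ae {p : AddCircle (2 * π) → Prop} (h : ∀ᵐ x, p x) :
    ∀ᵐ x ∂(@AddCircle.haarAddCircle (2 * π) _), p x := by
  rw [AddCircle.volume_eq_smul_haarAddCircle] at h
  exact (Measure.absolutelyContinuous_smul (by simp [Real.pi_pos])).ae_le h

theorem modeCoeff_congr_ae {f g : Channel → ℝ} (h : f =ᵐ[volume] g) (k : ℤ) :
    modeCoeff f k =ᵐ[volume] modeCoeff g k := by
  filter_upwards [ae_slice h] with y hy
  refine fourierCoeff_congr_ae ?_ |> fun h => congrFun h k
  filter_upwards [ae_haar_of_ae hy] with x hx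
  rw [hx]

theorem channelFourier_of_memLp {f : Channel → ℝ} (hf : MemLp f 2 volume) (k : ℤ) (ξ : ℝ) :
    channelFourier f k ξ =
      (𝓕 ((memLp_modeCoeff hf k).toLp (modeCoeff f k)) : Lp ℂ 2 (volume : Measure ℝ))
        (ξ / (2 * π)) := by
  rw [channelFourier, dif_pos hf]

theorem channelFourier_congr_ae {f g : Channel → ℝ} (h : f =ᵐ[volume] g) :
    channelFourier f = channelFourier g := by
  by_cases hf : MemLp f 2 volume
  · have hg : MemLp g 2 volume := hf.ae_eq h
    funext k ξ
    rw [channelFourier_of_memLp hf, channelFourier_of_memLp hg,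
      (MemLp.toLp_eq_toLp_iff _ _).2 (modeCoeff_congr_ae h k)]
  · have hg : ¬ MemLp g 2 volume := fun hg => hf (hg.ae_eq h.symm)
    funext k ξ
    rw [channelFourier, channelFourier, dif_neg hf, dif_neg hg]

theorem lintegral_comp_div_two_pi (F : ℝ → ℝ≥0∞) :
    ∫⁻ ξ, F (ξ / (2 * π)) = ENNReal.ofReal (2 * π) * ∫⁻ η, F η := by
  have h0 : (2 * π)⁻¹ ≠ 0 := by positivity
  have h := Real.map_volume_mul_right h0
  have h1 := (Homeomorph.mulRight₀ _ h0).toMeasurableEquiv.measurableEmbedding.lintegral_map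
    (μ := (volume : Measure ℝ)) F
  have h2 : Measure.map (⇑(Homeomorph.mulRight₀ _ h0).toMeasurableEquiv) (volume : Measure ℝ) =
      Measure.map (fun x => x * (2 * π)⁻¹) volume := rfl
  rw [h2, h, lintegral_smul_measure, inv_inv, abs_of_pos (by positivity)] at h1
  simp only [div_eq_mul_inv]
  exact h1.symm

theorem quasiMeasurePreserving_div_two_pi :
    Measure.QuasiMeasurePreserving (fun ξ : ℝ => ξ / (2 * π)) volume volume := by
  refine ⟨by fun_prop, ?_⟩
  have h0 : (2 * π)⁻¹ ≠ 0 := by positivity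
  simp only [div_eq_mul_inv]
  rw [Real.map_volume_mul_right h0]
  exact Measure.smul_absolutelyContinuous

theorem eLpNorm_sq_eq_lintegral {X E : Type*} [MeasurableSpace X] {μ : Measure X}
    [NormedAddCommGroup E] (f : X → E) : eLpNorm f 2 μ ^ 2 = ∫⁻ x, ‖f x‖ₑ ^ 2 ∂μ := by
  rw [eLpNorm_eq_lintegral_rpow_enorm_toReal (by norm_num) (by norm_num)]
  simp only [ENNReal.toReal_ofNat, ENNReal.rpow_ofNat]
  rw [← ENNReal.rpow_natCast, ← ENNReal.rpow_mul]
  norm_num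

theorem aestronglyMeasurable_channelFourier (f : Channel → ℝ) (k : ℤ) :
    AEStronglyMeasurable (channelFourier f k) volume := by
  by_cases hf : MemLp f 2 volume
  · have : channelFourier f k = fun ξ =>
      (𝓕 ((memLp_modeCoeff hf k).toLp (modeCoeff f k)) : Lp ℂ 2 (volume : Measure ℝ))
        (ξ / (2 * π)) := by
      funext ξ; exact channelFourier_of_memLp hf k ξ
    rw [this]
    exact (Lp.aestronglyMeasurable _).comp_quasiMeasurePreserving quasiMeasurePreserving_div_two_pi
  · have : channelFourier f k = fun _ => 0 := by
      funext ξ; rw [channelFourier, dif_neg hf]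
    rw [this]
    exact aestronglyMeasurable_const

theorem lintegral_channelFourier_sq {f : Channel → ℝ} (hf : MemLp f 2 volume) (k : ℤ) :
    ∫⁻ ξ, ‖channelFourier f k ξ‖ₑ ^ 2 =
      ENNReal.ofReal (2 * π) * ∫⁻ y, ‖modeCoeff f k y‖ₑ ^ 2 := by
  simp only [channelFourier_of_memLp hf]
  rw [lintegral_comp_div_two_pi (fun η => ‖(𝓕 ((memLp_modeCoeff hf k).toLp (modeCoeff f k)) :
    Lp ℂ 2 (volume : Measure ℝ)) η‖ₑ ^ 2), ← eLpNorm_sq_eq_lintegral, ← eLpNorm_sq_eq_lintegral,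
    ← Lp.enorm_def, ← ofReal_norm, Lp.norm_fourier_eq, ofReal_norm, Lp.enorm_toLp]

/-- Parseval on the circle. The factor `2π` passes from the normalized Haar measure to `dx`; it is
the same factor that rescaling `η = ξ / 2π` produces in `lintegral_channelFourier_sq`, so that none
is left in the combined identity. -/
theorem lintegral_slice_sq {f : AddCircle (2 * π) → ℝ} (hf : MemLp f 2 volume) :
    ENNReal.ofReal (2 * π) * ∑' k : ℤ, ‖fourierCoeff (fun x => (f x : ℂ)) k‖ₑ ^ 2 =
      ∫⁻ x, ‖f x‖ₑ ^ 2 := by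
  have hh : MemLp (fun x => (f x : ℂ)) 2 (@AddCircle.haarAddCircle (2 * π) _) :=
    memLp_haarAddCircle_iff.2 hf.ofReal
  have hs := hasSum_sq_fourierCoeff hh.toLp
  rw [fourierCoeff_congr_ae hh.coeFn_toLp] at hs
  have h1 : ∑' k : ℤ, ‖fourierCoeff (fun x => (f x : ℂ)) k‖ₑ ^ 2 =
      ENNReal.ofReal (∫ x, ‖hh.toLp _ x‖ ^ 2 ∂(@AddCircle.haarAddCircle (2 * π) _)) := by
    rw [← hs.tsum_eq, ENNReal.ofReal_tsum_of_nonneg (fun _ => by positivity) hs.summable]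
    refine tsum_congr fun k => ?_
    rw [ENNReal.ofReal_pow (norm_nonneg _), ofReal_norm]
  have h2 : ∫ x, ‖hh.toLp _ x‖ ^ 2 ∂(@AddCircle.haarAddCircle (2 * π) _) =
      ∫ x, ‖f x‖ ^ 2 ∂(@AddCircle.haarAddCircle (2 * π) _) := by
    refine integral_congr_ae ?_
    filter_upwards [hh.coeFn_toLp] with x hx
    rw [hx, Complex.norm_real]
  rw [h1, h2, AddCircle.integral_haarAddCircle, smul_eq_mul,
    ← ENNReal.ofReal_mul (by positivity), mul_inv_cancel_left₀ (by positivity),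
    ofReal_integral_eq_lintegral_ofReal hf.norm.integrable_sq
      (Eventually.of_forall fun _ => by positivity)]
  refine lintegral_congr fun x => ?_
  rw [ENNReal.ofReal_pow (norm_nonneg _), ofReal_norm]

/-- Plancherel's theorem on the channel. -/
theorem tsum_lintegral_channelFourier_sq {f : Channel → ℝ} (hf : MemLp f 2 volume) :
    ∑' k : ℤ, ∫⁻ ξ, ‖channelFourier f k ξ‖ₑ ^ 2 = ∫⁻ p, ‖f p‖ₑ ^ 2 := by
  simp only [lintegral_channelFourier_sq hf]
  rw [ENNReal.tsum_mul_left, ← lintegral_tsum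
    (fun k => ((memLp_modeCoeff hf k).aestronglyMeasurable.enorm.pow_const 2))]
  have hm : AEMeasurable (fun p : Channel => ‖f p‖ₑ ^ 2) ((volume : Measure (AddCircle (2 * π))).prod
    (volume : Measure ℝ)) := hf.aestronglyMeasurable.enorm.pow_const 2
  rw [Measure.volume_eq_prod, lintegral_prod_symm _ hm, ← lintegral_const_mul'' _
    (AEMeasurable.tsum fun k =>
      ((memLp_modeCoeff hf k).aestronglyMeasurable.enorm.pow_const 2))]
  refine lintegral_congr_ae ?_
  have hsq : Integrable (fun p : Channel => f p ^ 2) volume := hf.integrable_sq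
  have hslm : ∀ᵐ y : ℝ, AEStronglyMeasurable (fun x => f (x, y)) volume :=
    hf.aestronglyMeasurable.prod_swap.prodMk_left
  filter_upwards [hsq.prod_left_ae, hslm] with y hy hm
  exact lintegral_slice_sq ((memLp_two_iff_integrable_sq hm).2 hy)

theorem memLp_channelFourier (f : Channel → ℝ) (k : ℤ) : MemLp (channelFourier f k) 2 volume := by
  refine ⟨aestronglyMeasurable_channelFourier f k, ?_⟩
  by_cases hf : MemLp f 2 volume
  · have h : eLpNorm (channelFourier f k) 2 volume ^ 2 ≤ eLpNorm f 2 volume ^ 2 := by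
      rw [eLpNorm_sq_eq_lintegral, eLpNorm_sq_eq_lintegral, ← tsum_lintegral_channelFourier_sq hf]
      exact ENNReal.le_tsum k
    exact ((ENNReal.pow_le_pow_left_iff two_ne_zero).1 h).trans_lt hf.eLpNorm_lt_top
  · have : channelFourier f k = fun _ => 0 := by
      funext ξ; rw [channelFourier, dif_neg hf]
    rw [this]
    simp

/-- Real square integrable functions on the channel. -/
abbrev ChannelL2 : Type := Lp ℝ 2 (volume : Measure Channel)

theorem modeCoeff_add {f g : Channel → ℝ} (hf : MemLp f 2 volume) (hg : MemLp g 2 volume) (k : ℤ) :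
    modeCoeff (f + g) k =ᵐ[volume] modeCoeff f k + modeCoeff g k := by
  have key : ∀ {f : Channel → ℝ}, MemLp f 2 volume →
      ∀ᵐ y : ℝ, Integrable (fun x => (f (x, y) : ℂ)) (@AddCircle.haarAddCircle (2 * π) _) := by
    intro f hf
    have hsq : Integrable (fun p : Channel => f p ^ 2) volume := hf.integrable_sq
    have hslm : ∀ᵐ y : ℝ, AEStronglyMeasurable (fun x => f (x, y)) volume :=
      hf.aestronglyMeasurable.prod_swap.prodMk_left
    filter_upwards [hsq.prod_left_ae, hslm] with y hy hm
    exact (memLp_haarAddCircle_iff.2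
      ((memLp_two_iff_integrable_sq hm).2 hy).ofReal).integrable one_le_two
  filter_upwards [key hf, key hg] with y h1 h2
  have := congrFun (fourierCoeff.add h1 h2) k
  simp only [Pi.add_apply] at this
  rw [Pi.add_apply, modeCoeff, modeCoeff, modeCoeff, ← this]
  congr 1
  funext x
  simp

theorem modeCoeff_smul (c : ℝ) (f : Channel → ℝ) (k : ℤ) :
    modeCoeff (c • f) k = (c : ℂ) • modeCoeff f k := by
  funext y
  rw [Pi.smul_apply, modeCoeff, modeCoeff, ← fourierCoeff.const_smul]
  congr 1
  funext x
  simp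

theorem channelFourier_add {f g : Channel → ℝ} (hf : MemLp f 2 volume) (hg : MemLp g 2 volume)
    (k : ℤ) : channelFourier (f + g) k =ᵐ[volume] channelFourier f k + channelFourier g k := by
  have h : (memLp_modeCoeff (hf.add hg) k).toLp (modeCoeff (f + g) k) =
      (memLp_modeCoeff hf k).toLp (modeCoeff f k) + (memLp_modeCoeff hg k).toLp (modeCoeff g k) := by
    rw [← MemLp.toLp_add]
    exact (MemLp.toLp_eq_toLp_iff _ _).2 (modeCoeff_add hf hg k)
  have h2 := Lp.coeFn_add
    (𝓕 ((memLp_modeCoeff hf k).toLp (modeCoeff f k)) : Lp ℂ 2 (volume : Measure ℝ))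
    (𝓕 ((memLp_modeCoeff hg k).toLp (modeCoeff g k)) : Lp ℂ 2 (volume : Measure ℝ))
  filter_upwards [quasiMeasurePreserving_div_two_pi.ae h2] with ξ h3
  rw [Pi.add_apply, channelFourier_of_memLp (hf.add hg), channelFourier_of_memLp hf,
    channelFourier_of_memLp hg, h, FourierTransform.fourier_add, h3, Pi.add_apply]

theorem channelFourier_smul (c : ℝ) {f : Channel → ℝ} (hf : MemLp f 2 volume) (k : ℤ) :
    channelFourier (c • f) k =ᵐ[volume] c • channelFourier f k := by
  have h : (memLp_modeCoeff (hf.const_smul c) k).toLp (modeCoeff (c • f) k) =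
      (c : ℂ) • (memLp_modeCoeff hf k).toLp (modeCoeff f k) := by
    rw [← MemLp.toLp_const_smul]
    exact (MemLp.toLp_eq_toLp_iff _ _).2 (by rw [modeCoeff_smul])
  have h2 := Lp.coeFn_smul (c : ℂ)
    (𝓕 ((memLp_modeCoeff hf k).toLp (modeCoeff f k)) : Lp ℂ 2 (volume : Measure ℝ))
  filter_upwards [quasiMeasurePreserving_div_two_pi.ae h2] with ξ h3
  rw [Pi.smul_apply, channelFourier_of_memLp (hf.const_smul c), channelFourier_of_memLp hf, h,
    FourierTransform.fourier_smul, h3, Pi.smul_apply, Complex.coe_smul]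

/-- The transform of `f` at the mode `k`, as an element of `L²(ℝ)`. -/
def modeFourier (f : ChannelL2) (k : ℤ) : Lp ℂ 2 (volume : Measure ℝ) :=
  (memLp_channelFourier f k).toLp

theorem coeFn_modeFourier (f : ChannelL2) (k : ℤ) :
    modeFourier f k =ᵐ[volume] channelFourier f k := MemLp.coeFn_toLp _

theorem modeFourier_add (f g : ChannelL2) (k : ℤ) :
    modeFourier (f + g) k = modeFourier f k + modeFourier g k := by
  rw [modeFourier, modeFourier, modeFourier, ← MemLp.toLp_add]
  refine (MemLp.toLp_eq_toLp_iff _ _).2 ?_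
  rw [channelFourier_congr_ae (Lp.coeFn_add f g)]
  exact channelFourier_add (Lp.memLp f) (Lp.memLp g) k

theorem modeFourier_smul (c : ℝ) (f : ChannelL2) (k : ℤ) :
    modeFourier (c • f) k = c • modeFourier f k := by
  rw [modeFourier, modeFourier, ← MemLp.toLp_const_smul]
  refine (MemLp.toLp_eq_toLp_iff _ _).2 ?_
  rw [channelFourier_congr_ae (Lp.coeFn_smul c f)]
  exact channelFourier_smul c (Lp.memLp f) k

theorem enorm_modeFourier_sq (f : ChannelL2) (k : ℤ) :
    ‖modeFourier f k‖ₑ ^ 2 = ∫⁻ ξ, ‖channelFourier f k ξ‖ₑ ^ 2 := by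
  rw [modeFourier, Lp.enorm_toLp, eLpNorm_sq_eq_lintegral]

theorem hasSum_norm_modeFourier_sq (f : ChannelL2) :
    HasSum (fun k => ‖modeFourier f k‖ ^ 2) (‖f‖ ^ 2) := by
  have h : ∑' k, ENNReal.ofReal (‖modeFourier f k‖ ^ 2) = ENNReal.ofReal (‖f‖ ^ 2) := by
    simp only [ENNReal.ofReal_pow (norm_nonneg _), ofReal_norm, enorm_modeFourier_sq]
    rw [tsum_lintegral_channelFourier_sq (Lp.memLp f), Lp.enorm_def, eLpNorm_sq_eq_lintegral]
  have hsum : Summable fun k => ‖modeFourier f k‖ ^ 2 := by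
    refine (ENNReal.summable_toReal (f := fun k => ENNReal.ofReal (‖modeFourier f k‖ ^ 2))
      (by rw [h]; exact ENNReal.ofReal_ne_top)).congr fun k => ?_
    rw [ENNReal.toReal_ofReal (by positivity)]
  have h2 := ENNReal.ofReal_tsum_of_nonneg (fun k => by positivity) hsum
  rw [h, ENNReal.ofReal_eq_ofReal_iff (tsum_nonneg fun _ => by positivity) (by positivity)] at h2
  exact h2 ▸ hsum.hasSum

/-- Square summable sequences of square integrable functions of the frequency. -/
abbrev FrequencyL2 : Type := lp (fun _ : ℤ => Lp ℂ 2 (volume : Measure ℝ)) 2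

/-- The Fourier transform on the channel as a real linear isometry. -/
def fourierIsometry : ChannelL2 →ₗᵢ[ℝ] FrequencyL2 where
  toFun f := ⟨fun k => modeFourier f k, memℓp_gen (by
    simpa using (hasSum_norm_modeFourier_sq f).summable)⟩
  map_add' f g := lp.ext (funext fun k => modeFourier_add f g k)
  map_smul' c f := lp.ext (funext fun k => modeFourier_smul c f k)
  norm_map' f := by
    have h := lp.norm_rpow_eq_tsum (p := 2) (by norm_num)
      (⟨fun k => modeFourier f k, memℓp_gen (by
        simpa using (hasSum_norm_modeFourier_sq f).summable)⟩ : FrequencyL2)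
    simp only [ENNReal.toReal_ofNat, Real.rpow_ofNat] at h
    rw [(hasSum_norm_modeFourier_sq f).tsum_eq] at h
    exact (sq_eq_sq₀ (norm_nonneg _) (norm_nonneg _)).1 h

theorem fourierIsometry_apply (f : ChannelL2) (k : ℤ) : fourierIsometry f k = modeFourier f k := rfl

theorem channelL2_ext_of_channelFourier {f g : ChannelL2}
    (h : ∀ k, channelFourier f k =ᵐ[volume] channelFourier g k) : f = g :=
  fourierIsometry.injective (lp.ext (funext fun k => Lp.ext
    ((coeFn_modeFourier f k).trans ((h k).trans (coeFn_modeFourier g k).symm))))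

/-- Polarization of Plancherel's theorem. It lets multipliers be moved across pairings frequency by
frequency. -/
theorem inner_eq_tsum_channelFourier (f g : ChannelL2) :
    inner ℝ f g = ∑' k : ℤ, ∫ ξ, inner ℝ (channelFourier f k ξ) (channelFourier g k ξ) := by
  rw [← fourierIsometry.inner_map_map, lp.inner_eq_tsum]
  refine tsum_congr fun k => ?_
  rw [fourierIsometry_apply, fourierIsometry_apply, L2.inner_def]
  refine integral_congr_ae ?_
  filter_upwards [coeFn_modeFourier f k, coeFn_modeFourier g k] with ξ h1 h2
  rw [h1, h2]

/-! ### Prescribing the transform of a real function -/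

theorem memLp_re_fourier_mul (g : Lp ℂ 2 (volume : Measure ℝ)) (k : ℤ) :
    MemLp (fun p : Channel => (fourier k p.1 * g p.2).re) 2 volume := by
  have h1 : MemLp (fun p : Channel => g p.2) 2 volume := (Lp.memLp g).comp_snd _
  refine h1.of_le ?_ (Eventually.of_forall fun p => ?_)
  · refine Complex.continuous_re.comp_aestronglyMeasurable (AEStronglyMeasurable.mul ?_ h1.1)
    exact ((fourier k).continuous.comp continuous_fst).aestronglyMeasurable
  · refine (Complex.abs_re_le_norm _).trans ?_
    have : ‖(fourier k p.1 : ℂ)‖ = 1 := Circle.norm_coe _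
    rw [norm_mul, this, one_mul]

theorem modeCoeff_re_fourier_mul (g : ℝ → ℂ) (k j : ℤ) (y : ℝ) :
    modeCoeff (fun p : Channel => (fourier k p.1 * g p.2).re) j y =
      (if j = k then g y else 0) / 2 + (if j = -k then starRingEnd ℂ (g y) else 0) / 2 := by
  have h1 : (fun x : AddCircle (2 * π) => (((fourier k x * g y).re : ℝ) : ℂ)) =
      (fun x => g y / 2 * fourier k x) + fun x => starRingEnd ℂ (g y) / 2 * fourier (-k) x := by
    funext x
    rw [Complex.re_eq_add_conj, Pi.add_apply, map_mul, fourier_neg]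
    ring
  have hi : ∀ (c : ℂ) (m : ℤ), Integrable (fun x => c * fourier m x)
      (@AddCircle.haarAddCircle (2 * π) _) := fun c m =>
    (Continuous.integrable_of_hasCompactSupport (by fun_prop)
      (HasCompactSupport.of_compactSpace _))
  rw [modeCoeff]
  change fourierCoeff (fun x : AddCircle (2 * π) => (((fourier k x * g y).re : ℝ) : ℂ)) j = _
  rw [h1, fourierCoeff.add (hi _ _) (hi _ _), Pi.add_apply, fourierCoeff.const_mul,
    fourierCoeff.const_mul, fourierCoeff_fourier, fourierCoeff_fourier, Pi.single_apply,
    Pi.single_apply]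
  split_ifs <;> ring

/-- The function is `Re (e^{ikx} g(y))` with `g` the inverse transform of `F`. Taking the real part
splits it evenly between the modes `k` and `-k`; for `k = 0` the two halves fall on the same mode.
-/
theorem exists_channelFourier_eq_single {F : ℝ → ℂ} (hF : MemLp F 2 volume) (k : ℤ) :
    ∃ u : ChannelL2, ∀ j : ℤ, channelFourier u j =ᵐ[volume] fun ξ =>
      (if j = k then F ξ else 0) / 2 + (if j = -k then starRingEnd ℂ (F (-ξ)) else 0) / 2 := by
  have hpi : (2 * π) ≠ 0 := by positivity
  have hqm : Measure.QuasiMeasurePreserving (fun η : ℝ => (2 * π) * η) volume volume := by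
    refine ⟨by fun_prop, ?_⟩
    rw [Real.map_volume_mul_left hpi]
    exact Measure.smul_absolutelyContinuous
  have hG : MemLp (fun η => F ((2 * π) * η)) 2 volume := by
    refine ⟨hF.1.comp_quasiMeasurePreserving hqm, ?_⟩
    have h1 : eLpNorm (fun η => F ((2 * π) * η)) 2 volume ^ 2 < ∞ := by
      rw [eLpNorm_sq_eq_lintegral]
      have h2 := lintegral_comp_div_two_pi fun η => ‖F ((2 * π) * η)‖ₑ ^ 2
      simp only [mul_div_cancel₀ _ hpi] at h2
      rw [← eLpNorm_sq_eq_lintegral] at h2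
      by_contra h3
      rw [not_lt, top_le_iff] at h3
      rw [h3, ENNReal.mul_top (by simp [Real.pi_pos])] at h2
      exact (ENNReal.pow_lt_top hF.2).ne h2
    by_contra h3
    rw [not_lt, top_le_iff] at h3
    rw [h3] at h1
    simp at h1
  set G : Lp ℂ 2 (volume : Measure ℝ) := hG.toLp with hGdef
  set g : Lp ℂ 2 (volume : Measure ℝ) := 𝓕⁻ G with hg
  have hgG : (𝓕 g : Lp ℂ 2 (volume : Measure ℝ)) = G := FourierTransform.fourier_fourierInv_eq _
  have hcj : MemLp (fun y => starRingEnd ℂ (g y)) 2 volume :=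
    (Lp.memLp g).of_le (Complex.continuous_conj.comp_aestronglyMeasurable (Lp.aestronglyMeasurable g))
      (Eventually.of_forall fun y => by simp)
  refine ⟨(memLp_re_fourier_mul g k).toLp, fun j => ?_⟩
  rw [channelFourier_congr_ae (memLp_re_fourier_mul g k).coeFn_toLp]
  have e1 : (memLp_modeCoeff (memLp_re_fourier_mul g k) j).toLp
      (modeCoeff (fun p : Channel => (fourier k p.1 * g p.2).re) j) =
      (if j = k then (1 / 2 : ℂ) else 0) • g + (if j = -k then (1 / 2 : ℂ) else 0) • hcj.toLp := by
    refine Lp.ext ?_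
    filter_upwards [(memLp_modeCoeff (memLp_re_fourier_mul g k) j).coeFn_toLp,
      Lp.coeFn_add ((if j = k then (1 / 2 : ℂ) else 0) • g)
        ((if j = -k then (1 / 2 : ℂ) else 0) • hcj.toLp),
      Lp.coeFn_smul (if j = k then (1 / 2 : ℂ) else 0) g,
      Lp.coeFn_smul (if j = -k then (1 / 2 : ℂ) else 0) hcj.toLp, hcj.coeFn_toLp]
      with y h1 h2 h3 h4 h5
    rw [h1, h2, Pi.add_apply, h3, h4, Pi.smul_apply, Pi.smul_apply, h5, modeCoeff_re_fourier_mul]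
    split_ifs <;> simp <;> ring
  have hconj := fourier_conj (g := g) hcj.coeFn_toLp
  have hsum := Lp.coeFn_add ((if j = k then (1 / 2 : ℂ) else 0) • (𝓕 g : Lp ℂ 2 (volume : Measure ℝ)))
    ((if j = -k then (1 / 2 : ℂ) else 0) • (𝓕 hcj.toLp : Lp ℂ 2 (volume : Measure ℝ)))
  have hneg : Measure.QuasiMeasurePreserving (fun η : ℝ => -η) volume volume :=
    (Measure.measurePreserving_neg _).quasiMeasurePreserving
  filter_upwards [quasiMeasurePreserving_div_two_pi.ae hsum,
    quasiMeasurePreserving_div_two_pi.ae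
      (Lp.coeFn_smul (if j = k then (1 / 2 : ℂ) else 0) (𝓕 g : Lp ℂ 2 (volume : Measure ℝ))),
    quasiMeasurePreserving_div_two_pi.ae (Lp.coeFn_smul (if j = -k then (1 / 2 : ℂ) else 0)
      (𝓕 hcj.toLp : Lp ℂ 2 (volume : Measure ℝ))),
    quasiMeasurePreserving_div_two_pi.ae hconj,
    quasiMeasurePreserving_div_two_pi.ae hG.coeFn_toLp,
    quasiMeasurePreserving_div_two_pi.ae (hneg.ae hG.coeFn_toLp)] with ξ h1 h2 h3 h4 h5 h6
  rw [channelFourier_of_memLp (memLp_re_fourier_mul g k), e1, FourierTransform.fourier_add,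
    FourierTransform.fourier_smul, FourierTransform.fourier_smul, h1, Pi.add_apply, h2, h3,
    Pi.smul_apply, Pi.smul_apply, h4, hgG, hGdef, h5, h6]
  have e2 : 2 * π * (ξ / (2 * π)) = ξ := mul_div_cancel₀ _ hpi
  have e3 : 2 * π * -(ξ / (2 * π)) = -ξ := by rw [mul_neg, e2]
  rw [e2, e3]
  split_ifs <;> simp <;> ring

/-- Every square integrable function of the frequency with the symmetry of the transform of a real
function is the transform of a real function. -/
theorem exists_channelFourier_eq {F : ℤ → ℝ → ℂ} (hF : ∀ k, MemLp (F k) 2 volume)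
    (hs : ∑' k, ∫⁻ ξ, ‖F k ξ‖ₑ ^ 2 ≠ ∞)
    (hsym : ∀ k, ∀ᵐ ξ, F (-k) (-ξ) = starRingEnd ℂ (F k ξ)) :
    ∃ f : ChannelL2, ∀ k, channelFourier f k =ᵐ[volume] F k := by
  have hneg : Measure.QuasiMeasurePreserving (fun η : ℝ => -η) volume volume :=
    (Measure.measurePreserving_neg _).quasiMeasurePreserving
  have hmem : Memℓp (fun k => (hF k).toLp : ∀ _ : ℤ, Lp ℂ 2 (volume : Measure ℝ)) 2 := by
    refine memℓp_gen ?_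
    refine (ENNReal.summable_toReal hs).congr fun k => ?_
    rw [← eLpNorm_sq_eq_lintegral, Lp.norm_toLp]
    simp
  set V : FrequencyL2 := ⟨fun k => (hF k).toLp, hmem⟩ with hV
  have hVk : ∀ k, V k = (hF k).toLp := fun k => rfl
  choose u hu using fun k => exists_channelFourier_eq_single (hF k) k
  -- By the symmetry `hsym` the conjugate half of `u k` is half of the prescribed function at `-k`.
  have hu2 : ∀ k, fourierIsometry (u k) =
      (1 / 2 : ℝ) • lp.single 2 k (V k) + (1 / 2 : ℝ) • lp.single 2 (-k) (V (-k)) := by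
    intro k
    refine lp.ext (funext fun j => ?_)
    rw [fourierIsometry_apply]
    have hsing : ∀ m : ℤ, (lp.single 2 m (V m) : FrequencyL2) j =
        (if j = m then (1 : ℝ) else 0) • (hF j).toLp := by
      intro m
      by_cases h : j = m
      · subst h
        rw [lp.single_apply_self, if_pos rfl, one_smul, hVk]
      · rw [lp.single_apply_ne _ _ _ h, if_neg h, zero_smul]
    simp only [lp.coeFn_add, lp.coeFn_smul, Pi.add_apply, Pi.smul_apply, hsing, smul_smul,
      ← add_smul]
    refine Lp.ext ((coeFn_modeFourier _ _).trans ((hu k j).trans ?_))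
    filter_upwards [Lp.coeFn_smul (1 / 2 * (if j = k then (1 : ℝ) else 0) +
      1 / 2 * (if j = -k then (1 : ℝ) else 0)) (hF j).toLp, (hF j).coeFn_toLp,
      hneg.ae (hsym k)] with ξ a1 a2 a3
    rw [a1, Pi.smul_apply, a2, ← a3, neg_neg]
    have c1 : ∀ m : ℤ, (if j = m then F m ξ else 0) = ((if j = m then (1 : ℝ) else 0 : ℝ) : ℂ) * F j ξ := by
      intro m
      by_cases h : j = m
      · subst h; simp
      · simp [h]
    rw [c1, c1, Complex.real_smul]
    push_cast
    ring
  -- The sum over all `k` meets each mode twice, once from `k` and once from `-k`, each time with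
  -- weight `1/2`.
  have hsum : HasSum (fun k => fourierIsometry (u k)) V := by
    have h1 := lp.hasSum_single (p := 2) (by norm_num) V
    have h2 : HasSum (fun k : ℤ => lp.single 2 (-k) (V (-k))) V :=
      (Equiv.neg ℤ).hasSum_iff.2 h1
    have h3 := (h1.const_smul (1 / 2 : ℝ)).add (h2.const_smul (1 / 2 : ℝ))
    simp only [← hu2] at h3
    convert h3 using 1
    rw [← add_smul]
    norm_num
  have hcl : IsClosed (Set.range fourierIsometry) := fourierIsometry.isometry.isClosedEmbedding.isClosed_range
  -- The range of an isometry of a complete space is closed, so it contains the limit of the partial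
  -- sums.
  have hmemr : V ∈ Set.range fourierIsometry := by
    refine hcl.mem_of_tendsto hsum (Eventually.of_forall fun s => ?_)
    exact ⟨∑ k ∈ s, u k, by rw [map_sum]⟩
  obtain ⟨f, hf⟩ := hmemr
  refine ⟨f, fun k => (coeFn_modeFourier f k).symm.trans ?_⟩
  rw [← fourierIsometry_apply, hf, hVk]
  exact (hF k).coeFn_toLp

/-! ### Shears of the channel -/

theorem measurePreserving_shear (a : ℝ) :
    MeasurePreserving (fun p : Channel => (p.1 + ((a * p.2 : ℝ) : AddCircle (2 * π)), p.2))
      volume volume := by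
  have h1 : MeasurePreserving (fun q : ℝ × AddCircle (2 * π) =>
      (q.1, q.2 + ((a * q.1 : ℝ) : AddCircle (2 * π))))
      ((volume : Measure ℝ).prod (volume : Measure (AddCircle (2 * π))))
      ((volume : Measure ℝ).prod (volume : Measure (AddCircle (2 * π)))) := by
    refine MeasurePreserving.skew_product (MeasurePreserving.id _)
      (g := fun y x => x + ((a * y : ℝ) : AddCircle (2 * π))) ?_ (Eventually.of_forall fun y => ?_)
    · refine Continuous.measurable ?_
      exact continuous_snd.add
        ((AddCircle.continuous_mk' _).comp (continuous_const.mul continuous_fst))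
    · exact (measurePreserving_add_right volume _).map_eq
  exact Measure.measurePreserving_swap.comp (h1.comp Measure.measurePreserving_swap)

theorem modeCoeff_shear (f : Channel → ℝ) (a : ℝ) (k : ℤ) (y : ℝ) :
    modeCoeff (fun p => f (p.1 + ((a * p.2 : ℝ) : AddCircle (2 * π)), p.2)) k y =
      Complex.exp (2 * π * Complex.I * ((k * a / (2 * π)) * y : ℝ)) * modeCoeff f k y := by
  rw [modeCoeff, modeCoeff, fourierCoeff, fourierCoeff, ← integral_const_mul,
    ← integral_add_right_eq_self (fun x : AddCircle (2 * π) => Complex.exp (2 * π * Complex.I *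
      ((k * a / (2 * π)) * y : ℝ)) * (fourier (-k) x • ((f (x, y) : ℝ) : ℂ)))
      ((a * y : ℝ) : AddCircle (2 * π))]
  refine integral_congr_ae (Eventually.of_forall fun x => ?_)
  have hpi : (π : ℂ) ≠ 0 := by exact_mod_cast Real.pi_ne_zero
  have h1 : (fourier (-k) (x + ((a * y : ℝ) : AddCircle (2 * π))) : ℂ) =
      fourier (-k) x * fourier (-k) ((a * y : ℝ) : AddCircle (2 * π)) := by
    simp only [fourier_apply, smul_add, AddCircle.toCircle_add, Circle.coe_mul]
  simp only [h1, smul_eq_mul]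
  rw [fourier_coe_apply]
  have h2 : Complex.exp (2 * π * Complex.I * ((k * a / (2 * π)) * y : ℝ)) *
      Complex.exp (2 * π * Complex.I * ((-k : ℤ) : ℂ) * ((a * y : ℝ) : ℂ) / ((2 * π : ℝ) : ℂ)) = 1 := by
    rw [← Complex.exp_add, Complex.exp_eq_one_iff]
    refine ⟨0, ?_⟩
    push_cast
    field_simp
    ring
  linear_combination (-(fourier (-k) x : ℂ) * (f (x + ((a * y : ℝ) : AddCircle (2 * π)), y) : ℂ)) * h2

/-- The shear multiplies the `k`-th coefficient in `x` by `e^{ikay}`, and a modulation in `y` is a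
translation in `ξ`. -/
theorem channelFourier_shear {f : Channel → ℝ} (hf : MemLp f 2 volume) (a : ℝ) (k : ℤ) :
    channelFourier (fun p => f (p.1 + ((a * p.2 : ℝ) : AddCircle (2 * π)), p.2)) k =ᵐ[volume]
      fun ξ => channelFourier f k (ξ - k * a) := by
  have hg : MemLp (fun p : Channel => f (p.1 + ((a * p.2 : ℝ) : AddCircle (2 * π)), p.2)) 2 volume :=
    hf.comp_measurePreserving (measurePreserving_shear a)
  have h1 := fourier_modulate (g := (memLp_modeCoeff hf k).toLp)
    (h := (memLp_modeCoeff hg k).toLp) (a := k * a / (2 * π)) (by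
      filter_upwards [(memLp_modeCoeff hf k).coeFn_toLp, (memLp_modeCoeff hg k).coeFn_toLp]
        with y h1 h2
      rw [h1, h2, modeCoeff_shear])
  filter_upwards [quasiMeasurePreserving_div_two_pi.ae h1] with ξ h2
  rw [channelFourier_of_memLp hg, channelFourier_of_memLp hf, h2, sub_div]

theorem modeCoeff_neg (f : Channel → ℝ) (k : ℤ) (y : ℝ) :
    modeCoeff f (-k) y = starRingEnd ℂ (modeCoeff f k y) := by
  rw [modeCoeff, modeCoeff, fourierCoeff, fourierCoeff, ← integral_conj]
  refine integral_congr_ae (Eventually.of_forall fun x => ?_)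
  simp [fourier_neg]

theorem channelFourier_neg (f : Channel → ℝ) (k : ℤ) :
    ∀ᵐ ξ, channelFourier f (-k) (-ξ) = starRingEnd ℂ (channelFourier f k ξ) := by
  by_cases hf : MemLp f 2 volume
  · have h1 := fourier_conj (g := (memLp_modeCoeff hf k).toLp)
      (h := (memLp_modeCoeff hf (-k)).toLp) (by
        filter_upwards [(memLp_modeCoeff hf k).coeFn_toLp, (memLp_modeCoeff hf (-k)).coeFn_toLp]
          with y h1 h2
        rw [h1, h2, modeCoeff_neg])
    have hneg : Measure.QuasiMeasurePreserving (fun η : ℝ => -η) volume volume :=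
      (Measure.measurePreserving_neg _).quasiMeasurePreserving
    filter_upwards [hneg.ae (quasiMeasurePreserving_div_two_pi.ae h1)] with ξ h2
    rw [channelFourier_of_memLp hf, channelFourier_of_memLp hf, h2, neg_div, neg_neg]
  · simp [channelFourier, hf]

/-- The function `f(x + ay, y)`. -/
def shearBy (a : ℝ) (f : Channel → ℝ) : Channel → ℝ :=
  fun p => f (p.1 + ((a * p.2 : ℝ) : AddCircle (2 * π)), p.2)

theorem shearBy_shearBy (a b : ℝ) (f : Channel → ℝ) : shearBy a (shearBy b f) = shearBy (a + b) f := by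
  funext p
  simp only [shearBy, add_assoc, ← AddCircle.coe_add, add_mul]

theorem shearBy_zero (f : Channel → ℝ) : shearBy 0 f = f := by
  funext p
  simp [shearBy]

theorem shearBy_congr_ae {f g : Channel → ℝ} (h : f =ᵐ[volume] g) (a : ℝ) :
    shearBy a f =ᵐ[volume] shearBy a g :=
  (measurePreserving_shear a).quasiMeasurePreserving.ae_eq_comp h

theorem memLp_shearBy {f : Channel → ℝ} (hf : MemLp f 2 volume) (a : ℝ) :
    MemLp (shearBy a f) 2 volume :=
  hf.comp_measurePreserving (measurePreserving_shear a)

theorem eLpNorm_shearBy {f : Channel → ℝ} (hf : MemLp f 2 volume) (a : ℝ) :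
    eLpNorm (shearBy a f) 2 volume = eLpNorm f 2 volume :=
  eLpNorm_comp_measurePreserving hf.1 (measurePreserving_shear a)

theorem integral_shearBy_mul (f g : Channel → ℝ) (a : ℝ) :
    ∫ p, shearBy a f p * g p = ∫ p, f p * shearBy (-a) g p := by
  have hme : MeasurableEmbedding
      (fun p : Channel => (p.1 + ((a * p.2 : ℝ) : AddCircle (2 * π)), p.2)) := by
    refine (Homeomorph.mk (Equiv.mk
      (fun p : Channel => (p.1 + ((a * p.2 : ℝ) : AddCircle (2 * π)), p.2))
      (fun p : Channel => (p.1 - ((a * p.2 : ℝ) : AddCircle (2 * π)), p.2))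
      (fun p => by simp) (fun p => by simp)) ?_ ?_).measurableEmbedding
    · exact (continuous_fst.add ((AddCircle.continuous_mk' _).comp
        (continuous_const.mul continuous_snd))).prodMk continuous_snd
    · exact (continuous_fst.sub ((AddCircle.continuous_mk' _).comp
        (continuous_const.mul continuous_snd))).prodMk continuous_snd
  rw [← (measurePreserving_shear a).integral_comp hme (fun p => f p * shearBy (-a) g p)]
  refine integral_congr_ae (Eventually.of_forall fun p => ?_)
  simp [shearBy]

/-! ### Test functions: calculus, motion with the shear, density -/

theorem IsTestFunction.continuous {φ : Channel → ℝ} (hφ : IsTestFunction φ) : Continuous φ := by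
  have hq : IsOpenQuotientMap (Prod.map (fun x : ℝ => (x : AddCircle (2 * π))) (id : ℝ → ℝ)) :=
    QuotientAddGroup.isOpenQuotientMap_mk.prodMap IsOpenQuotientMap.id
  exact hq.isQuotientMap.continuous_iff.2 hφ.1.continuous

theorem IsTestFunction.memLp {φ : Channel → ℝ} (hφ : IsTestFunction φ) : MemLp φ 2 volume :=
  hφ.continuous.memLp_of_hasCompactSupport hφ.2

theorem IsTestFunction.exists_bound {φ : Channel → ℝ} (hφ : IsTestFunction φ) :
    ∃ M : ℝ, 0 ≤ M ∧ ∀ p, |φ p| ≤ M := by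
  obtain ⟨M, hM⟩ := hφ.2.exists_bound_of_continuous hφ.continuous
  exact ⟨M, (norm_nonneg _).trans (hM (0, 0)), hM⟩

theorem IsTestFunction.hasDerivAt {φ : Channel → ℝ} (hφ : IsTestFunction φ) (p : Channel) (h : ℝ) :
    HasDerivAt (fun h : ℝ => φ (p.1 + (h : AddCircle (2 * π)), p.2))
      (dx φ (p.1 + (h : AddCircle (2 * π)), p.2)) h := by
  obtain ⟨⟨x⟩, y⟩ := p
  have hd : Differentiable ℝ (fun h : ℝ => φ ((x : AddCircle (2 * π)) + (h : AddCircle (2 * π)), y)) := by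
    have h1 : ContDiff ℝ ((⊤ : ℕ∞) : WithTop ℕ∞)
      (fun h : ℝ => (fun p : ℝ × ℝ => φ ((p.1 : AddCircle (2 * π)), p.2)) (x + h, y)) :=
      hφ.1.comp (by fun_prop)
    simp only [AddCircle.coe_add] at h1
    exact h1.differentiable (by simp)
  have h2 := (hd h).hasDerivAt
  have h3 : deriv (fun h : ℝ => φ ((x : AddCircle (2 * π)) + (h : AddCircle (2 * π)), y)) h =
      dx φ ((x : AddCircle (2 * π)) + (h : AddCircle (2 * π)), y) := by
    rw [dx]
    have := deriv_comp_const_add (fun h : ℝ => φ ((x : AddCircle (2 * π)) + (h : AddCircle (2 * π)), y)) h 0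
    simp only [add_zero] at this
    rw [← this]
    simp only [AddCircle.coe_add, add_assoc]
  rw [h3] at h2
  exact h2

theorem IsTestFunction.dx {φ : Channel → ℝ} (hφ : IsTestFunction φ) : IsTestFunction (dx φ) := by
  constructor
  · have h1 : (fun p : ℝ × ℝ => BoussinesqLinear.dx φ ((p.1 : AddCircle (2 * π)), p.2)) =
        fun p => fderiv ℝ (fun p : ℝ × ℝ => φ ((p.1 : AddCircle (2 * π)), p.2)) p (1, 0) := by
      funext p
      have h2 := hφ.hasDerivAt (((0 : ℝ) : AddCircle (2 * π)), p.2) p.1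
      have h3 : HasDerivAt (fun h : ℝ => (fun p : ℝ × ℝ => φ ((p.1 : AddCircle (2 * π)), p.2)) (h, p.2))
          (fderiv ℝ (fun p : ℝ × ℝ => φ ((p.1 : AddCircle (2 * π)), p.2)) (p.1, p.2) (1, 0)) p.1 := by
        have hc : HasDerivAt (fun h : ℝ => (h, p.2)) ((1 : ℝ), (0 : ℝ)) p.1 :=
          (hasDerivAt_id _).prodMk (hasDerivAt_const _ _)
        have hF := (hφ.1.differentiable (by simp) (p.1, p.2)).hasFDerivAt
        exact hF.comp_hasDerivAt p.1 hc
      simp only [AddCircle.coe_zero, zero_add] at h2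
      exact h2.unique h3
    rw [h1]
    exact (hφ.1.fderiv_right (m := ((⊤ : ℕ∞) : WithTop ℕ∞)) (by exact_mod_cast le_top)).clm_apply
      contDiff_const
  · refine hφ.2.mono' fun p hp => ?_
    by_contra hn
    have h1 : φ =ᶠ[𝓝 p] fun _ => 0 := by
      have := notMem_tsupport_iff_eventuallyEq.1 hn
      exact this
    refine hp ?_
    have h2 : Tendsto (fun h : ℝ => ((p.1 + (h : AddCircle (2 * π)), p.2) : Channel)) (𝓝 0) (𝓝 p) := by
      have : Continuous (fun h : ℝ => ((p.1 + (h : AddCircle (2 * π)), p.2) : Channel)) :=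
        (continuous_const.add (AddCircle.continuous_mk' _)).prodMk continuous_const
      have h4 := this.tendsto 0
      simpa using h4
    have h3 := h2.eventually h1
    rw [BoussinesqLinear.dx, EventuallyEq.deriv_eq h3]
    simp

theorem IsTestFunction.snd_mul {φ : Channel → ℝ} (hφ : IsTestFunction φ) (b : ℝ) :
    IsTestFunction (fun p => b * p.2 * φ p) :=
  ⟨((contDiff_const.mul contDiff_snd).mul hφ.1), hφ.2.mul_left⟩

theorem isTestFunction_shearBy {φ : Channel → ℝ} (hφ : IsTestFunction φ) (a : ℝ) :
    IsTestFunction (shearBy a φ) := by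
  constructor
  · have h1 : ContDiff ℝ ((⊤ : ℕ∞) : WithTop ℕ∞)
      (fun q : ℝ × ℝ => (fun p : ℝ × ℝ => φ ((p.1 : AddCircle (2 * π)), p.2)) (q.1 + a * q.2, q.2)) :=
      hφ.1.comp (by fun_prop)
    simpa only [shearBy, AddCircle.coe_add] using h1
  · let e : Channel ≃ₜ Channel := Homeomorph.mk (Equiv.mk
      (fun p : Channel => (p.1 + ((a * p.2 : ℝ) : AddCircle (2 * π)), p.2))
      (fun p : Channel => (p.1 - ((a * p.2 : ℝ) : AddCircle (2 * π)), p.2))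
      (fun p => by simp) (fun p => by simp))
      ((continuous_fst.add ((AddCircle.continuous_mk' _).comp
        (continuous_const.mul continuous_snd))).prodMk continuous_snd)
      ((continuous_fst.sub ((AddCircle.continuous_mk' _).comp
        (continuous_const.mul continuous_snd))).prodMk continuous_snd)
    exact hφ.2.comp_homeomorph e

theorem dx_shearBy (a : ℝ) (φ : Channel → ℝ) : dx (shearBy a φ) = shearBy a (dx φ) := by
  funext p
  simp only [dx, shearBy]
  congr 1
  funext h
  rw [add_right_comm]

theorem exists_support_bound {φ : Channel → ℝ} (hφ : HasCompactSupport φ) :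
    ∃ R : ℝ, ∀ p : Channel, R < |p.2| → φ p = 0 := by
  obtain ⟨R, hR⟩ := ((hφ.image continuous_snd).isBounded).exists_norm_le
  refine ⟨R, fun p hp => ?_⟩
  by_contra hne
  exact absurd (hR p.2 ⟨p, subset_tsupport _ hne, rfl⟩) (not_le.2 hp)

theorem hasDerivAt_shearBy_apply {φ : Channel → ℝ} (hφ : IsTestFunction φ) (β : ℝ) (p : Channel)
    (s : ℝ) : HasDerivAt (fun s => shearBy (β * s) φ p)
      (shearBy (β * s) (fun p => β * p.2 * dx φ p) p) s := by
  have h1 := hφ.hasDerivAt p (β * s * p.2)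
  have h2 : HasDerivAt (fun s : ℝ => β * s * p.2) (β * p.2) s := by
    have := ((hasDerivAt_id s).const_mul β).mul_const p.2
    simpa using this
  exact h1.scomp s h2

/-- The remainder is governed by the second derivative in `s`, which is a shear of `(βy∂ₓ)²φ`. A
shear only permutes values, so one supremum serves all times and points. -/
theorem abs_shearBy_taylor {φ : Channel → ℝ} (hφ : IsTestFunction φ) (β : ℝ) :
    ∃ M : ℝ, ∀ (s t : ℝ) (p : Channel),
      |shearBy (β * s) φ p - shearBy (β * t) φ p -
        (s - t) * shearBy (β * t) (fun p => β * p.2 * dx φ p) p| ≤ M * |s - t| ^ 2 := by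
  have hψ := hφ.dx.snd_mul β
  obtain ⟨M, hM0, hM⟩ := (hψ.dx.snd_mul β).exists_bound
  refine ⟨M, fun s t p => ?_⟩
  have h1 : ∀ r, |shearBy (β * r) (fun p => β * p.2 * dx φ p) p -
      shearBy (β * t) (fun p => β * p.2 * dx φ p) p| ≤ M * |r - t| := fun r =>
    convex_univ.norm_image_sub_le_of_norm_hasDerivWithin_le (𝕜 := ℝ) (G := ℝ)
      (f := fun r => shearBy (β * r) (fun p => β * p.2 * dx φ p) p)
      (fun x _ => (hasDerivAt_shearBy_apply hψ β p x).hasDerivWithinAt)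
      (fun x _ => hM _) (mem_univ t) (mem_univ r)
  have h2 : ∀ r ∈ uIcc t s, HasDerivWithinAt (fun r => shearBy (β * r) φ p -
      (r - t) * shearBy (β * t) (fun p => β * p.2 * dx φ p) p)
      (shearBy (β * r) (fun p => β * p.2 * dx φ p) p -
        shearBy (β * t) (fun p => β * p.2 * dx φ p) p) (uIcc t s) r := fun r _ => by
    have := (hasDerivAt_shearBy_apply hφ β p r).sub
      (((hasDerivAt_id r).sub_const t).mul_const
        (shearBy (β * t) (fun p => β * p.2 * dx φ p) p))
    rw [one_mul] at this
    exact this.hasDerivWithinAt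
  have h3 := (convex_uIcc t s).norm_image_sub_le_of_norm_hasDerivWithin_le (𝕜 := ℝ) (G := ℝ)
    (C := M * |s - t|) h2 (fun r hr => (h1 r).trans
      (mul_le_mul_of_nonneg_left (abs_sub_left_of_mem_uIcc hr) hM0)) left_mem_uIcc right_mem_uIcc
  simp only [sub_self, zero_mul, sub_zero, Real.norm_eq_abs] at h3
  rw [sub_right_comm]
  linarith [h3]

/-- The class in `L²` of a sheared test function. -/
def shearedTest {φ : Channel → ℝ} (hφ : IsTestFunction φ) (a : ℝ) : ChannelL2 :=
  (isTestFunction_shearBy hφ a).memLp.toLp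

theorem coeFn_shearedTest {φ : Channel → ℝ} (hφ : IsTestFunction φ) (a : ℝ) :
    shearedTest hφ a =ᵐ[volume] shearBy a φ := MemLp.coeFn_toLp _

/-- Shears do not change `y`. All the functions therefore live in one strip of finite measure, on
which the uniform Taylor estimate becomes an `L²` estimate. -/
theorem hasDerivAt_shearedTest {φ : Channel → ℝ} (hφ : IsTestFunction φ) (β t : ℝ) :
    HasDerivAt (fun s => shearedTest hφ (β * s)) (shearedTest (hφ.dx.snd_mul β) (β * t)) t := by
  obtain ⟨M, hM⟩ := abs_shearBy_taylor hφ β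
  obtain ⟨R, hR⟩ := exists_support_bound hφ.2
  obtain ⟨R', hR'⟩ := exists_support_bound hφ.dx.2
  set K : Set Channel := univ ×ˢ Icc (-max R R') (max R R') with hK
  have hKm : MeasurableSet K := MeasurableSet.univ.prod measurableSet_Icc
  have hKf : volume K ≠ ∞ := by
    rw [hK, Measure.volume_eq_prod, Measure.prod_prod]
    exact ENNReal.mul_ne_top (measure_ne_top _ _) (by simp)
  have hest : ∀ s, ‖shearedTest hφ (β * s) - shearedTest hφ (β * t) -
      (s - t) • shearedTest (hφ.dx.snd_mul β) (β * t)‖ ≤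
      (M * |s - t| ^ 2) * ‖(indicatorConstLp 2 hKm hKf (1 : ℝ) : ChannelL2)‖ := by
    intro s
    refine Lp.norm_le_mul_norm_of_ae_le_mul ?_
    filter_upwards [Lp.coeFn_sub (shearedTest hφ (β * s) - shearedTest hφ (β * t))
      ((s - t) • shearedTest (hφ.dx.snd_mul β) (β * t)),
      Lp.coeFn_sub (shearedTest hφ (β * s)) (shearedTest hφ (β * t)),
      Lp.coeFn_smul (s - t) (shearedTest (hφ.dx.snd_mul β) (β * t)),
      coeFn_shearedTest hφ (β * s), coeFn_shearedTest hφ (β * t),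
      coeFn_shearedTest (hφ.dx.snd_mul β) (β * t),
      indicatorConstLp_coeFn (p := 2) (hs := hKm) (hμs := hKf) (c := (1 : ℝ))]
      with p h1 h2 h3 h4 h5 h6 h7
    rw [h1, Pi.sub_apply, h2, Pi.sub_apply, h3, Pi.smul_apply, h4, h5, h6, h7, smul_eq_mul]
    by_cases hp : p ∈ K
    · rw [indicator_of_mem hp, norm_one, mul_one]
      exact hM s t p
    · have hp2 : max R R' < |p.2| := by
        by_contra hle
        exact hp ⟨mem_univ _, abs_le.1 (not_lt.1 hle)⟩
      have e1 : ∀ a, shearBy a φ p = 0 := fun a => hR _ ((le_max_left _ _).trans_lt hp2)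
      have e2 : ∀ a, shearBy a (fun p => β * p.2 * dx φ p) p = 0 := fun a => by
        have h0 : dx φ (p.1 + ((a * p.2 : ℝ) : AddCircle (2 * π)), p.2) = 0 :=
          hR' _ ((le_max_right _ _).trans_lt hp2)
        simp only [shearBy, h0, mul_zero]
      rw [e1, e1, e2, indicator_of_notMem hp]
      simp
  rw [hasDerivAt_iff_isLittleO]
  refine (Asymptotics.IsBigO.of_bound (M * ‖(indicatorConstLp 2 hKm hKf (1 : ℝ) : ChannelL2)‖)
    (g := fun s : ℝ => ‖s - t‖ ^ 2) (Eventually.of_forall fun s => ?_)).trans_isLittleO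
    (Asymptotics.isLittleO_pow_sub_sub t one_lt_two)
  refine (hest s).trans (le_of_eq ?_)
  rw [norm_pow, norm_norm, Real.norm_eq_abs]
  ring

theorem modeCoeff_dx {φ : Channel → ℝ} (hφ : IsTestFunction φ) (k : ℤ) (y : ℝ) :
    modeCoeff (dx φ) k y = Complex.I * k * modeCoeff φ k y := by
  rw [modeCoeff, modeCoeff, fourierCoeff_eq_intervalIntegral _ _ 0,
    fourierCoeff_eq_intervalIntegral _ _ 0]
  have hpi : (π : ℂ) ≠ 0 := by exact_mod_cast Real.pi_ne_zero
  have hv : ∀ x : ℝ, HasDerivAt (fun x : ℝ => ((φ ((x : AddCircle (2 * π)), y) : ℝ) : ℂ))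
      ((dx φ ((x : AddCircle (2 * π)), y) : ℝ) : ℂ) x := by
    intro x
    have := hφ.hasDerivAt (((0 : ℝ) : AddCircle (2 * π)), y) x
    simp only [AddCircle.coe_zero, zero_add] at this
    exact this.ofReal_comp
  have hcont : ∀ n : ℤ, Continuous fun x : ℝ => (fourier n (x : AddCircle (2 * π)) : ℂ) := fun n =>
    (fourier n).continuous.comp (AddCircle.continuous_mk' _)
  have hcd : Continuous fun x : ℝ => ((dx φ ((x : AddCircle (2 * π)), y) : ℝ) : ℂ) :=
    Complex.continuous_ofReal.comp (hφ.dx.continuous.comp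
      ((AddCircle.continuous_mk' _).prodMk continuous_const))
  have h := intervalIntegral.integral_mul_deriv_eq_deriv_mul (a := 0) (b := 0 + 2 * π)
    (u := fun x : ℝ => (fourier (-k) (x : AddCircle (2 * π)) : ℂ))
    (v := fun x : ℝ => ((φ ((x : AddCircle (2 * π)), y) : ℝ) : ℂ))
    (u' := fun x : ℝ => -2 * π * Complex.I * k / ((2 * π : ℝ) : ℂ) *
      (fourier (-k) (x : AddCircle (2 * π)) : ℂ))
    (v' := fun x : ℝ => ((dx φ ((x : AddCircle (2 * π)), y) : ℝ) : ℂ))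
    (fun x _ => hasDerivAt_fourier_neg (2 * π) k x) (fun x _ => hv x)
    ((continuous_const.mul (hcont _)).intervalIntegrable _ _) (hcd.intervalIntegrable _ _)
  have h0 : ((0 + 2 * π : ℝ) : AddCircle (2 * π)) = ((0 : ℝ) : AddCircle (2 * π)) := by
    rw [zero_add, AddCircle.coe_period, AddCircle.coe_zero]
  simp only [h0, sub_self, zero_sub, mul_assoc] at h
  rw [intervalIntegral.integral_const_mul] at h
  simp only [smul_eq_mul] at h ⊢
  rw [h]
  simp only [Complex.real_smul]
  push_cast
  field_simp

theorem channelFourier_dx {φ : Channel → ℝ} (hφ : IsTestFunction φ) (k : ℤ) :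
    channelFourier (dx φ) k =ᵐ[volume] fun ξ => Complex.I * k * channelFourier φ k ξ := by
  have h : (memLp_modeCoeff hφ.dx.memLp k).toLp (modeCoeff (dx φ) k) =
      (Complex.I * k) • (memLp_modeCoeff hφ.memLp k).toLp (modeCoeff φ k) := by
    rw [← MemLp.toLp_const_smul]
    refine (MemLp.toLp_eq_toLp_iff _ _).2 (Eventually.of_forall fun y => ?_)
    rw [Pi.smul_apply, smul_eq_mul, modeCoeff_dx hφ]
  have h2 := Lp.coeFn_smul (Complex.I * k)
    (𝓕 ((memLp_modeCoeff hφ.memLp k).toLp (modeCoeff φ k)) : Lp ℂ 2 (volume : Measure ℝ))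
  filter_upwards [quasiMeasurePreserving_div_two_pi.ae h2] with ξ h3
  rw [channelFourier_of_memLp hφ.dx.memLp, channelFourier_of_memLp hφ.memLp, h,
    FourierTransform.fourier_smul, h3, Pi.smul_apply, smul_eq_mul]

/-- Integration by parts in `x`, where `f` is the `x`-derivative of `g` in the sense of the
Fourier transform. -/
theorem inner_eq_neg_inner_dx {f g : ChannelL2}
    (h : ∀ k : ℤ, channelFourier f k =ᵐ[volume] fun ξ => Complex.I * k * channelFourier g k ξ)
    {φ : Channel → ℝ} (hφ : IsTestFunction φ) (a : ℝ) :
    inner ℝ f (shearedTest hφ a) = -inner ℝ g (shearedTest hφ.dx a) := by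
  rw [inner_eq_tsum_channelFourier, inner_eq_tsum_channelFourier, ← tsum_neg]
  refine tsum_congr fun k => ?_
  rw [← integral_neg]
  refine integral_congr_ae ?_
  rw [channelFourier_congr_ae (coeFn_shearedTest hφ a),
    channelFourier_congr_ae (coeFn_shearedTest hφ.dx a), ← dx_shearBy]
  filter_upwards [h k, channelFourier_dx (isTestFunction_shearBy hφ a) k] with ξ h1 h2
  rw [h1, h2]
  simp only [Complex.inner, map_mul, Complex.conj_I]
  rw [← Complex.neg_re]
  congr 1
  simp
  ring

theorem isTestFunction_const_mul {χ : ℝ → ℝ} (hχ : ContDiff ℝ ((⊤ : ℕ∞) : WithTop ℕ∞) χ)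
    (hc : HasCompactSupport χ) (k : ℤ) (L : ℂ →L[ℝ] ℝ) :
    IsTestFunction (fun p : Channel => L (fourier k p.1) * χ p.2) := by
  constructor
  · refine ContDiff.mul ?_ (hχ.comp contDiff_snd)
    simp only [fourier_coe_apply]
    refine L.contDiff.comp ?_
    refine Complex.contDiff_exp.comp ?_
    simp only [div_eq_mul_inv]
    exact ((contDiff_const.mul (Complex.ofRealCLM.contDiff.comp contDiff_fst)).mul contDiff_const)
  · refine HasCompactSupport.intro (K := univ ×ˢ tsupport χ) (isCompact_univ.prod hc) fun p hp => ?_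
    have : p.2 ∉ tsupport χ := fun h => hp ⟨mem_univ _, h⟩
    rw [image_eq_zero_of_notMem_tsupport this, mul_zero]

/-- Testing against the real and imaginary parts of `e^{-ikx} χ(y)` shows that each coefficient in
`x` vanishes as a distribution in `y`. -/
theorem eq_zero_of_forall_integral_test {f : ChannelL2}
    (h : ∀ φ : Channel → ℝ, IsTestFunction φ → ∫ p, f p * φ p = 0) : f = 0 := by
  have hmode : ∀ k, modeCoeff f k =ᵐ[volume] 0 := by
    intro k
    have hloc : LocallyIntegrable (modeCoeff f k) volume :=
      (memLp_modeCoeff (Lp.memLp f) k).locallyIntegrable one_le_two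
    refine ae_eq_zero_of_integral_contDiff_smul_eq_zero hloc fun χ hχ hc => ?_
    have hre := h _ (isTestFunction_const_mul hχ hc (-k) Complex.reCLM)
    have him := h _ (isTestFunction_const_mul hχ hc (-k) Complex.imCLM)
    have hi : ∀ L : ℂ →L[ℝ] ℝ, Integrable (fun p : Channel =>
        f p * (L (fourier (-k) p.1) * χ p.2)) volume := fun L =>
      (Lp.memLp f).integrable_mul (isTestFunction_const_mul hχ hc (-k) L).memLp
    have hsum : ∀ p : Channel, (χ p.2 : ℂ) * (fourier (-k) p.1 * (f p : ℂ)) =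
        ((f p * (Complex.reCLM (fourier (-k) p.1) * χ p.2) : ℝ) : ℂ) +
        ((f p * (Complex.imCLM (fourier (-k) p.1) * χ p.2) : ℝ) : ℂ) * Complex.I := by
      intro p
      nth_rw 1 [← Complex.re_add_im (fourier (-k) p.1)]
      simp only [Complex.reCLM_apply, Complex.imCLM_apply]
      push_cast
      ring
    have hint : ∫ p : Channel, (χ p.2 : ℂ) * (fourier (-k) p.1 * (f p : ℂ)) = 0 := by
      simp only [hsum]
      rw [integral_add (hi Complex.reCLM).ofReal ((hi Complex.imCLM).ofReal.mul_const _),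
        integral_mul_const, integral_complex_ofReal, integral_complex_ofReal, hre, him]
      simp
    have hint2 : Integrable (fun p : Channel => (χ p.2 : ℂ) * (fourier (-k) p.1 * (f p : ℂ)))
        ((volume : Measure (AddCircle (2 * π))).prod (volume : Measure ℝ)) := by
      simp only [hsum]
      exact (hi Complex.reCLM).ofReal.add ((hi Complex.imCLM).ofReal.mul_const _)
    have hint3 := (integral_prod_symm _ hint2).symm.trans hint
    have h3 : ∀ y, χ y • modeCoeff f k y = ((2 * π)⁻¹ : ℝ) • ∫ x : AddCircle (2 * π),
        (χ y : ℂ) * (fourier (-k) x * (f (x, y) : ℂ)) := by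
      intro y
      rw [modeCoeff, fourierCoeff, AddCircle.integral_haarAddCircle, integral_const_mul]
      simp only [smul_eq_mul, Complex.real_smul]
      ring
    simp only [h3]
    rw [integral_smul, hint3, smul_zero]
  refine channelL2_ext_of_channelFourier fun k => ?_
  have h0 : ∀ {g : ChannelL2}, modeCoeff g k =ᵐ[volume] 0 → channelFourier g k =ᵐ[volume] 0 := by
    intro g hg
    have h1 : (memLp_modeCoeff (Lp.memLp g) k).toLp (modeCoeff g k) = 0 := by
      rw [← MemLp.toLp_zero (MemLp.zero' (p := 2))]
      exact (MemLp.toLp_eq_toLp_iff _ _).2 hg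
    filter_upwards [quasiMeasurePreserving_div_two_pi.ae (Lp.coeFn_zero ℂ 2 (volume : Measure ℝ))]
      with ξ h2
    rw [channelFourier_of_memLp (Lp.memLp g), h1, FourierTransform.fourier_zero, h2]
    rfl
  refine (h0 (hmode k)).trans (h0 ?_).symm
  refine (modeCoeff_congr_ae (Lp.coeFn_zero ℝ 2 volume) k).trans (Eventually.of_forall fun y => ?_)
  simp [modeCoeff, fourierCoeff]

theorem inner_shearedTest (f : ChannelL2) {φ : Channel → ℝ} (hφ : IsTestFunction φ) (a : ℝ) :
    inner ℝ f (shearedTest hφ a) = ∫ p, f p * shearBy a φ p := by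
  rw [L2.inner_def]
  refine integral_congr_ae ?_
  filter_upwards [coeFn_shearedTest hφ a] with p hp
  rw [hp]
  simp [mul_comm]

theorem norm_shearedTest {φ : Channel → ℝ} (hφ : IsTestFunction φ) (a b : ℝ) :
    ‖shearedTest hφ a‖ = ‖shearedTest hφ b‖ := by
  rw [shearedTest, shearedTest, Lp.norm_toLp, Lp.norm_toLp, eLpNorm_shearBy hφ.memLp,
    eLpNorm_shearBy hφ.memLp]

theorem isTestFunction_add {φ ψ : Channel → ℝ} (hφ : IsTestFunction φ) (hψ : IsTestFunction ψ) :
    IsTestFunction (φ + ψ) := ⟨hφ.1.add hψ.1, hφ.2.add hψ.2⟩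

theorem isTestFunction_smul {φ : Channel → ℝ} (hφ : IsTestFunction φ) (c : ℝ) :
    IsTestFunction (c • φ) := ⟨hφ.1.const_smul c, hφ.2.smul_left (f := fun _ => c)⟩

theorem isTestFunction_zero : IsTestFunction 0 := ⟨contDiff_const, HasCompactSupport.zero⟩

/-- The classes of test functions in `L²`. -/
def testSubmodule : Submodule ℝ ChannelL2 where
  carrier := {f | ∃ φ, IsTestFunction φ ∧ f =ᵐ[volume] φ}
  add_mem' := by
    rintro f g ⟨φ, hφ, h1⟩ ⟨ψ, hψ, h2⟩
    exact ⟨φ + ψ, isTestFunction_add hφ hψ, (Lp.coeFn_add f g).trans (h1.add h2)⟩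
  zero_mem' := ⟨0, isTestFunction_zero, Lp.coeFn_zero _ _ _⟩
  smul_mem' := by
    rintro c f ⟨φ, hφ, h1⟩
    exact ⟨c • φ, isTestFunction_smul hφ c, (Lp.coeFn_smul c f).trans (h1.const_smul c)⟩

theorem dense_testSubmodule : testSubmodule.topologicalClosure = ⊤ := by
  rw [Submodule.topologicalClosure_eq_top_iff, Submodule.eq_bot_iff]
  intro f hf
  refine eq_zero_of_forall_integral_test fun φ hφ => ?_
  have h1 := (Submodule.mem_orthogonal' _ _).1 hf (shearedTest hφ 0)
    ⟨shearBy 0 φ, isTestFunction_shearBy hφ 0, coeFn_shearedTest hφ 0⟩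
  rwa [inner_shearedTest, shearBy_zero] at h1

/-- A bound on the pairings with all test functions bounds the norm. -/
theorem norm_le_of_forall_inner_test {f : ChannelL2} {C : ℝ} (hC : 0 ≤ C)
    (h : ∀ φ : Channel → ℝ, ∀ hφ : IsTestFunction φ,
      |inner ℝ f (shearedTest hφ 0)| ≤ C * ‖shearedTest hφ 0‖) : ‖f‖ ≤ C := by
  have h1 : ∀ g : ChannelL2, |inner ℝ f g| ≤ C * ‖g‖ := by
    intro g
    have hg : g ∈ closure (testSubmodule : Set ChannelL2) := by
      rw [← Submodule.topologicalClosure_coe, dense_testSubmodule]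
      trivial
    refine closure_minimal (t := {g : ChannelL2 | |inner ℝ f g| ≤ C * ‖g‖}) ?_ ?_ hg
    · rintro u ⟨φ, hφ, hu⟩
      have hu2 : u = shearedTest hφ 0 := by
        refine Lp.ext (hu.trans ?_)
        have := coeFn_shearedTest hφ 0
        rw [shearBy_zero] at this
        exact this.symm
      rw [mem_ofPred_eq, hu2]
      exact h φ hφ
    · exact isClosed_le ((continuous_const.inner continuous_id).abs)
        (continuous_const.mul continuous_norm)
  have h2 := h1 f
  rw [real_inner_self_eq_norm_sq, abs_of_nonneg (by positivity), sq] at h2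
  by_cases h0 : ‖f‖ = 0
  · rwa [h0]
  · exact le_of_mul_le_mul_right h2 (lt_of_le_of_ne (norm_nonneg _) (Ne.symm h0))

/-! ### Linear differential equations with bounded operator coefficients -/

section LinearODE

variable {F : Type*} [NormedAddCommGroup F] [NormedSpace ℝ F]

/-- The iterated integrals in the solution of a linear differential equation. -/
def volterraIterate (M : ℝ → F →L[ℝ] F) (y₀ : F) : ℕ → ℝ → F
  | 0 => fun _ => y₀
  | n + 1 => fun t => ∫ r in (0 : ℝ)..t, M r (volterraIterate M y₀ n r)

theorem continuous_volterraIterate {M : ℝ → F →L[ℝ] F} (hM : Continuous M) (y₀ : F) (n : ℕ) :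
    Continuous (volterraIterate M y₀ n) := by
  induction n with
  | zero => exact continuous_const
  | succ n ih =>
    exact intervalIntegral.continuous_primitive (fun a b => (hM.clm_apply ih).intervalIntegrable a b) 0

theorem norm_volterraIterate_le {M : ℝ → F →L[ℝ] F} {C : ℝ}
    (hC : ∀ t, ‖M t‖ ≤ C) (y₀ : F) (n : ℕ) (t : ℝ) :
    ‖volterraIterate M y₀ n t‖ ≤ ‖y₀‖ * ((C * |t|) ^ n / n.factorial) := by
  have hC0 : 0 ≤ C := (norm_nonneg _).trans (hC 0)
  induction n generalizing t with
  | zero => simp [volterraIterate]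
  | succ n ih =>
    have hcont : Continuous fun r : ℝ => C * (‖y₀‖ * ((C * |r|) ^ n / n.factorial)) := by fun_prop
    have h1 : ‖∫ r in (0 : ℝ)..t, M r (volterraIterate M y₀ n r)‖ ≤
        |∫ r in (0 : ℝ)..t, C * (‖y₀‖ * ((C * |r|) ^ n / n.factorial))| := by
      refine intervalIntegral.norm_integral_le_abs_of_norm_le (Eventually.of_forall fun r => ?_)
        (hcont.intervalIntegrable _ _)
      exact (ContinuousLinearMap.le_opNorm _ _).trans
        (mul_le_mul (hC r) (ih r) (norm_nonneg _) hC0)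
    refine h1.trans (le_of_eq ?_)
    have h2 : (fun r : ℝ => C * (‖y₀‖ * ((C * |r|) ^ n / n.factorial))) =
        fun r => (C ^ (n + 1) * ‖y₀‖ / n.factorial) * |r - 0| ^ n := by
      funext r
      rw [mul_pow, sub_zero]
      ring
    rw [h2, intervalIntegral.integral_const_mul, abs_mul, intervalIntegral.abs_intervalIntegral_eq,
      integral_pow_abs_sub_uIoc, abs_of_nonneg (by positivity), abs_of_nonneg (by positivity),
      Nat.factorial_succ, sub_zero, mul_pow]
    push_cast
    field_simp

/-- The series of iterated integrals is dominated by an exponential series, locally uniformly in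
time together with its termwise derivative. Boundedness of `M` makes the solution global. -/
theorem exists_linearODE_solution [CompleteSpace F] {M : ℝ → F →L[ℝ] F} (hM : Continuous M) {C : ℝ}
    (hC : ∀ t, ‖M t‖ ≤ C) (y₀ : F) :
    ∃ y : ℝ → F, y 0 = y₀ ∧ ∀ t, HasDerivAt y (M t (y t)) t := by
  have hC0 : 0 ≤ C := (norm_nonneg _).trans (hC 0)
  have hsum : ∀ t, Summable fun n => volterraIterate M y₀ n t := fun t =>
    Summable.of_norm_bounded ((Real.summable_pow_div_factorial (C * |t|)).mul_left ‖y₀‖)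
      (fun n => norm_volterraIterate_le hC y₀ n t)
  refine ⟨fun t => ∑' n, volterraIterate M y₀ n t, ?_, fun t => ?_⟩
  · change ∑' n, volterraIterate M y₀ n 0 = y₀
    rw [tsum_eq_single 0]
    · rfl
    · intro n hn
      obtain ⟨m, rfl⟩ := Nat.exists_eq_succ_of_ne_zero hn
      simp [volterraIterate]
  · set R := |t| + 1 with hR
    have hR0 : 0 < R := by positivity
    have h1 : HasDerivAt (fun z => ∑' n, volterraIterate M y₀ (n + 1) z)
        (∑' n, M t (volterraIterate M y₀ n t)) t := by
      -- Termwise differentiation takes place on a ball about `0` that contains `t`, so that the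
      -- domination is uniform there.
      refine hasDerivAt_tsum_of_isPreconnected (t := Metric.ball (0 : ℝ) R) (y₀ := 0)
        (g := fun n z => volterraIterate M y₀ (n + 1) z)
        (g' := fun n z => M z (volterraIterate M y₀ n z))
        (u := fun n => C * (‖y₀‖ * ((C * R) ^ n / n.factorial)))
        (((Real.summable_pow_div_factorial (C * R)).mul_left ‖y₀‖).mul_left C) Metric.isOpen_ball
        (convex_ball _ _).isPreconnected ?_ ?_ (Metric.mem_ball_self hR0) ?_ ?_
      · intro n z _
        exact intervalIntegral.integral_hasDerivAt_right
          ((hM.clm_apply (continuous_volterraIterate hM y₀ n)).intervalIntegrable _ _)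
          (hM.clm_apply (continuous_volterraIterate hM y₀ n)).aestronglyMeasurable.stronglyMeasurableAtFilter
          (hM.clm_apply (continuous_volterraIterate hM y₀ n)).continuousAt
      · intro n z hz
        have hz' : |z| ≤ R := by
          rw [Metric.mem_ball, dist_zero_right] at hz
          exact hz.le
        refine (ContinuousLinearMap.le_opNorm _ _).trans
          (mul_le_mul (hC z) ((norm_volterraIterate_le hC y₀ n z).trans ?_) (norm_nonneg _) hC0)
        gcongr
      · exact (summable_nat_add_iff 1).2 (hsum 0)
      · rw [Metric.mem_ball, dist_zero_right, Real.norm_eq_abs]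
        linarith
    have h2 : (fun z => ∑' n, volterraIterate M y₀ n z) =
        fun z => y₀ + ∑' n, volterraIterate M y₀ (n + 1) z := by
      funext z
      rw [(hsum z).tsum_eq_zero_add]
      rfl
    rw [← (M t).map_tsum (hsum t)] at h1
    have h3 := h1.const_add y₀
    rw [← h2] at h3
    exact h3

theorem exists_secondOrderODE_solution {E : Type*} [NormedRing E] [NormedAlgebra ℝ E]
    [CompleteSpace E] {Q : ℝ → E} (hQ : Continuous Q) {C : ℝ} (hC : ∀ t, ‖Q t‖ ≤ C) (u₀ v₀ : E) :
    ∃ u v : ℝ → E, u 0 = u₀ ∧ v 0 = v₀ ∧ (∀ t, HasDerivAt u (v t) t) ∧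
      ∀ t, HasDerivAt v (-(Q t * u t)) t := by
  have hC0 : 0 ≤ C := (norm_nonneg _).trans (hC 0)
  let M : ℝ → (E × E) →L[ℝ] (E × E) := fun t =>
    (ContinuousLinearMap.inl ℝ E E).comp (ContinuousLinearMap.snd ℝ E E) -
    (ContinuousLinearMap.inr ℝ E E).comp
      ((ContinuousLinearMap.mul ℝ E (Q t)).comp (ContinuousLinearMap.fst ℝ E E))
  have hMa : ∀ t y, M t y = (y.2, -(Q t * y.1)) := fun t y => by simp [M]
  have hM : Continuous M := by
    refine continuous_const.sub (continuous_const.clm_comp (Continuous.clm_comp ?_ continuous_const))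
    exact (ContinuousLinearMap.mul ℝ E).continuous.comp hQ
  have hMC : ∀ t, ‖M t‖ ≤ 1 + C := fun t => by
    refine ContinuousLinearMap.opNorm_le_bound _ (by linarith) fun y => ?_
    rw [hMa, Prod.norm_mk, norm_neg]
    have h1 : ‖y.1‖ ≤ ‖y‖ := norm_fst_le y
    have h2 : ‖y.2‖ ≤ ‖y‖ := norm_snd_le y
    have h3 : ‖Q t * y.1‖ ≤ C * ‖y‖ :=
      (norm_mul_le _ _).trans (mul_le_mul (hC t) h1 (norm_nonneg _) hC0)
    have h4 : 0 ≤ C * ‖y‖ := mul_nonneg hC0 (norm_nonneg _)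
    refine max_le ?_ ?_ <;> nlinarith [norm_nonneg y]
  obtain ⟨y, hy0, hy⟩ := exists_linearODE_solution hM hMC (u₀, v₀)
  refine ⟨fun t => (y t).1, fun t => (y t).2, congrArg Prod.fst hy0, congrArg Prod.snd hy0, fun t => ?_, fun t => ?_⟩
  · have := (hasFDerivAt_fst (𝕜 := ℝ) (p := y t)).comp_hasDerivAt t (hy t)
    rw [hMa] at this
    exact this
  · have := (hasFDerivAt_snd (𝕜 := ℝ) (p := y t)).comp_hasDerivAt t (hy t)
    rw [hMa] at this
    exact this

end LinearODE

/-! ### Fourier multipliers and the propagator -/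

/-- Bounded continuous functions of the ratio `ξ / k`, with a second copy of the line for the
frequencies with `k = 0`. -/
abbrev Symbols : Type := BoundedContinuousFunction (ℝ × Bool) ℝ

/-- The point at which a symbol is evaluated at the frequency `(k, ξ)`. -/
def symbolPoint (k : ℤ) (ξ : ℝ) : ℝ × Bool := (ξ / k, decide (k ≠ 0))

theorem symbolPoint_neg (k : ℤ) (ξ : ℝ) : symbolPoint (-k) (-ξ) = symbolPoint k ξ := by
  simp [symbolPoint, neg_div_neg_eq]

theorem continuous_symbolPoint (k : ℤ) : Continuous (symbolPoint k) :=
  (continuous_id.div_const _).prodMk continuous_const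

theorem enorm_sq_eq_tsum_channelFourier (f : ChannelL2) :
    ‖f‖ₑ ^ 2 = ∑' k, ∫⁻ ξ, ‖channelFourier f k ξ‖ₑ ^ 2 := by
  rw [tsum_lintegral_channelFourier_sq (Lp.memLp f), Lp.enorm_def, eLpNorm_sq_eq_lintegral]

theorem norm_le_of_channelFourier_le {f g : ChannelL2} {C : ℝ} (hC : 0 ≤ C)
    (h : ∀ k, ∀ᵐ ξ, ‖channelFourier f k ξ‖ ≤ C * ‖channelFourier g k ξ‖) : ‖f‖ ≤ C * ‖g‖ := by
  have h1 : ‖f‖ₑ ^ 2 ≤ (ENNReal.ofReal C * ‖g‖ₑ) ^ 2 := by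
    rw [mul_pow, enorm_sq_eq_tsum_channelFourier, enorm_sq_eq_tsum_channelFourier,
      ← ENNReal.tsum_mul_left]
    refine ENNReal.tsum_le_tsum fun k => ?_
    rw [← lintegral_const_mul' _ _ (by simp)]
    refine lintegral_mono_ae ?_
    filter_upwards [h k] with ξ h2
    rw [← mul_pow]
    gcongr
    rw [← ofReal_norm, ← ofReal_norm, ← ENNReal.ofReal_mul hC]
    exact ENNReal.ofReal_le_ofReal h2
  have h2 := (ENNReal.pow_le_pow_left_iff two_ne_zero).1 h1
  rw [← ofReal_norm, ← ofReal_norm, ← ENNReal.ofReal_mul hC] at h2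
  exact (ENNReal.ofReal_le_ofReal_iff (by positivity)).1 h2

/-- Bounded Fourier multipliers that preserve real functions. -/
theorem exists_fourierMultiplier {m : ℤ → ℝ → ℂ} (hm : ∀ k, Measurable (m k)) {C : ℝ}
    (hC : ∀ k ξ, ‖m k ξ‖ ≤ C) (hsym : ∀ k ξ, m (-k) (-ξ) = starRingEnd ℂ (m k ξ)) (f : ChannelL2) :
    ∃ g : ChannelL2, ∀ k, channelFourier g k =ᵐ[volume] fun ξ => m k ξ * channelFourier f k ξ := by
  have hmem : ∀ k, MemLp (fun ξ => m k ξ * channelFourier f k ξ) 2 volume := fun k =>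
    (memLp_channelFourier f k).of_le_mul (c := C)
      ((hm k).aestronglyMeasurable.mul (aestronglyMeasurable_channelFourier f k))
      (Eventually.of_forall fun ξ => by
        rw [norm_mul]
        exact mul_le_mul_of_nonneg_right (hC k ξ) (norm_nonneg _))
  refine exists_channelFourier_eq hmem (ne_of_lt ?_) fun k => ?_
  · have h1 : ∑' k, ∫⁻ ξ, ‖m k ξ * channelFourier f k ξ‖ₑ ^ 2 ≤
        ENNReal.ofReal C ^ 2 * ‖f‖ₑ ^ 2 := by
      rw [enorm_sq_eq_tsum_channelFourier, ← ENNReal.tsum_mul_left]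
      refine ENNReal.tsum_le_tsum fun k => ?_
      rw [← lintegral_const_mul' _ _ (by simp)]
      refine lintegral_mono fun ξ => ?_
      rw [← mul_pow, enorm_mul]
      gcongr
      rw [← ofReal_norm]
      exact ENNReal.ofReal_le_ofReal (hC k ξ)
    exact h1.trans_lt (ENNReal.mul_lt_top (by simp) (by simp))
  · filter_upwards [channelFourier_neg f k] with ξ h
    rw [hsym, h, map_mul]

theorem exists_symbolMultiplier (m : Symbols) (f : ChannelL2) :
    ∃ g : ChannelL2, ∀ k, channelFourier g k =ᵐ[volume]
      fun ξ => (m (symbolPoint k ξ) : ℂ) * channelFourier f k ξ := by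
  refine exists_fourierMultiplier (C := ‖m‖) (fun k => ?_) (fun k ξ => ?_) (fun k ξ => ?_) f
  · exact (Complex.continuous_ofReal.comp (m.continuous.comp (continuous_symbolPoint k))).measurable
  · rw [Complex.norm_real]
    exact m.norm_coe_le_norm _
  · rw [symbolPoint_neg, Complex.conj_ofReal]

theorem channelFourier_coe_add (f g : ChannelL2) (k : ℤ) :
    channelFourier (f + g : ChannelL2) k =ᵐ[volume] channelFourier f k + channelFourier g k := by
  rw [channelFourier_congr_ae (Lp.coeFn_add f g)]
  exact channelFourier_add (Lp.memLp f) (Lp.memLp g) k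

theorem channelFourier_coe_smul (c : ℝ) (f : ChannelL2) (k : ℤ) :
    channelFourier (c • f : ChannelL2) k =ᵐ[volume] c • channelFourier f k := by
  rw [channelFourier_congr_ae (Lp.coeFn_smul c f)]
  exact channelFourier_smul c (Lp.memLp f) k

/-- The Fourier multiplier with a given symbol, as a function. -/
def symbolMultiplierFun (m : Symbols) (f : ChannelL2) : ChannelL2 :=
  Classical.choose (exists_symbolMultiplier m f)

theorem channelFourier_symbolMultiplierFun (m : Symbols) (f : ChannelL2) (k : ℤ) :
    channelFourier (symbolMultiplierFun m f) k =ᵐ[volume]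
      fun ξ => (m (symbolPoint k ξ) : ℂ) * channelFourier f k ξ :=
  Classical.choose_spec (exists_symbolMultiplier m f) k

/-- The Fourier multiplier with a given symbol. -/
def symbolMultiplier : Symbols →L[ℝ] ChannelL2 →L[ℝ] ChannelL2 :=
  LinearMap.mkContinuous₂ (LinearMap.mk₂ ℝ symbolMultiplierFun
    (fun m n f => channelL2_ext_of_channelFourier fun k => by
      filter_upwards [channelFourier_symbolMultiplierFun (m + n) f k,
        channelFourier_symbolMultiplierFun m f k, channelFourier_symbolMultiplierFun n f k,
        channelFourier_coe_add (symbolMultiplierFun m f) (symbolMultiplierFun n f) k]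
        with ξ h1 h2 h3 h4
      rw [h1, h4, Pi.add_apply, h2, h3, BoundedContinuousFunction.add_apply]
      push_cast
      ring)
    (fun c m f => channelL2_ext_of_channelFourier fun k => by
      filter_upwards [channelFourier_symbolMultiplierFun (c • m) f k,
        channelFourier_symbolMultiplierFun m f k,
        channelFourier_coe_smul c (symbolMultiplierFun m f) k] with ξ h1 h2 h3
      rw [h1, h3, Pi.smul_apply, h2, BoundedContinuousFunction.smul_apply, smul_eq_mul,
        Complex.real_smul]
      push_cast
      ring)
    (fun m f g => channelL2_ext_of_channelFourier fun k => by
      filter_upwards [channelFourier_symbolMultiplierFun m (f + g) k,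
        channelFourier_symbolMultiplierFun m f k, channelFourier_symbolMultiplierFun m g k,
        channelFourier_coe_add (symbolMultiplierFun m f) (symbolMultiplierFun m g) k,
        channelFourier_coe_add f g k] with ξ h1 h2 h3 h4 h5
      rw [h1, h4, Pi.add_apply, h2, h3, h5, Pi.add_apply]
      ring)
    (fun c m f => channelL2_ext_of_channelFourier fun k => by
      filter_upwards [channelFourier_symbolMultiplierFun m (c • f) k,
        channelFourier_symbolMultiplierFun m f k,
        channelFourier_coe_smul c (symbolMultiplierFun m f) k,
        channelFourier_coe_smul c f k] with ξ h1 h2 h3 h4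
      rw [h1, h3, Pi.smul_apply, h2, h4, Pi.smul_apply, Complex.real_smul, Complex.real_smul]
      ring)) 1 (fun m f => by
    rw [one_mul]
    refine norm_le_of_channelFourier_le (norm_nonneg _) fun k => ?_
    filter_upwards [channelFourier_symbolMultiplierFun m f k] with ξ h
    change ‖channelFourier (symbolMultiplierFun m f) k ξ‖ ≤ _
    rw [h, norm_mul, Complex.norm_real]
    exact mul_le_mul_of_nonneg_right (m.norm_coe_le_norm _) (norm_nonneg _))

theorem channelFourier_symbolMultiplier (m : Symbols) (f : ChannelL2) (k : ℤ) :
    channelFourier (symbolMultiplier m f) k =ᵐ[volume]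
      fun ξ => (m (symbolPoint k ξ) : ℂ) * channelFourier f k ξ :=
  channelFourier_symbolMultiplierFun m f k

theorem abs_inv_one_add_sq_sub_le (u v : ℝ) : |(1 + u ^ 2)⁻¹ - (1 + v ^ 2)⁻¹| ≤ |u - v| := by
  have hu : 0 < 1 + u ^ 2 := by positivity
  have hv : 0 < 1 + v ^ 2 := by positivity
  have h1 : (1 + u ^ 2)⁻¹ - (1 + v ^ 2)⁻¹ = (v - u) * ((v + u) / ((1 + u ^ 2) * (1 + v ^ 2))) := by
    field_simp
    ring
  rw [h1, abs_mul, abs_sub_comm]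
  refine mul_le_of_le_one_right (abs_nonneg _) ?_
  rw [abs_div, abs_of_pos (mul_pos hu hv), div_le_one (mul_pos hu hv), abs_le]
  constructor <;> nlinarith [sq_nonneg (u - 1), sq_nonneg (v - 1), sq_nonneg (u + 1),
    sq_nonneg (v + 1), sq_nonneg (u * v)]

/-- The symbol `α k² / (k² + (ξ - βtk)²)`. -/
def stratification (α β t : ℝ) : Symbols :=
  BoundedContinuousFunction.ofNormedAddCommGroup
    (fun p => (if p.2 then α else 0) * (1 + (p.1 - β * t) ^ 2)⁻¹)
    (by
      refine Continuous.mul ?_ (Continuous.inv₀ (by fun_prop) fun p => by positivity)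
      exact (continuous_of_discreteTopology (f := fun b : Bool => if b then α else 0)).comp
        continuous_snd) |α|
    (fun p => by
      have h1 : |(1 + (p.1 - β * t) ^ 2)⁻¹| ≤ 1 := by
        rw [abs_of_nonneg (by positivity)]
        exact inv_le_one_of_one_le₀ (by nlinarith [sq_nonneg (p.1 - β * t)])
      have h2 : |if p.2 then α else 0| ≤ |α| := by split_ifs <;> simp
      rw [Real.norm_eq_abs, abs_mul]
      nlinarith [abs_nonneg (if p.2 then α else 0)])

theorem stratification_apply (α β t : ℝ) (p : ℝ × Bool) :
    stratification α β t p = (if p.2 then α else 0) * (1 + (p.1 - β * t) ^ 2)⁻¹ := rfl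

theorem norm_stratification_le (α β t : ℝ) : ‖stratification α β t‖ ≤ |α| :=
  BoundedContinuousFunction.norm_ofNormedAddCommGroup_le _ (abs_nonneg _) _

/-- Since `v ↦ 1 / (1 + v²)` is Lipschitz, a shift of its argument by `β(t - s)` is controlled
uniformly in `η`. This is what allows one ODE in `Symbols` to replace an ODE for each frequency. -/
theorem continuous_stratification (α β : ℝ) : Continuous (stratification α β) := by
  refine (LipschitzWith.of_dist_le_mul (K := Real.nnabs α * Real.nnabs β) fun t s => ?_).continuous
  refine (BoundedContinuousFunction.dist_le (by positivity)).2 fun p => ?_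
  rw [stratification_apply, stratification_apply, Real.dist_eq, ← mul_sub, abs_mul]
  have h1 := abs_inv_one_add_sq_sub_le (p.1 - β * t) (p.1 - β * s)
  have h2 : |if p.2 then α else 0| ≤ |α| := by split_ifs <;> simp
  refine (mul_le_mul h2 h1 (abs_nonneg _) (abs_nonneg _)).trans (le_of_eq ?_)
  rw [Real.dist_eq, NNReal.coe_mul, Real.coe_nnabs, Real.coe_nnabs,
    show p.1 - β * t - (p.1 - β * s) = -(β * (t - s)) by ring, abs_neg, abs_mul, mul_assoc]

/-- Fundamental solutions of `w'' = -α k² / (k² + (ξ - βtk)²) w` for all frequencies. -/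
structure Propagator (α β : ℝ) where
  c : ℝ → Symbols
  c' : ℝ → Symbols
  s : ℝ → Symbols
  s' : ℝ → Symbols
  c_zero : c 0 = 1
  c'_zero : c' 0 = 0
  s_zero : s 0 = 0
  s'_zero : s' 0 = 1
  hasDerivAt_c : ∀ t, HasDerivAt c (c' t) t
  hasDerivAt_c' : ∀ t, HasDerivAt c' (-(stratification α β t * c t)) t
  hasDerivAt_s : ∀ t, HasDerivAt s (s' t) t
  hasDerivAt_s' : ∀ t, HasDerivAt s' (-(stratification α β t * s t)) t

theorem nonempty_propagator (α β : ℝ) : Nonempty (Propagator α β) := by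
  obtain ⟨c, c', h1, h2, h3, h4⟩ := exists_secondOrderODE_solution (continuous_stratification α β)
    (norm_stratification_le α β) 1 0
  obtain ⟨s, s', h5, h6, h7, h8⟩ := exists_secondOrderODE_solution (continuous_stratification α β)
    (norm_stratification_le α β) 0 1
  exact ⟨⟨c, c', s, s', h1, h2, h5, h6, h3, h4, h7, h8⟩⟩

theorem hasDerivAt_symbol_apply {m : ℝ → Symbols} {m' : Symbols} {t : ℝ} (h : HasDerivAt m m' t)
    (p : ℝ × Bool) : HasDerivAt (fun t => m t p) (m' p) t :=
  (BoundedContinuousFunction.evalCLM ℝ p : Symbols →L[ℝ] ℝ).hasFDerivAt.comp_hasDerivAt t h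

/-- The coefficient vanishes for `k = 0`. Without this the equation `W' = ∂ₓΘ` would fail at `k =
0`, where `∂ₓ` cannot be inverted. -/
theorem Propagator.c'_apply_false {α β : ℝ} (P : Propagator α β) (t η : ℝ) :
    P.c' t (η, false) = 0 := by
  have h1 : ∀ t, HasDerivAt (fun t => P.c' t (η, false)) 0 t := fun t => by
    have := hasDerivAt_symbol_apply (P.hasDerivAt_c' t) (η, false)
    simpa [stratification_apply] using this
  have h2 := is_const_of_deriv_eq_zero (fun t => (h1 t).differentiableAt) (fun t => (h1 t).deriv) t 0
  simp only [P.c'_zero] at h2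
  exact h2

theorem Propagator.c_apply_false {α β : ℝ} (P : Propagator α β) (t η : ℝ) :
    P.c t (η, false) = 1 := by
  have h1 : ∀ t, HasDerivAt (fun t => P.c t (η, false)) 0 t := fun t => by
    have := hasDerivAt_symbol_apply (P.hasDerivAt_c t) (η, false)
    rwa [P.c'_apply_false] at this
  have h2 := is_const_of_deriv_eq_zero (fun t => (h1 t).differentiableAt) (fun t => (h1 t).deriv) t 0
  simp only [P.c_zero] at h2
  exact h2

theorem Propagator.s'_apply_false {α β : ℝ} (P : Propagator α β) (t η : ℝ) :
    P.s' t (η, false) = 1 := by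
  have h1 : ∀ t, HasDerivAt (fun t => P.s' t (η, false)) 0 t := fun t => by
    have := hasDerivAt_symbol_apply (P.hasDerivAt_s' t) (η, false)
    simpa [stratification_apply] using this
  have h2 := is_const_of_deriv_eq_zero (fun t => (h1 t).differentiableAt) (fun t => (h1 t).deriv) t 0
  simp only [P.s'_zero] at h2
  exact h2

/-- A multiplier depends linearly and continuously on its symbol, so derivatives in the supremum
norm pass to derivatives in `L²`. -/
theorem hasDerivAt_symbolMultiplier {m : ℝ → Symbols} {m' : Symbols} {t : ℝ}
    (h : HasDerivAt m m' t) (f : ChannelL2) :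
    HasDerivAt (fun t => symbolMultiplier (m t) f) (symbolMultiplier m' f) t :=
  (symbolMultiplier.flip f).hasFDerivAt.comp_hasDerivAt t h

theorem symbolMultiplier_one (f : ChannelL2) : symbolMultiplier 1 f = f := by
  refine channelL2_ext_of_channelFourier fun k => ?_
  filter_upwards [channelFourier_symbolMultiplier 1 f k] with ξ h
  rw [h]
  simp

/-- The inverse of `∂ₓ` on the modes `k ≠ 0`. -/
theorem exists_dxInverse (f : ChannelL2) : ∃ g : ChannelL2, ∀ k, channelFourier g k =ᵐ[volume]
    fun ξ => -(Complex.I / k) * channelFourier f k ξ := by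
  refine exists_fourierMultiplier (C := 1) (m := fun k _ => -(Complex.I / k))
    (fun k => measurable_const) (fun k ξ => ?_) (fun k ξ => ?_) f
  · rw [norm_neg, norm_div, Complex.norm_I]
    by_cases hk : k = 0
    · simp [hk]
    · have h1 : (1 : ℝ) ≤ |(k : ℝ)| := by exact_mod_cast Int.one_le_abs hk
      rw [Complex.norm_intCast]
      exact (div_le_one (by linarith)).2 h1
  · push_cast
    simp [div_neg, neg_div]

theorem exists_dxMultiplier {f : ChannelL2}
    (hf : ∑' k : ℤ, ∫⁻ ξ, ‖Complex.I * k * channelFourier f k ξ‖ₑ ^ 2 ≠ ∞) :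
    ∃ g : ChannelL2, ∀ k, channelFourier g k =ᵐ[volume]
      fun ξ => Complex.I * k * channelFourier f k ξ := by
  refine exists_channelFourier_eq (fun k => (memLp_channelFourier f k).const_mul _) hf fun k => ?_
  filter_upwards [channelFourier_neg f k] with ξ h
  rw [h]
  simp

/-! ### Existence of solutions -/

theorem sheared_eq_shearBy (β : ℝ) (u : ℝ → Channel → ℝ) (t : ℝ) :
    sheared β u t = shearBy (β * t) (u t) := rfl

theorem locallyBoundedInL2_shear {W : ℝ → ChannelL2} (hW : Continuous W) (b : ℝ → ℝ) :
    LocallyBoundedInL2 (fun t => shearBy (b t) (W t)) := by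
  refine ⟨fun t _ => memLp_shearBy (Lp.memLp _) _, fun T => ?_⟩
  obtain ⟨M, hM⟩ := isCompact_Icc.exists_bound_of_continuousOn (s := Icc 0 T) hW.continuousOn
  refine ⟨M.toNNReal, fun t ht => ?_⟩
  rw [eLpNorm_shearBy (Lp.memLp _), ← Lp.enorm_def, ← ofReal_norm]
  exact ENNReal.ofReal_le_ofReal (hM t ht)

theorem integral_mul_eq_inner (W : ChannelL2) {φ : Channel → ℝ} (hφ : IsTestFunction φ) (a : ℝ) :
    ∫ p, shearBy (-a) W p * φ p = inner ℝ W (shearedTest hφ a) := by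
  rw [integral_shearBy_mul, neg_neg, inner_shearedTest]

/-- The shear is moved onto the test function and the product rule applied; the transport term is
the derivative of the moving test function. -/
theorem hasDerivAt_integral_shear {W : ℝ → ChannelL2} {W' : ChannelL2} {β t : ℝ}
    (hW : HasDerivAt W W' t) {φ : Channel → ℝ} (hφ : IsTestFunction φ) :
    HasDerivAt (fun s => ∫ p, shearBy (-(β * s)) (W s) p * φ p)
      ((∫ p, shearBy (-(β * t)) (W t) p * (β * p.2 * dx φ p)) +
        ∫ p, shearBy (-(β * t)) W' p * φ p) t := by
  have h1 := hW.inner ℝ (hasDerivAt_shearedTest hφ β t)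
  rw [integral_mul_eq_inner _ (hφ.dx.snd_mul β), integral_mul_eq_inner _ hφ]
  simpa only [integral_mul_eq_inner _ hφ] using h1

/-- In moving coordinates `W = c ω₀ + s ∂ₓθ₀` and `Θ = c' ∂ₓ⁻¹ω₀ + s' θ₀`. The hypothesis on `θ₀`
puts `∂ₓθ₀` in `L²`, so that both curves are differentiable in `L²`. -/
theorem exists_isSolution {α β : ℝ} (hα : 0 < α) (P : Propagator α β) (ω₀ θ₀ : ChannelL2)
    (hθ₀ : ∑' k : ℤ, ∫⁻ ξ, ‖Complex.I * k * channelFourier θ₀ k ξ‖ₑ ^ 2 ≠ ∞) :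
    ∃ ω θ : ℝ → Channel → ℝ, IsSolution α β ω₀ θ₀ ω θ ∧ ∀ (t : ℝ) (k : ℤ), ∀ᵐ ξ : ℝ,
      channelFourier (sheared β ω t) k ξ =
        (P.c t (symbolPoint k ξ) : ℂ) * channelFourier ω₀ k ξ +
          Complex.I * k * (P.s t (symbolPoint k ξ) : ℂ) * channelFourier θ₀ k ξ ∧
      channelFourier (sheared β θ t) k ξ =
        -(Complex.I / k) * (P.c' t (symbolPoint k ξ) : ℂ) * channelFourier ω₀ k ξ +
          (P.s' t (symbolPoint k ξ) : ℂ) * channelFourier θ₀ k ξ := by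
  obtain ⟨I₀, hI₀⟩ := exists_dxInverse ω₀
  obtain ⟨Z₀, hZ₀⟩ := exists_dxMultiplier hθ₀
  set T := symbolMultiplier with hT
  set W : ℝ → ChannelL2 := fun t => T (P.c t) ω₀ + T (P.s t) Z₀ with hW
  set Θ : ℝ → ChannelL2 := fun t => T (P.c' t) I₀ + T (P.s' t) θ₀ with hΘ
  have hW' : ∀ t, HasDerivAt W (T (P.c' t) ω₀ + T (P.s' t) Z₀) t := fun t =>
    (hasDerivAt_symbolMultiplier (P.hasDerivAt_c t) ω₀).add
      (hasDerivAt_symbolMultiplier (P.hasDerivAt_s t) Z₀)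
  have hΘ' : ∀ t, HasDerivAt Θ (T (-(stratification α β t * P.c t)) I₀ +
      T (-(stratification α β t * P.s t)) θ₀) t := fun t =>
    (hasDerivAt_symbolMultiplier (P.hasDerivAt_c' t) I₀).add
      (hasDerivAt_symbolMultiplier (P.hasDerivAt_s' t) θ₀)
  have hWf : ∀ t k, ∀ᵐ ξ, channelFourier (W t) k ξ =
      (P.c t (symbolPoint k ξ) : ℂ) * channelFourier ω₀ k ξ +
          Complex.I * k * (P.s t (symbolPoint k ξ) : ℂ) * channelFourier θ₀ k ξ := by
    intro t k
    filter_upwards [channelFourier_coe_add (T (P.c t) ω₀) (T (P.s t) Z₀) k,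
      channelFourier_symbolMultiplier (P.c t) ω₀ k, channelFourier_symbolMultiplier (P.s t) Z₀ k,
      hZ₀ k] with ξ h1 h2 h3 h4
    rw [h1, Pi.add_apply, h2, h3, h4]
    ring
  have hΘf : ∀ t k, ∀ᵐ ξ, channelFourier (Θ t) k ξ =
      -(Complex.I / k) * (P.c' t (symbolPoint k ξ) : ℂ) * channelFourier ω₀ k ξ +
          (P.s' t (symbolPoint k ξ) : ℂ) * channelFourier θ₀ k ξ := by
    intro t k
    filter_upwards [channelFourier_coe_add (T (P.c' t) I₀) (T (P.s' t) θ₀) k,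
      channelFourier_symbolMultiplier (P.c' t) I₀ k, channelFourier_symbolMultiplier (P.s' t) θ₀ k,
      hI₀ k] with ξ h1 h2 h3 h4
    rw [h1, Pi.add_apply, h2, h3, h4]
    ring
  -- This is `W' = ∂ₓΘ`.
  have hWdx : ∀ t k, channelFourier (T (P.c' t) ω₀ + T (P.s' t) Z₀ : ChannelL2) k =ᵐ[volume]
      fun ξ => Complex.I * k * channelFourier (Θ t) k ξ := by
    intro t k
    filter_upwards [channelFourier_coe_add (T (P.c' t) ω₀) (T (P.s' t) Z₀) k,
      channelFourier_symbolMultiplier (P.c' t) ω₀ k, channelFourier_symbolMultiplier (P.s' t) Z₀ k,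
      hZ₀ k, hΘf t k] with ξ h1 h2 h3 h4 h5
    rw [h1, Pi.add_apply, h2, h3, h4, h5]
    by_cases hk : k = 0
    · subst hk
      have : P.c' t (symbolPoint 0 ξ) = 0 := by
        simp only [symbolPoint]
        exact P.c'_apply_false _ _
      simp [this]
    · have hk' : (k : ℂ) ≠ 0 := by exact_mod_cast hk
      field_simp
      linear_combination ((P.c' t (symbolPoint k ξ) : ℂ) * channelFourier ω₀ k ξ) * Complex.I_sq
  -- This is `Θ' = -α ∂ₓΔ⁻¹ω` in moving coordinates, where the frequency `ξ` of `W` is the frequency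
  -- `ξ - kβt` of `ω`.
  have hΘdx : ∀ t k, ∀ᵐ ξ : ℝ, channelFourier (T (-(stratification α β t * P.c t)) I₀ +
      T (-(stratification α β t * P.s t)) θ₀ : ChannelL2) k ξ =
      α * (Complex.I * k / ((k : ℂ) ^ 2 + ((ξ - k * (β * t) : ℝ) : ℂ) ^ 2)) *
        channelFourier (W t) k ξ := by
    intro t k
    filter_upwards [channelFourier_coe_add (T (-(stratification α β t * P.c t)) I₀)
      (T (-(stratification α β t * P.s t)) θ₀) k,
      channelFourier_symbolMultiplier (-(stratification α β t * P.c t)) I₀ k,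
      channelFourier_symbolMultiplier (-(stratification α β t * P.s t)) θ₀ k,
      hI₀ k, hWf t k] with ξ h1 h2 h3 h4 h5
    rw [h1, Pi.add_apply, h2, h3, h4, h5]
    simp only [BoundedContinuousFunction.neg_apply, BoundedContinuousFunction.mul_apply,
      stratification_apply]
    by_cases hk : k = 0
    · subst hk
      simp [symbolPoint]
    · have hk' : (k : ℂ) ≠ 0 := by exact_mod_cast hk
      have hkr : (k : ℝ) ≠ 0 := by exact_mod_cast hk
      have e1 : (1 + (ξ / k - β * t) ^ 2)⁻¹ = (k : ℝ) ^ 2 / ((k : ℝ) ^ 2 + (ξ - k * (β * t)) ^ 2) := by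
        have : (k : ℝ) ^ 2 + (ξ - k * (β * t)) ^ 2 ≠ 0 := by positivity
        field_simp
      have e2 : ((k : ℝ) ^ 2 + (ξ - k * (β * t)) ^ 2 : ℝ) ≠ 0 := by positivity
      have e3 : (k : ℂ) ^ 2 + ((ξ - k * (β * t) : ℝ) : ℂ) ^ 2 ≠ 0 := by exact_mod_cast e2
      have e4 : (symbolPoint k ξ).1 = ξ / k := rfl
      have e5 : (symbolPoint k ξ).2 = true := by simp [symbolPoint, hk]
      rw [e4, e5, if_pos rfl, e1]
      have e6 : Complex.I / k * (k : ℂ) ^ 2 = Complex.I * k := by field_simp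
      push_cast at e3 ⊢
      linear_combination (α / ((k : ℂ) ^ 2 + ((ξ : ℂ) - k * (β * t)) ^ 2) *
        (P.c t (symbolPoint k ξ) : ℂ) * channelFourier ω₀ k ξ) * e6 -
        (α * (k : ℂ) ^ 2 / ((k : ℂ) ^ 2 + ((ξ : ℂ) - k * (β * t)) ^ 2) *
        (P.s t (symbolPoint k ξ) : ℂ) * channelFourier θ₀ k ξ) * Complex.I_sq
  have hsW : ∀ t, shearBy (β * t) (shearBy (-(β * t)) (W t)) = W t := fun t => by
    rw [shearBy_shearBy, add_neg_cancel, shearBy_zero]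
  have hsΘ : ∀ t, shearBy (β * t) (shearBy (-(β * t)) (Θ t)) = Θ t := fun t => by
    rw [shearBy_shearBy, add_neg_cancel, shearBy_zero]
  refine ⟨fun t => shearBy (-(β * t)) (W t), fun t => shearBy (-(β * t)) (Θ t), ⟨?_, ?_, ?_, ?_, ?_, ?_⟩, ?_⟩
  · exact locallyBoundedInL2_shear (continuous_iff_continuousAt.2 fun t => (hW' t).continuousAt) _
  · exact locallyBoundedInL2_shear (continuous_iff_continuousAt.2 fun t => (hΘ' t).continuousAt) _
  · simp only [mul_zero, neg_zero, shearBy_zero]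
    simp [hW, hT, P.c_zero, P.s_zero, symbolMultiplier_one]
  · simp only [mul_zero, neg_zero, shearBy_zero]
    simp [hΘ, hT, P.c'_zero, P.s'_zero, symbolMultiplier_one]
  · intro φ hφ t _
    have h1 := hasDerivAt_integral_shear (β := β) (hW' t) hφ
    rw [integral_mul_eq_inner (T (P.c' t) ω₀ + T (P.s' t) Z₀) hφ,
      inner_eq_neg_inner_dx (hWdx t) hφ, ← integral_mul_eq_inner (Θ t) hφ.dx, ← sub_eq_add_neg] at h1
    exact h1.hasDerivWithinAt
  · intro t _
    set D : ChannelL2 := T (-(stratification α β t * P.c t)) I₀ +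
      T (-(stratification α β t * P.s t)) θ₀ with hD
    -- Since `D = Θ'`, the equation itself dictates `∂ₓΔ⁻¹ω = -α⁻¹ Θ'`, sheared back.
    have hψm : MemLp (shearBy (-(β * t)) ((-α⁻¹) • D : ChannelL2)) 2 volume :=
      memLp_shearBy (Lp.memLp _) _
    refine ⟨shearBy (-(β * t)) ((-α⁻¹) • D : ChannelL2), ⟨memLp_shearBy (Lp.memLp _) _, hψm,
      fun k => ?_⟩, fun φ hφ => ?_⟩
    · have hq : Measure.QuasiMeasurePreserving (fun ξ : ℝ => ξ - k * (-(β * t))) volume volume :=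
        (measurePreserving_sub_right volume _).quasiMeasurePreserving
      filter_upwards [channelFourier_shear (Lp.memLp ((-α⁻¹) • D)) (-(β * t)) k,
        channelFourier_shear (Lp.memLp (W t)) (-(β * t)) k, hq.ae (hΘdx t k),
        hq.ae (channelFourier_coe_smul (-α⁻¹) D k)] with ξ h1 h2 h3 h4
      refine h1.trans ?_
      have h2' : channelFourier (shearBy (-(β * t)) (W t)) k ξ = _ := h2
      rw [h2', h4, Pi.smul_apply, h3, Complex.real_smul]
      have hα' : (α : ℂ) ≠ 0 := by exact_mod_cast hα.ne'
      have e1 : ξ - k * (-(β * t)) - k * (β * t) = ξ := by ring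
      rw [e1]
      push_cast
      field_simp
    · have h1 := hasDerivAt_integral_shear (β := β) (hΘ' t) hφ
      have h2 : ∫ p, shearBy (-(β * t)) ((-α⁻¹) • D : ChannelL2) p * φ p =
          -α⁻¹ * ∫ p, shearBy (-(β * t)) D p * φ p := by
        rw [integral_mul_eq_inner _ hφ, integral_mul_eq_inner _ hφ, real_inner_smul_left]
      have h3 : -(α * (-α⁻¹ * ∫ p, shearBy (-(β * t)) D p * φ p)) =
          ∫ p, shearBy (-(β * t)) D p * φ p := by
        field_simp
      rw [h2, sub_eq_add_neg, h3]
      exact h1.hasDerivWithinAt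
  · intro t k
    filter_upwards [hWf t k, hΘf t k] with ξ h1 h2
    simp only [sheared_eq_shearBy, hsW, hsΘ]
    exact ⟨h1, h2⟩

/-! ### Uniqueness of solutions -/

theorem shearedTest_shearBy {φ : Channel → ℝ} (hφ : IsTestFunction φ) (a b : ℝ) :
    shearedTest (isTestFunction_shearBy hφ a) b = shearedTest hφ (b + a) := by
  simp only [shearedTest, shearBy_shearBy]

theorem shearedTest_dx_shearBy {φ : Channel → ℝ} (hφ : IsTestFunction φ) (a b : ℝ) :
    shearedTest (isTestFunction_shearBy hφ a).dx b = shearedTest hφ.dx (b + a) := by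
  simp only [shearedTest, dx_shearBy, shearBy_shearBy]

/-- A weak transport equation in the coordinates moving with the shear. -/
theorem hasDerivWithinAt_inner_shearedTest {u : ℝ → ChannelL2} {β : ℝ}
    (hu : ∀ T : ℝ, ∃ M : ℝ, ∀ t ∈ Icc 0 T, ‖u t‖ ≤ M)
    (G : (φ : Channel → ℝ) → IsTestFunction φ → ℝ) {t : ℝ}
    (h : ∀ φ : Channel → ℝ, ∀ hφ : IsTestFunction φ,
      HasDerivWithinAt (fun s => inner ℝ (u s) (shearedTest hφ 0))
        (inner ℝ (u t) (shearedTest (hφ.dx.snd_mul β) 0) + G φ hφ) (Ici 0) t)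
    {φ : Channel → ℝ} (hφ : IsTestFunction φ) :
    HasDerivWithinAt (fun s => inner ℝ (u s) (shearedTest hφ (-β * s)))
      (G (shearBy (-β * t) φ) (isTestFunction_shearBy hφ _)) (Ici 0) t := by
  set S := fun s => shearedTest hφ (-β * s) with hS
  set S' := shearedTest (hφ.dx.snd_mul (-β)) (-β * t) with hS'
  have hSd : HasDerivAt S S' t := hasDerivAt_shearedTest hφ (-β) t
  have h1 := h _ (isTestFunction_shearBy hφ (-β * t))
  rw [shearedTest_shearBy hφ, zero_add] at h1
  -- The transport term is exactly minus the derivative of the moving test function, so the two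
  -- cancel below.
  have e1 : shearedTest ((isTestFunction_shearBy hφ (-β * t)).dx.snd_mul β) 0 = -S' := by
    refine Lp.ext ?_
    filter_upwards [coeFn_shearedTest ((isTestFunction_shearBy hφ (-β * t)).dx.snd_mul β) 0,
      coeFn_shearedTest (hφ.dx.snd_mul (-β)) (-β * t), Lp.coeFn_neg S'] with p h2 h3 h4
    rw [h2, h4, Pi.neg_apply, hS', h3, shearBy_zero, dx_shearBy]
    simp [shearBy]
  rw [e1, inner_neg_right] at h1
  -- No strong continuity of `u` is known. Continuity of its pairing with `S'` comes from the
  -- equation tested with that function.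
  have hcont : Tendsto (fun s => inner ℝ (u s) S') (𝓝[Ici 0] t) (𝓝 (inner ℝ (u t) S')) := by
    have h2 := (h _ (isTestFunction_shearBy (hφ.dx.snd_mul (-β)) (-β * t))).continuousWithinAt
    rw [shearedTest_shearBy (hφ.dx.snd_mul (-β)), zero_add] at h2
    exact h2
  obtain ⟨M, hM⟩ := hu (t + 1)
  have hev : ∀ᶠ s in 𝓝[Ici 0] t, s ∈ Icc 0 (t + 1) := by
    filter_upwards [self_mem_nhdsWithin, mem_nhdsWithin_of_mem_nhds (Iic_mem_nhds (lt_add_one t))]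
      with s h2 h3
    exact ⟨h2, h3⟩
  -- A product rule for `⟨u(s), S(s)⟩` when `u` is only bounded and weakly continuous: boundedness
  -- handles the Taylor error of `S`, weak continuity the rest.
  have h2 : HasDerivWithinAt (fun s => inner ℝ (u s) (S s - S t)) (inner ℝ (u t) S') (Ici 0) t := by
    rw [hasDerivWithinAt_iff_isLittleO]
    have e2 : (fun s => inner ℝ (u s) (S s - S t) - inner ℝ (u t) (S t - S t) -
        (s - t) • inner ℝ (u t) S') = fun s => inner ℝ (u s) (S s - S t - (s - t) • S') +
        (s - t) * (inner ℝ (u s) S' - inner ℝ (u t) S') := by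
      funext s
      simp only [sub_self, inner_zero_right, smul_eq_mul, inner_sub_right, inner_smul_right]
      ring
    rw [e2]
    refine Asymptotics.IsLittleO.add ?_ ?_
    · refine Asymptotics.IsBigO.trans_isLittleO (g := fun s => S s - S t - (s - t) • S')
        (Asymptotics.IsBigO.of_bound M ?_)
        ((hasDerivAt_iff_isLittleO.1 hSd).mono nhdsWithin_le_nhds)
      filter_upwards [hev] with s hs
      exact (norm_inner_le_norm _ _).trans
        (mul_le_mul_of_nonneg_right (hM s hs) (norm_nonneg _))
    · have h3 : (fun s => inner ℝ (u s) S' - inner ℝ (u t) S') =o[𝓝[Ici 0] t] fun _ => (1 : ℝ) := by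
        rw [Asymptotics.isLittleO_one_iff]
        simpa using hcont.sub_const (inner ℝ (u t) S')
      have h4 := (Asymptotics.isBigO_refl (fun s : ℝ => s - t) (𝓝[Ici 0] t)).mul_isLittleO h3
      simpa using h4
  have h3 := h1.add h2
  rw [neg_add_cancel_comm] at h3
  refine h3.congr_deriv ?_ |>.congr (fun s _ => ?_) ?_
  · rfl
  · simp only [Pi.add_apply, hS]
    rw [← inner_add_right]
    congr 1
    exact (add_sub_cancel _ _).symm
  · simp only [Pi.add_apply, hS]
    rw [← inner_add_right]
    congr 1
    exact (add_sub_cancel _ _).symm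

/-- The class in `L²` of the difference of two functions. -/
def diffClass (u v : Channel → ℝ) : ChannelL2 :=
  open scoped Classical in if h : MemLp (u - v) 2 volume then h.toLp else 0

theorem coeFn_diffClass {u v : Channel → ℝ} (hu : MemLp u 2 volume) (hv : MemLp v 2 volume) :
    diffClass u v =ᵐ[volume] u - v := by
  rw [diffClass, dif_pos (hu.sub hv)]
  exact MemLp.coeFn_toLp _

theorem inner_diffClass {u v : Channel → ℝ} (hu : MemLp u 2 volume) (hv : MemLp v 2 volume)
    {φ : Channel → ℝ} (hφ : IsTestFunction φ) :
    inner ℝ (diffClass u v) (shearedTest hφ 0) = (∫ p, u p * φ p) - ∫ p, v p * φ p := by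
  have := integral_sub (hu.integrable_mul hφ.memLp) (hv.integrable_mul hφ.memLp)
  simp only [Pi.mul_apply] at this
  rw [inner_shearedTest, shearBy_zero, ← this]
  refine integral_congr_ae ?_
  filter_upwards [coeFn_diffClass hu hv] with p hp
  rw [hp, Pi.sub_apply, sub_mul]

theorem exists_norm_diffClass_le {u v : ℝ → Channel → ℝ} (hu : LocallyBoundedInL2 u)
    (hv : LocallyBoundedInL2 v) (T : ℝ) : ∃ M : ℝ, ∀ t ∈ Icc 0 T, ‖diffClass (u t) (v t)‖ ≤ M := by
  obtain ⟨M₁, h1⟩ := hu.2 T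
  obtain ⟨M₂, h2⟩ := hv.2 T
  refine ⟨M₁ + M₂, fun t ht => ?_⟩
  have h3 : eLpNorm (diffClass (u t) (v t)) 2 volume ≤ ((M₁ + M₂ : ℝ≥0) : ℝ≥0∞) := by
    rw [eLpNorm_congr_ae (coeFn_diffClass (hu.1 t ht.1) (hv.1 t ht.1))]
    refine (eLpNorm_sub_le (hu.1 t ht.1).1 (hv.1 t ht.1).1 one_le_two).trans ?_
    rw [ENNReal.coe_add]
    exact add_le_add (h1 t ht) (h2 t ht)
  rw [Lp.norm_def]
  have := ENNReal.toReal_mono ENNReal.coe_ne_top h3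
  rwa [ENNReal.coe_toReal, NNReal.coe_add] at this

theorem diffClass_eq_zero {u v : Channel → ℝ} (hu : MemLp u 2 volume) (hv : MemLp v 2 volume)
    (h : u =ᵐ[volume] v) : diffClass u v = 0 := by
  refine Lp.ext ((coeFn_diffClass hu hv).trans ?_)
  filter_upwards [h, Lp.coeFn_zero ℝ 2 (volume : Measure Channel)] with p h1 h2
  rw [Pi.sub_apply, h1, h2]
  simp

theorem ae_eq_of_diffClass_eq_zero {u v : Channel → ℝ} (hu : MemLp u 2 volume)
    (hv : MemLp v 2 volume) (h : diffClass u v = 0) : u =ᵐ[volume] v := by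
  filter_upwards [coeFn_diffClass hu hv, Lp.coeFn_zero ℝ 2 (volume : Measure Channel)] with p h1 h2
  rw [h, h2, Pi.sub_apply] at h1
  exact (sub_eq_zero.1 h1.symm)

/-- The operator `∂ₓ²Δ⁻¹` has the symbol `k² / (k² + ξ²) ≤ 1`. In the uniqueness proof this recovers
the `x`-derivative lost in `∂ₜω = ∂ₓθ`. -/
theorem exists_dx_of_isDxInvLaplacian {d Ψ : ChannelL2}
    (h : ∀ k : ℤ, ∀ᵐ ξ : ℝ, channelFourier Ψ k ξ =
      -(Complex.I * (k : ℂ)) / ((k : ℂ) ^ 2 + (ξ : ℂ) ^ 2) * channelFourier d k ξ) :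
    ∃ χ : ChannelL2, ‖χ‖ ≤ ‖d‖ ∧
      ∀ k, channelFourier χ k =ᵐ[volume] fun ξ => Complex.I * k * channelFourier Ψ k ξ := by
  have hb : ∀ (k : ℤ) (ξ : ℝ), ‖(((k : ℝ) ^ 2 / ((k : ℝ) ^ 2 + ξ ^ 2) : ℝ) : ℂ)‖ ≤ 1 := fun k ξ => by
    rw [Complex.norm_real, Real.norm_of_nonneg (by positivity)]
    exact div_le_one_of_le₀ (by nlinarith [sq_nonneg ξ]) (by positivity)
  obtain ⟨χ, hχ⟩ := exists_fourierMultiplier (C := 1)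
    (m := fun k ξ => (((k : ℝ) ^ 2 / ((k : ℝ) ^ 2 + ξ ^ 2) : ℝ) : ℂ))
    (fun k => Complex.measurable_ofReal.comp (by fun_prop)) hb
    (fun k ξ => by rw [Complex.conj_ofReal]; simp) d
  refine ⟨χ, ?_, fun k => ?_⟩
  · have := norm_le_of_channelFourier_le (f := χ) (g := d) zero_le_one fun k => by
      filter_upwards [hχ k] with ξ h1
      rw [h1, norm_mul]
      exact mul_le_mul_of_nonneg_right (hb k ξ) (norm_nonneg _)
    rwa [one_mul] at this
  · filter_upwards [hχ k, h k] with ξ h1 h2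
    rw [h1, h2]
    push_cast
    linear_combination ((k : ℂ) ^ 2 / ((k : ℂ) ^ 2 + (ξ : ℂ) ^ 2) * channelFourier d k ξ) *
      Complex.I_sq

/-- For the differences `d`, `e` of two solutions in moving coordinates, `d' = ∂ₓe` and `∂ₓe' = -α
∂ₓ²Δ⁻¹d` weakly, so `d` is controlled by two time integrals of itself. Iteration gives a factorial
bound and `d = 0`; then `e` is constant, hence zero. Everything is stated for pairings with test
functions, as `∂ₓe` need not be in `L²`. -/
theorem isSolution_unique {α β : ℝ} (hα : 0 < α) {ω₀ θ₀ : Channel → ℝ} {ω θ ω' θ' : ℝ → Channel → ℝ}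
    (h : IsSolution α β ω₀ θ₀ ω θ) (h' : IsSolution α β ω₀ θ₀ ω' θ') {t : ℝ} (ht : 0 ≤ t) :
    ω' t =ᵐ[volume] ω t ∧ θ' t =ᵐ[volume] θ t := by
  set d : ℝ → ChannelL2 := fun t => diffClass (ω' t) (ω t) with hd
  set e : ℝ → ChannelL2 := fun t => diffClass (θ' t) (θ t) with he
  have hω := h.bounded_vorticity.1
  have hω' := h'.bounded_vorticity.1
  have hθ := h.bounded_temperature.1
  have hθ' := h'.bounded_temperature.1
  have hdM := exists_norm_diffClass_le h'.bounded_vorticity h.bounded_vorticity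
  have heM := exists_norm_diffClass_le h'.bounded_temperature h.bounded_temperature
  have hd0 : d 0 = 0 := diffClass_eq_zero (hω' 0 le_rfl) (hω 0 le_rfl)
    (h'.initial_vorticity.trans h.initial_vorticity.symm)
  have he0 : e 0 = 0 := diffClass_eq_zero (hθ' 0 le_rfl) (hθ 0 le_rfl)
    (h'.initial_temperature.trans h.initial_temperature.symm)
  have hF : ∀ t, 0 ≤ t → ∀ φ : Channel → ℝ, ∀ hφ : IsTestFunction φ,
      HasDerivWithinAt (fun s => inner ℝ (d s) (shearedTest hφ (-β * s)))
        (-inner ℝ (e t) (shearedTest hφ.dx (-β * t))) (Ici 0) t := by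
    intro t ht φ hφ
    have h1 := hasDerivWithinAt_inner_shearedTest (u := d) (β := β) hdM
      (fun φ hφ => -inner ℝ (e t) (shearedTest hφ.dx 0)) (fun φ hφ => by
        refine (((h'.vorticity_eq φ hφ t ht).sub (h.vorticity_eq φ hφ t ht)).congr_deriv ?_).congr
          (fun s hs => ?_) ?_
        · rw [inner_diffClass (hω' t ht) (hω t ht), inner_diffClass (hθ' t ht) (hθ t ht)]
          ring
        · exact inner_diffClass (hω' s hs) (hω s hs) hφ
        · exact inner_diffClass (hω' t ht) (hω t ht) hφ) hφ
    rw [shearedTest_dx_shearBy hφ, zero_add] at h1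
    exact h1
  have hG : ∀ t, 0 ≤ t → ∃ Ψ : ChannelL2, (∀ k : ℤ, ∀ᵐ ξ : ℝ, channelFourier Ψ k ξ =
      -(Complex.I * (k : ℂ)) / ((k : ℂ) ^ 2 + (ξ : ℂ) ^ 2) * channelFourier (d t) k ξ) ∧
      ∀ φ : Channel → ℝ, ∀ hφ : IsTestFunction φ,
        HasDerivWithinAt (fun s => inner ℝ (e s) (shearedTest hφ (-β * s)))
          (-(α * inner ℝ Ψ (shearedTest hφ (-β * t)))) (Ici 0) t := by
    intro t ht
    obtain ⟨ψ, ⟨_, hψm, hψ⟩, hψd⟩ := h.temperature_eq t ht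
    obtain ⟨ψ', ⟨_, hψm', hψ'⟩, hψd'⟩ := h'.temperature_eq t ht
    refine ⟨diffClass ψ' ψ, fun k => ?_, fun φ hφ => ?_⟩
    · have hsub : ∀ {u v : Channel → ℝ}, MemLp u 2 volume → MemLp v 2 volume →
          channelFourier (diffClass u v) k =ᵐ[volume]
            fun ξ => channelFourier u k ξ - channelFourier v k ξ := by
        intro u v hu hv
        have e1 : diffClass u v =ᵐ[volume] u + (-1 : ℝ) • v := by
          filter_upwards [coeFn_diffClass hu hv] with p hp
          rw [hp]
          simp [sub_eq_add_neg]
        rw [channelFourier_congr_ae e1]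
        filter_upwards [channelFourier_add hu (hv.const_smul (-1 : ℝ)) k,
          channelFourier_smul (-1) hv k] with ξ h1 h2
        rw [h1, Pi.add_apply, h2]
        simp [sub_eq_add_neg]
      filter_upwards [hsub hψm' hψm, hsub (hω' t ht) (hω t ht), hψ k, hψ' k] with ξ h1 h2 h3 h4
      rw [h1, h2, h3, h4, mul_sub]
    · have h1 := hasDerivWithinAt_inner_shearedTest (u := e) (β := β) heM
        (fun φ hφ => -(α * inner ℝ (diffClass ψ' ψ) (shearedTest hφ 0))) (fun φ hφ => by
          refine (((hψd' φ hφ).sub (hψd φ hφ)).congr_deriv ?_).congr (fun s hs => ?_) ?_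
          · rw [inner_diffClass (hθ' t ht) (hθ t ht), inner_diffClass hψm' hψm]
            ring
          · exact inner_diffClass (hθ' s hs) (hθ s hs) hφ
          · exact inner_diffClass (hθ' t ht) (hθ t ht) hφ) hφ
      rw [shearedTest_shearBy hφ, zero_add] at h1
      exact h1
  have hdz : ∀ T, 0 ≤ T → d T = 0 := by
    intro T hT
    obtain ⟨M, hM⟩ := hdM T
    have hM0 : 0 ≤ M := (norm_nonneg _).trans (hM 0 ⟨le_rfl, hT⟩)
    have hK0 : 0 ≤ α * T := by positivity
    -- One of the two time integrals is bounded crudely by the factor `T`, so each round adds one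
    -- power of `t` and one factor of the factorial.
    have hit : ∀ n : ℕ, ∀ t ∈ Icc 0 T, ‖d t‖ ≤ M * ((α * T) ^ n * t ^ n / n.factorial) := by
      intro n
      induction n with
      | zero => intro t ht; simpa using hM t ht
      | succ n ih =>
        intro t ht
        have ht0 := ht.1
        refine norm_le_of_forall_inner_test (by positivity) fun φ hφ => ?_
        -- Shearing by `βt` in advance makes the moving test function equal to `φ` at the final time
        -- `t`.
        set hφ₁ := isTestFunction_shearBy hφ (β * t) with hφ1def
        set N := ‖shearedTest hφ 0‖ with hN
        have hNs : ∀ a, ‖shearedTest hφ₁ a‖ = N := fun a => by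
          rw [shearedTest_shearBy hφ]
          exact norm_shearedTest hφ _ _
        have hGb : ∀ r ∈ Icc 0 T, |inner ℝ (e r) (shearedTest hφ₁.dx (-β * r))| ≤
            (α * T) * (M * ((α * T) ^ n * r ^ n / n.factorial)) * N := by
          intro r hr
          have hr0 := hr.1
          choose! Ψ hΨ1 hΨ2 using hG
          have hder : ∀ s ∈ Icc 0 r, HasDerivWithinAt
              (fun s => inner ℝ (e s) (shearedTest hφ₁.dx (-β * s)))
              (-(α * inner ℝ (Ψ s) (shearedTest hφ₁.dx (-β * s)))) (Icc 0 r) s := fun s hs =>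
            (hΨ2 s hs.1 _ hφ₁.dx).mono Icc_subset_Ici_self
          have h1 := (convex_Icc 0 r).norm_image_sub_le_of_norm_hasDerivWithin_le
            (C := α * (M * ((α * T) ^ n * r ^ n / n.factorial)) * N) hder (fun s hs => by
              obtain ⟨χ, hχ1, hχ2⟩ := exists_dx_of_isDxInvLaplacian (hΨ1 s hs.1)
              have h2 := inner_eq_neg_inner_dx hχ2 hφ₁ (-β * s)
              rw [show inner ℝ (Ψ s) (shearedTest hφ₁.dx (-β * s)) =
                -inner ℝ χ (shearedTest hφ₁ (-β * s)) by rw [h2, neg_neg], Real.norm_eq_abs,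
                abs_neg, abs_mul, abs_neg, abs_of_pos hα, mul_assoc]
              refine mul_le_mul_of_nonneg_left ?_ hα.le
              refine (abs_real_inner_le_norm _ _).trans ?_
              rw [hNs]
              refine mul_le_mul_of_nonneg_right ?_ (norm_nonneg _)
              refine hχ1.trans ((ih s ⟨hs.1, hs.2.trans hr.2⟩).trans ?_)
              have hs0 := hs.1
              have := hs.2
              gcongr) (left_mem_Icc.2 hr.1) (right_mem_Icc.2 hr.1)
          rw [he0, inner_zero_left, sub_zero, sub_zero, Real.norm_eq_abs, Real.norm_eq_abs,
            abs_of_nonneg hr.1] at h1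
          refine h1.trans ?_
          have : α * (M * ((α * T) ^ n * r ^ n / n.factorial)) * N * r =
            (α * r) * (M * ((α * T) ^ n * r ^ n / n.factorial)) * N := by ring
          rw [this]
          have := hr.2
          gcongr
        have h2 := image_norm_le_of_norm_deriv_right_le_deriv_boundary (a := 0) (b := t)
          (f := fun s => inner ℝ (d s) (shearedTest hφ₁ (-β * s)))
          (f' := fun s => -inner ℝ (e s) (shearedTest hφ₁.dx (-β * s)))
          (B := fun s => M * ((α * T) ^ (n + 1) * s ^ (n + 1) / (n + 1).factorial) * N)
          (B' := fun s => (α * T) * (M * ((α * T) ^ n * s ^ n / n.factorial)) * N)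
          (fun s hs => ((hF s hs.1 _ hφ₁).mono Icc_subset_Ici_self).continuousWithinAt)
          (fun s hs => (hF s hs.1 _ hφ₁).mono (Ici_subset_Ici.2 hs.1))
          (by rw [hd0]; simp)
          (fun s => by
            have h3 := ((((hasDerivAt_pow (n + 1) s).const_mul ((α * T) ^ (n + 1))).div_const
              ((n + 1).factorial : ℝ)).const_mul M).mul_const N
            refine h3.congr_deriv ?_
            rw [Nat.factorial_succ]
            push_cast
            field_simp
            ring)
          (fun s hs => by
            rw [norm_neg]
            exact hGb s ⟨hs.1, hs.2.le.trans ht.2⟩) (right_mem_Icc.2 ht.1)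
        have h4 : shearedTest hφ₁ (-β * t) = shearedTest hφ 0 := by
          rw [shearedTest_shearBy hφ]
          congr 1
          ring
        rw [h4] at h2
        exact h2
    have hlim : Tendsto (fun n : ℕ => M * ((α * T) ^ n * T ^ n / n.factorial)) atTop (𝓝 0) := by
      have h1 := (FloorSemiring.tendsto_pow_div_factorial_atTop (α * T * T)).const_mul M
      rw [mul_zero] at h1
      refine h1.congr fun n => ?_
      rw [mul_pow (α * T) T]
    have h2 := ge_of_tendsto' hlim fun n => hit n T ⟨hT, le_rfl⟩
    exact norm_le_zero_iff.1 h2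
  have hez : ∀ T, 0 ≤ T → e T = 0 := by
    -- With `d = 0` the source for `e` vanishes, so pairings of `e` with moving test functions are
    -- constant.
    intro T hT
    refine norm_le_zero_iff.1 (norm_le_of_forall_inner_test le_rfl fun φ hφ => ?_)
    set hφ₁ := isTestFunction_shearBy hφ (β * T) with hφ1def
    have hder : ∀ s, 0 ≤ s → HasDerivWithinAt (fun s => inner ℝ (e s) (shearedTest hφ₁ (-β * s)))
        0 (Ici 0) s := by
      intro s hs
      obtain ⟨Ψ, hΨ, h2⟩ := hG s hs
      have hΨ0 : Ψ = 0 := by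
        have h3 := norm_le_of_channelFourier_le (f := Ψ) (g := d s) zero_le_one fun k => by
          have h5 : channelFourier (0 : ChannelL2) k =ᵐ[volume] 0 := by
            have := channelFourier_coe_smul 0 (0 : ChannelL2) k
            simpa using this
          filter_upwards [hΨ k, h5] with ξ h4 h5
          rw [h4, hdz s hs, h5]
          simp
        rw [hdz s hs, norm_zero, mul_zero] at h3
        exact norm_le_zero_iff.1 h3
      have h6 := h2 _ hφ₁
      rw [hΨ0] at h6
      simpa using h6
    have h1 := (convex_Icc 0 T).norm_image_sub_le_of_norm_hasDerivWithin_le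
      (C := 0) (fun s hs => (hder s hs.1).mono Icc_subset_Ici_self) (fun s hs => by simp)
      (left_mem_Icc.2 hT) (right_mem_Icc.2 hT)
    have h4 : shearedTest hφ₁ (-β * T) = shearedTest hφ 0 := by
      rw [shearedTest_shearBy hφ]
      congr 1
      ring
    rw [he0, inner_zero_left, sub_zero, zero_mul, h4] at h1
    rw [zero_mul]
    exact h1
  exact ⟨ae_eq_of_diffClass_eq_zero (hω' t ht) (hω t ht) (hdz t ht),
    ae_eq_of_diffClass_eq_zero (hθ' t ht) (hθ t ht) (hez t ht)⟩

/-! ### The equation `u'' = -a u / (1 + s²)`: energy estimates from above -/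

/-- A differential form of Grönwall's inequality. -/
theorem le_mul_exp_of_deriv_le {F F' Φ φ : ℝ → ℝ} {a b : ℝ} (hab : a ≤ b)
    (hF : ∀ s ∈ Icc a b, HasDerivAt F (F' s) s) (hΦ : ∀ s ∈ Icc a b, HasDerivAt Φ (φ s) s)
    (h : ∀ s ∈ Icc a b, F' s ≤ φ s * F s) : F b ≤ Real.exp (Φ b - Φ a) * F a := by
  have hG : ∀ s ∈ Icc a b, HasDerivAt (fun s => F s * Real.exp (-Φ s))
      (F' s * Real.exp (-Φ s) + F s * (Real.exp (-Φ s) * -φ s)) s := fun s hs =>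
    (hF s hs).mul (hΦ s hs).neg.exp
  have h1 := antitoneOn_of_deriv_nonpos (convex_Icc a b)
    (fun s hs => (hG s hs).continuousAt.continuousWithinAt)
    (fun s hs => (hG s (interior_subset hs)).differentiableAt.differentiableWithinAt) (fun s hs => by
      rw [(hG s (interior_subset hs)).deriv]
      have h2 := h s (interior_subset hs)
      have h3 := Real.exp_pos (-Φ s)
      nlinarith) (left_mem_Icc.2 hab) (right_mem_Icc.2 hab) hab
  have h4 : F b = Real.exp (Φ b) * (F b * Real.exp (-Φ b)) := by
    rw [mul_left_comm, ← Real.exp_add]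
    simp
  rw [h4, sub_eq_add_neg, Real.exp_add, mul_assoc, mul_comm (Real.exp (-Φ a))]
  exact mul_le_mul_of_nonneg_left h1 (Real.exp_pos _).le

/-- The bracket `⟨s⟩ = √(1 + s²)`. -/
def bracket (s : ℝ) : ℝ := √(1 + s ^ 2)

theorem bracket_sq (s : ℝ) : bracket s ^ 2 = 1 + s ^ 2 := Real.sq_sqrt (by positivity)

theorem one_le_bracket (s : ℝ) : 1 ≤ bracket s := Real.one_le_sqrt.2 (by nlinarith [sq_nonneg s])

theorem bracket_pos (s : ℝ) : 0 < bracket s := zero_lt_one.trans_le (one_le_bracket s)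

theorem abs_le_bracket (s : ℝ) : |s| ≤ bracket s := Real.abs_le_sqrt (by linarith)

theorem bracket_le_one_add_abs (s : ℝ) : bracket s ≤ 1 + |s| := by
  rw [bracket, Real.sqrt_le_left (by positivity)]
  nlinarith [abs_nonneg s, sq_abs s]

theorem bracket_add_le (s r : ℝ) : bracket (s + r) ≤ bracket s * (1 + |r|) := by
  rw [bracket, Real.sqrt_le_left (mul_nonneg (bracket_pos s).le (by positivity)), mul_pow, bracket_sq]
  have h1 : s * r ≤ |s| * |r| := by rw [← abs_mul]; exact le_abs_self _
  have h2 : |s| ≤ (1 + s ^ 2) := by nlinarith [sq_nonneg (|s| - 1), sq_abs s]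
  nlinarith [abs_nonneg r, sq_abs r, mul_le_mul_of_nonneg_right h2 (abs_nonneg r), sq_nonneg (s * r)]

theorem hasDerivAt_bracket (s : ℝ) : HasDerivAt bracket (s / bracket s) s := by
  have h1 : HasDerivAt (fun s : ℝ => 1 + s ^ 2) (2 * s) s := by
    simpa using (hasDerivAt_pow 2 s).const_add 1
  refine (h1.sqrt (by positivity)).congr_deriv ?_
  rw [bracket, mul_div_mul_left _ _ two_ne_zero]

theorem exp_arsinh_eq (s : ℝ) : Real.exp (Real.arsinh s) = s + bracket s := Real.exp_arsinh s

/-- As `⟨s⟩ = cosh τ` with `τ = arsinh s`, this follows from `cosh 2x = 1 + 2 sinh² x` and `|x| ≤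
|sinh x|` at `x = τ / 2`. It makes the logarithmic losses at `a = 1/4` integrable. -/
theorem one_add_arsinh_sq_le (s : ℝ) : 1 + Real.arsinh s ^ 2 ≤ 2 * bracket s := by
  set x := Real.arsinh s / 2 with hx
  have h1 : |x| ≤ |Real.sinh x| := by
    rw [Real.abs_sinh]
    exact Real.self_le_sinh_iff.2 (abs_nonneg x)
  have h2 := sq_le_sq.2 h1
  have h3 : bracket s = Real.cosh (2 * x) := by
    rw [hx, mul_div_cancel₀ _ two_ne_zero, Real.cosh_arsinh, bracket]
  have h4 : Real.arsinh s = 2 * x := by rw [hx]; ring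
  rw [h3, h4, Real.cosh_two_mul, Real.cosh_sq]
  nlinarith [sq_nonneg x]

theorem hasDerivAt_arsinh_bracket (s : ℝ) : HasDerivAt Real.arsinh (bracket s)⁻¹ s :=
  Real.hasDerivAt_arsinh s

/-- The equation `u'' = -a u / (1 + s²)`. -/
structure IsTaylorGoldstein (a : ℝ) (u u' : ℝ → ℝ) : Prop where
  hasDerivAt : ∀ s, HasDerivAt u (u' s) s
  hasDerivAt' : ∀ s, HasDerivAt u' (-(a / (1 + s ^ 2)) * u s) s

/-- The scale-invariant size `|u| + ⟨s⟩ |u'|`. -/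
def scaleSize (u u' : ℝ → ℝ) (s : ℝ) : ℝ := |u s| + bracket s * |u' s|

theorem scaleSize_nonneg (u u' : ℝ → ℝ) (s : ℝ) : 0 ≤ scaleSize u u' s := by
  have := bracket_pos s
  rw [scaleSize]
  positivity

/-- The derivative in `arsinh s` of `⟨s⟩^{-1/2} u`, up to a power of `⟨s⟩`. -/
def liouville (u u' : ℝ → ℝ) (s : ℝ) : ℝ := bracket s * u' s - s / (2 * bracket s) * u s

section
variable {a : ℝ} {u u' : ℝ → ℝ}

theorem abs_div_two_bracket_le (s : ℝ) : |s / (2 * bracket s)| ≤ 1 / 2 := by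
  have := bracket_pos s
  rw [abs_div, abs_of_pos (by positivity : 0 < 2 * bracket s), div_le_iff₀ (by positivity)]
  linarith [abs_le_bracket s]

theorem abs_liouville_le (u u' : ℝ → ℝ) (s : ℝ) : |liouville u u' s| ≤ scaleSize u u' s := by
  refine (abs_sub _ _).trans ?_
  rw [abs_mul, abs_mul, abs_of_pos (bracket_pos s), scaleSize]
  nlinarith [abs_div_two_bracket_le s, abs_nonneg (u s)]

theorem scaleSize_le (u u' : ℝ → ℝ) (s : ℝ) :
    scaleSize u u' s ≤ |liouville u u' s| + 3 / 2 * |u s| := by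
  have h1 : bracket s * u' s = liouville u u' s + s / (2 * bracket s) * u s := by
    rw [liouville]; ring
  have h2 : bracket s * |u' s| ≤ |liouville u u' s| + 1 / 2 * |u s| := by
    rw [show bracket s * |u' s| = |bracket s * u' s| by rw [abs_mul, abs_of_pos (bracket_pos s)], h1]
    refine (abs_add_le _ _).trans ?_
    rw [abs_mul]
    nlinarith [abs_div_two_bracket_le s, abs_nonneg (u s)]
  rw [scaleSize]
  linarith

theorem IsTaylorGoldstein.deriv_eq (s : ℝ) :
    u' s = s / (2 * bracket s ^ 2) * u s + liouville u u' s / bracket s := by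
  have := bracket_pos s
  rw [liouville]
  field_simp
  ring

/-- This is `v_ττ = (1/4 - a - 3/(4⟨s⟩²)) v` for `v = ⟨s⟩^{-1/2} u`; the first term is due to the
power of `⟨s⟩` left out of `liouville`. -/
theorem IsTaylorGoldstein.hasDerivAt_liouville (h : IsTaylorGoldstein a u u') (s : ℝ) :
    HasDerivAt (liouville u u') (s / (2 * bracket s ^ 2) * liouville u u' s +
      (1 / 4 - a - 3 / (4 * bracket s ^ 2)) / bracket s * u s) s := by
  have hJ := bracket_pos s
  have hJ2 := bracket_sq s
  have h1 := ((hasDerivAt_bracket s).mul (h.hasDerivAt' s)).sub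
    (((hasDerivAt_id s).div ((hasDerivAt_bracket s).const_mul 2) (by positivity)).mul
      (h.hasDerivAt s))
  refine h1.congr_deriv ?_
  rw [← hJ2]
  simp only [id, Pi.div_apply, liouville]
  field_simp
  have h3 : s ^ 2 = bracket s ^ 2 - 1 := by linarith
  ring_nf
  simp only [h3]
  ring_nf

theorem exp_weight (δ C s₀ s₁ : ℝ) :
    Real.exp ((Real.log (bracket s₁) + δ * Real.arsinh s₁ + C * Real.arctan s₁) -
      (Real.log (bracket s₀) + δ * Real.arsinh s₀ + C * Real.arctan s₀)) =
    bracket s₁ / bracket s₀ * Real.exp (δ * (Real.arsinh s₁ - Real.arsinh s₀)) *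
      Real.exp (C * (Real.arctan s₁ - Real.arctan s₀)) := by
  rw [← Real.exp_log (div_pos (bracket_pos s₁) (bracket_pos s₀)), ← Real.exp_add, ← Real.exp_add,
    Real.log_div (bracket_pos s₁).ne' (bracket_pos s₀).ne']
  congr 1
  ring

/-- The three summands of the Grönwall exponent: `log ⟨s⟩` restores the factor removed from `u²`, `δ
arsinh s` is the exponential growth in `τ`, and the bounded `arctan` collects the integrable errors.
-/
theorem hasDerivAt_weight (δ C s : ℝ) :
    HasDerivAt (fun s => Real.log (bracket s) + δ * Real.arsinh s + C * Real.arctan s)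
      (s / bracket s ^ 2 + δ / bracket s + C / bracket s ^ 2) s := by
  have hJ := bracket_pos s
  have h1 := (((hasDerivAt_bracket s).log hJ.ne').add
    ((hasDerivAt_arsinh_bracket s).const_mul δ)).add ((Real.hasDerivAt_arctan s).const_mul C)
  refine h1.congr_deriv ?_
  rw [bracket_sq, ← bracket_sq]
  field_simp

theorem exp_mul_arctan_sub_le {C : ℝ} (hC : 0 ≤ C) (s₀ s₁ : ℝ) :
    Real.exp (C * (Real.arctan s₁ - Real.arctan s₀)) ≤ Real.exp (C * π) := by
  have h1 := Real.arctan_lt_pi_div_two s₁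
  have h2 := Real.neg_pi_div_two_lt_arctan s₀
  rw [Real.exp_le_exp]
  exact mul_le_mul_of_nonneg_left (by linarith) hC

/-- Grönwall for the energy `q² + m u²`. It is comparable to `scaleSize²` because `m > 0`, which is
why `a = 1/4` is excluded. -/
theorem sq_scaleSize_le_of_ne (ha : a ≠ 1 / 4) : ∃ K : ℝ, 0 < K ∧ ∀ u u' : ℝ → ℝ,
    IsTaylorGoldstein a u u' → ∀ s₀ s₁ : ℝ, s₀ ≤ s₁ → scaleSize u u' s₁ ^ 2 ≤
      K * (bracket s₁ / bracket s₀ *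
        Real.exp (2 * (√(1 - 4 * a) / 2) * (Real.arsinh s₁ - Real.arsinh s₀))) *
        scaleSize u u' s₀ ^ 2 := by
  set δ := √(1 - 4 * a) / 2 with hδ
  have hδ0 : 0 ≤ δ := by positivity
  set m := |1 / 4 - a| with hm
  have hm0 : 0 < m := abs_pos.2 (sub_ne_zero.2 ha.symm)
  -- For `a < 1/4` one has `m = δ²`; for `a > 1/4` one has `δ = 0` and the leading cross terms
  -- cancel. Both cases then run together.
  have hmδ : 1 / 4 - a + m = 2 * δ ^ 2 ∧ δ ^ 2 ≤ m := by
    rcases le_total 0 (1 - 4 * a) with h | h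
    · have h1 : δ ^ 2 = 1 / 4 - a := by rw [hδ, div_pow, Real.sq_sqrt h]; ring
      rw [hm, abs_of_nonneg (by linarith), h1]
      constructor <;> linarith
    · have h1 : δ = 0 := by rw [hδ, Real.sqrt_eq_zero_of_nonpos h, zero_div]
      rw [hm, abs_of_nonpos (by linarith), h1]
      constructor <;> linarith
  set L := 1 + m⁻¹ with hL
  have hL0 : 0 < L := by positivity
  refine ⟨(2 + 5 * m⁻¹) * Real.exp (L * π) * (1 + m), by positivity, fun u u' h s₀ s₁ hs => ?_⟩
  set q := liouville u u' with hq
  have hF : ∀ s, HasDerivAt (fun s => q s ^ 2 + m * u s ^ 2)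
      (2 * q s * (s / (2 * bracket s ^ 2) * q s +
      (1 / 4 - a - 3 / (4 * bracket s ^ 2)) / bracket s * u s) +
        m * (2 * u s * (s / (2 * bracket s ^ 2) * u s + q s / bracket s))) s := fun s => by
    have h1 := ((h.hasDerivAt_liouville s).pow 2).add (((h.hasDerivAt s).pow 2).const_mul m)
    refine h1.congr_deriv ?_
    rw [IsTaylorGoldstein.deriv_eq (u := u) (u' := u') s]
    simp [hq]
  have h1 := le_mul_exp_of_deriv_le hs (fun s _ => hF s) (fun s _ => hasDerivAt_weight (2 * δ) L s) (fun s _ => by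
    have hJ := one_le_bracket s
    have hJ0 := bracket_pos s
    set J := bracket s
    have e1 : 2 * q s * (s / (2 * J ^ 2) * q s + (1 / 4 - a - 3 / (4 * J ^ 2)) / J * u s) +
        m * (2 * u s * (s / (2 * J ^ 2) * u s + q s / J)) =
        s / J ^ 2 * (q s ^ 2 + m * u s ^ 2) + (1 / 4 - a + m) * (2 * q s * u s) / J +
          (-(3 / 2) * (q s * u s) / J) / J ^ 2 := by
      field_simp
      ring
    have e2 : (1 / 4 - a + m) * (2 * q s * u s) ≤ 2 * δ * (q s ^ 2 + m * u s ^ 2) := by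
      rw [hmδ.1]
      nlinarith [mul_nonneg hδ0 (sq_nonneg (q s - δ * u s)), mul_nonneg hδ0
        (mul_nonneg (sub_nonneg.2 hmδ.2) (sq_nonneg (u s)))]
    have e3 : -(3 / 2) * (q s * u s) / J ≤ L * (q s ^ 2 + m * u s ^ 2) := by
      have h2 : -(3 / 2) * (q s * u s) ≤ L * (q s ^ 2 + m * u s ^ 2) := by
        have : L * (q s ^ 2 + m * u s ^ 2) =
          q s ^ 2 + u s ^ 2 + m * u s ^ 2 + m⁻¹ * q s ^ 2 := by
          rw [hL]
          field_simp
          ring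
        have h3 : 0 ≤ m * u s ^ 2 := by positivity
        have h4 : 0 ≤ m⁻¹ * q s ^ 2 := by positivity
        nlinarith [sq_nonneg (q s + u s)]
      exact (div_le_of_le_mul₀ hJ0.le (by positivity) (h2.trans
        (le_mul_of_one_le_right (by positivity) hJ)))
    rw [e1, add_mul (s / J ^ 2 + 2 * δ / J), add_mul (s / J ^ 2)]
    refine add_le_add (add_le_add le_rfl ?_) ?_
    · rw [div_mul_eq_mul_div]
      gcongr
    · rw [div_mul_eq_mul_div]
      gcongr)
  rw [exp_weight] at h1
  have h2 : scaleSize u u' s₁ ^ 2 ≤ (2 + 5 * m⁻¹) * (q s₁ ^ 2 + m * u s₁ ^ 2) := by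
    refine (pow_le_pow_left₀ (scaleSize_nonneg _ _ _) (scaleSize_le u u' s₁) 2).trans ?_
    have e1 : (2 + 5 * m⁻¹) * (q s₁ ^ 2 + m * u s₁ ^ 2) =
        2 * q s₁ ^ 2 + 5 * u s₁ ^ 2 + 2 * (m * u s₁ ^ 2) + 5 * (m⁻¹ * q s₁ ^ 2) := by
      field_simp
      ring
    have e2 : 0 ≤ m * u s₁ ^ 2 := by positivity
    have e3 : 0 ≤ m⁻¹ * q s₁ ^ 2 := by positivity
    rw [e1, ← sq_abs (q s₁), ← sq_abs (u s₁)]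
    rw [← sq_abs (q s₁)] at e3
    rw [← sq_abs (u s₁)] at e2
    nlinarith [sq_nonneg (|q s₁| - 3 / 2 * |u s₁|), sq_nonneg (u s₁), sq_abs (u s₁)]
  have h3 : q s₀ ^ 2 + m * u s₀ ^ 2 ≤ (1 + m) * scaleSize u u' s₀ ^ 2 := by
    have e1 : q s₀ ^ 2 ≤ scaleSize u u' s₀ ^ 2 := sq_le_sq' (abs_le.1 (abs_liouville_le u u' s₀)).1
      (abs_le.1 (abs_liouville_le u u' s₀)).2
    have e2 : |u s₀| ≤ scaleSize u u' s₀ := by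
      rw [scaleSize]
      have := bracket_pos s₀
      linarith [show 0 ≤ bracket s₀ * |u' s₀| by positivity]
    have e3 : u s₀ ^ 2 ≤ scaleSize u u' s₀ ^ 2 := sq_le_sq' (abs_le.1 e2).1 (abs_le.1 e2).2
    nlinarith
  have h4 := exp_mul_arctan_sub_le hL0.le s₀ s₁
  have hρ : 0 < bracket s₁ / bracket s₀ := div_pos (bracket_pos _) (bracket_pos _)
  calc scaleSize u u' s₁ ^ 2 ≤ (2 + 5 * m⁻¹) * (q s₁ ^ 2 + m * u s₁ ^ 2) := h2
    _ ≤ (2 + 5 * m⁻¹) * (bracket s₁ / bracket s₀ *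
        Real.exp (2 * δ * (Real.arsinh s₁ - Real.arsinh s₀)) * Real.exp (L * π) *
          ((1 + m) * scaleSize u u' s₀ ^ 2)) := by
        refine mul_le_mul_of_nonneg_left (h1.trans ?_) (by positivity)
        gcongr
    _ = _ := by ring

/-- At `a = 1/4` the unperturbed equation is `v_ττ = 0`, for which `v_τ` and `v - (τ - c)v_τ` are
conserved for any base point `c`. Their squares form the energy; returning to `u` costs a factor
linear in `τ - c` at each end. The condition on `c` keeps the perturbation integrable. -/
theorem sq_scaleSize_le_of_eq : ∃ K : ℝ, 0 < K ∧ ∀ u u' : ℝ → ℝ,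
    IsTaylorGoldstein (1 / 4) u u' → ∀ s₀ s₁ c : ℝ, s₀ ≤ s₁ →
      (∀ s ∈ Icc s₀ s₁, |Real.arsinh s - c| ≤ |Real.arsinh s|) → scaleSize u u' s₁ ^ 2 ≤
      K * (bracket s₁ / bracket s₀ * ((1 + |Real.arsinh s₁ - c|) ^ 2 *
        (1 + |Real.arsinh s₀ - c|) ^ 2)) * scaleSize u u' s₀ ^ 2 := by
  refine ⟨5 * Real.exp (6 * π) * 2, by positivity, fun u u' h s₀ s₁ c hs hc => ?_⟩
  set q := liouville u u' with hq
  set A : ℝ → ℝ := fun s => u s - (Real.arsinh s - c) * q s with hA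
  have hAd : ∀ s, HasDerivAt A (s / (2 * bracket s ^ 2) * A s +
      3 / (4 * bracket s ^ 3) * ((Real.arsinh s - c) * u s)) s := fun s => by
    have hJ := bracket_pos s
    have h1 := (h.hasDerivAt s).sub (((hasDerivAt_arsinh_bracket s).sub_const c).mul
      (h.hasDerivAt_liouville s))
    refine h1.congr_deriv ?_
    rw [IsTaylorGoldstein.deriv_eq (u := u) (u' := u') s]
    simp only [hA, ← hq]
    field_simp
    ring
  have hF : ∀ s, HasDerivAt (fun s => A s ^ 2 + q s ^ 2)
      (2 * A s * (s / (2 * bracket s ^ 2) * A s +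
      3 / (4 * bracket s ^ 3) * ((Real.arsinh s - c) * u s)) +
        2 * q s * (s / (2 * bracket s ^ 2) * q s +
      (1 / 4 - 1 / 4 - 3 / (4 * bracket s ^ 2)) / bracket s * u s)) s := fun s => by
    have h1 := ((hAd s).pow 2).add ((h.hasDerivAt_liouville s).pow 2)
    refine h1.congr_deriv ?_
    simp [hq]
  have h1 := le_mul_exp_of_deriv_le hs (fun s _ => hF s) (fun s _ => hasDerivAt_weight 0 6 s) (fun s hsI => by
    have hJ := one_le_bracket s
    have hJ0 := bracket_pos s
    have hcs := hc s hsI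
    have hτ := one_add_arsinh_sq_le s
    set J := bracket s
    set τ := Real.arsinh s - c with hτdef
    have hu : u s = A s + τ * q s := by simp only [hA, ← hτdef]; ring
    have hτ2 : 1 + τ ^ 2 ≤ 2 * J := by
      have := sq_le_sq.2 hcs
      linarith
    have e1 : 2 * A s * (s / (2 * J ^ 2) * A s + 3 / (4 * J ^ 3) * (τ * u s)) +
        2 * q s * (s / (2 * J ^ 2) * q s + (1 / 4 - 1 / 4 - 3 / (4 * J ^ 2)) / J * u s) =
        s / J ^ 2 * (A s ^ 2 + q s ^ 2) + (3 / 2 * ((A s * τ - q s) * u s) / J) / J ^ 2 := by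
      field_simp
      ring
    have e3 : 3 / 2 * ((A s * τ - q s) * u s) / J ≤ 6 * (A s ^ 2 + q s ^ 2) := by
      rw [div_le_iff₀ hJ0, hu]
      -- The squares of the two factors on the left add up to the right-hand side.
      have e4 : (A s * τ - q s) * (A s + τ * q s) ≤ (1 + τ ^ 2) * (A s ^ 2 + q s ^ 2) := by
        nlinarith [sq_nonneg (A s * τ - q s - (A s + τ * q s)), sq_nonneg (A s * τ - q s),
          sq_nonneg (A s + τ * q s)]
      have e5 := mul_le_mul_of_nonneg_right hτ2 (show 0 ≤ A s ^ 2 + q s ^ 2 by positivity)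
      have e6 : 0 ≤ J * (A s ^ 2 + q s ^ 2) := by positivity
      nlinarith
    rw [e1, zero_div, add_zero, add_mul]
    refine add_le_add le_rfl ?_
    rw [div_mul_eq_mul_div 6]
    gcongr)
  rw [exp_weight, zero_mul, Real.exp_zero, mul_one] at h1
  have h4 := exp_mul_arctan_sub_le (show (0 : ℝ) ≤ 6 by norm_num) s₀ s₁
  have hρ : 0 < bracket s₁ / bracket s₀ := div_pos (bracket_pos _) (bracket_pos _)
  set T₁ := |Real.arsinh s₁ - c| with hT1
  set T₀ := |Real.arsinh s₀ - c| with hT0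
  have hT1n : 0 ≤ T₁ := abs_nonneg _
  have hT0n : 0 ≤ T₀ := abs_nonneg _
  have h2 : scaleSize u u' s₁ ^ 2 ≤ 5 * (1 + T₁) ^ 2 * (A s₁ ^ 2 + q s₁ ^ 2) := by
    have e0 : |u s₁| ≤ |A s₁| + T₁ * |q s₁| := by
      rw [hT1, ← abs_mul]
      refine le_trans (le_of_eq ?_) (abs_add_le _ _)
      congr 1
      simp only [hA]
      ring
    have e1 : scaleSize u u' s₁ ≤ 3 / 2 * (1 + T₁) * (|A s₁| + |q s₁|) := by
      have := scaleSize_le u u' s₁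
      nlinarith [abs_nonneg (A s₁), abs_nonneg (q s₁), mul_nonneg hT1n (abs_nonneg (A s₁))]
    refine (pow_le_pow_left₀ (scaleSize_nonneg _ _ _) e1 2).trans ?_
    rw [mul_pow, mul_pow, ← sq_abs (A s₁), ← sq_abs (q s₁)]
    have e2 : (|A s₁| + |q s₁|) ^ 2 ≤ 2 * (|A s₁| ^ 2 + |q s₁| ^ 2) := by
      nlinarith [sq_nonneg (|A s₁| - |q s₁|)]
    calc (3 / 2 : ℝ) ^ 2 * (1 + T₁) ^ 2 * (|A s₁| + |q s₁|) ^ 2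
        ≤ (3 / 2 : ℝ) ^ 2 * (1 + T₁) ^ 2 * (2 * (|A s₁| ^ 2 + |q s₁| ^ 2)) := by gcongr
      _ ≤ _ := by nlinarith [show 0 ≤ (1 + T₁) ^ 2 * (|A s₁| ^ 2 + |q s₁| ^ 2) by positivity]
  have h3 : A s₀ ^ 2 + q s₀ ^ 2 ≤ 2 * (1 + T₀) ^ 2 * scaleSize u u' s₀ ^ 2 := by
    have e1 := abs_liouville_le u u' s₀
    have e2 : |u s₀| ≤ scaleSize u u' s₀ := by
      rw [scaleSize]
      have := bracket_pos s₀
      linarith [show 0 ≤ bracket s₀ * |u' s₀| by positivity]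
    set S := scaleSize u u' s₀
    have e3 : |A s₀| ≤ (1 + T₀) * S := by
      refine (abs_sub _ _).trans ?_
      rw [abs_mul, ← hT0]
      nlinarith
    have e4 : |q s₀| ≤ (1 + T₀) * S := by
      nlinarith [mul_nonneg hT0n ((abs_nonneg _).trans e1)]
    have e5 := pow_le_pow_left₀ (abs_nonneg _) e3 2
    have e6 := pow_le_pow_left₀ (abs_nonneg _) e4 2
    rw [sq_abs, mul_pow] at e5 e6
    linarith
  calc scaleSize u u' s₁ ^ 2 ≤ 5 * (1 + T₁) ^ 2 * (A s₁ ^ 2 + q s₁ ^ 2) := h2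
    _ ≤ 5 * (1 + T₁) ^ 2 * (bracket s₁ / bracket s₀ * Real.exp (6 * π) *
          (2 * (1 + T₀) ^ 2 * scaleSize u u' s₀ ^ 2)) := by
        refine mul_le_mul_of_nonneg_left (h1.trans ?_) (by positivity)
        gcongr
    _ = _ := by ring

end

/-! ### Growth in terms of the length of the interval -/

theorem bracket_neg (s : ℝ) : bracket (-s) = bracket s := by simp [bracket]

theorem bracket_div_le {s₀ s₁ : ℝ} (h : s₀ ≤ s₁) : bracket s₁ / bracket s₀ ≤ 1 + (s₁ - s₀) := by
  have h1 := bracket_add_le s₀ (s₁ - s₀)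
  rw [add_sub_cancel, abs_of_nonneg (sub_nonneg.2 h), mul_comm] at h1
  exact (div_le_iff₀ (bracket_pos s₀)).2 h1

theorem add_bracket_pos (s : ℝ) : 0 < s + bracket s := by
  rw [← exp_arsinh_eq]
  exact Real.exp_pos _

theorem exp_arsinh_sub (s₀ s₁ : ℝ) :
    Real.exp (Real.arsinh s₁ - Real.arsinh s₀) = (s₁ + bracket s₁) / (s₀ + bracket s₀) := by
  rw [Real.exp_sub, exp_arsinh_eq, exp_arsinh_eq]

theorem exp_arsinh_sub_le_of_nonneg {s₀ s₁ : ℝ} (h : s₀ ≤ s₁) (h0 : 0 ≤ s₀) :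
    Real.exp (Real.arsinh s₁ - Real.arsinh s₀) ≤ 2 * (1 + (s₁ - s₀)) := by
  have hJ := bracket_pos s₀
  have h1 := (div_le_iff₀ hJ).1 (bracket_div_le h)
  have h2 := (le_abs_self s₁).trans (abs_le_bracket s₁)
  rw [exp_arsinh_sub, div_le_iff₀ (add_bracket_pos _)]
  nlinarith [mul_nonneg (show 0 ≤ 1 + (s₁ - s₀) by linarith) h0]

theorem exp_arsinh_sub_le_of_nonpos {s₀ s₁ : ℝ} (h : s₀ ≤ s₁) (h1 : s₁ ≤ 0) :
    Real.exp (Real.arsinh s₁ - Real.arsinh s₀) ≤ 2 * (1 + (s₁ - s₀)) := by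
  have := exp_arsinh_sub_le_of_nonneg (neg_le_neg h) (neg_nonneg.2 h1)
  rw [Real.arsinh_neg, Real.arsinh_neg] at this
  convert this using 2 <;> ring

theorem exp_abs_arsinh_le (s : ℝ) : Real.exp |Real.arsinh s| ≤ 2 * bracket s := by
  have key : ∀ s : ℝ, Real.exp (Real.arsinh s) ≤ 2 * bracket s := fun s => by
    rw [exp_arsinh_eq]
    linarith [(le_abs_self s).trans (abs_le_bracket s)]
  rcases abs_choice (Real.arsinh s) with h | h
  · rw [h]; exact key s
  · rw [h, ← Real.arsinh_neg, ← bracket_neg]; exact key (-s)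

/-- The factor by which solutions of `u'' = -a u / (1 + s²)` grow on an interval of length `r`. -/
def intervalGrowth (a r : ℝ) : ℝ :=
  open scoped Classical in
  if a = 1 / 4 then (1 + r) ^ (1 / 2 : ℝ) * (1 + Real.log (1 + r))
  else (1 + r) ^ (1 / 2 + √(1 - 4 * a) / 2)

theorem intervalGrowth_nonneg (a : ℝ) {r : ℝ} (hr : 0 ≤ r) : 0 ≤ intervalGrowth a r := by
  have := Real.log_nonneg (show 1 ≤ 1 + r by linarith)
  rw [intervalGrowth]
  split_ifs <;> positivity

/-- On one side of `0` the increase of `e^τ` is at most linear in the length of the interval. Across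
`0` it is a product of contributions from both ends. -/
theorem bracket_div_mul_exp_le {δ : ℝ} (hδ : 0 ≤ δ) (hδ1 : δ ≤ 1 / 2) {s₀ s₁ : ℝ} (h : s₀ ≤ s₁) :
    bracket s₁ / bracket s₀ * Real.exp (2 * δ * (Real.arsinh s₁ - Real.arsinh s₀)) ≤
      4 * ((1 + (s₁ - s₀)) ^ (1 / 2 + δ)) ^ 2 := by
  set r := s₁ - s₀ with hr
  have hr0 : 0 ≤ r := sub_nonneg.2 h
  have hr1 : 0 < 1 + r := by linarith
  have e1 : ((1 + r) ^ (1 / 2 + δ)) ^ 2 = (1 + r) * (1 + r) ^ (2 * δ) := by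
    rw [← Real.rpow_natCast, ← Real.rpow_mul hr1.le, ← Real.rpow_one_add' hr1.le (by positivity)]
    congr 1
    push_cast
    ring
  have e2 : Real.exp (2 * δ * (Real.arsinh s₁ - Real.arsinh s₀)) =
      Real.exp (Real.arsinh s₁ - Real.arsinh s₀) ^ (2 * δ) := by
    rw [← Real.exp_mul, mul_comm]
  have h2δ : ∀ {x : ℝ}, 1 ≤ x → x ^ (2 * δ) ≤ x := fun {x} hx => by
    conv_rhs => rw [← Real.rpow_one x]
    exact Real.rpow_le_rpow_of_exponent_le hx (by linarith)
  have hp : 0 ≤ (1 + r) ^ (2 * δ) := by positivity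
  rw [e1, e2]
  have hsame : Real.exp (Real.arsinh s₁ - Real.arsinh s₀) ≤ 2 * (1 + r) →
      bracket s₁ / bracket s₀ * Real.exp (Real.arsinh s₁ - Real.arsinh s₀) ^ (2 * δ) ≤
        4 * ((1 + r) * (1 + r) ^ (2 * δ)) := fun h3 => by
    have h4 := Real.rpow_le_rpow (Real.exp_pos _).le h3 (by positivity : 0 ≤ 2 * δ)
    rw [Real.mul_rpow two_pos.le hr1.le] at h4
    have h5 := mul_le_mul_of_nonneg_right (h2δ one_le_two) hp
    calc _ ≤ (1 + r) * (2 * (1 + r) ^ (2 * δ)) :=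
          mul_le_mul (bracket_div_le h) (h4.trans h5) (by positivity) hr1.le
      _ ≤ _ := by nlinarith [mul_nonneg hr1.le hp]
  rcases le_total 0 s₀ with h0 | h0
  · exact hsame (exp_arsinh_sub_le_of_nonneg h h0)
  rcases le_total s₁ 0 with h1 | h1
  · exact hsame (exp_arsinh_sub_le_of_nonpos h h1)
  -- The interval contains `0`: the contribution `⟨s₀⟩^{2δ}` is at most `⟨s₀⟩` since `2δ ≤ 1`, and
  -- the quotient `⟨s₁⟩ / ⟨s₀⟩` absorbs it.
  · have hJ1 : bracket s₁ ≤ 1 + r := by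
      have := bracket_le_one_add_abs s₁
      rw [abs_of_nonneg h1] at this
      linarith
    have hJ10 := bracket_pos s₁
    have hJ00 := bracket_pos s₀
    have h3 : Real.exp (Real.arsinh s₁ - Real.arsinh s₀) ≤ 4 * (bracket s₁ * bracket s₀) := by
      calc _ ≤ Real.exp (|Real.arsinh s₁| + |Real.arsinh s₀|) := Real.exp_le_exp.2
            (by linarith [le_abs_self (Real.arsinh s₁), neg_le_abs (Real.arsinh s₀)])
        _ = Real.exp |Real.arsinh s₁| * Real.exp |Real.arsinh s₀| := Real.exp_add _ _
        _ ≤ (2 * bracket s₁) * (2 * bracket s₀) :=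
          mul_le_mul (exp_abs_arsinh_le _) (exp_abs_arsinh_le _) (Real.exp_pos _).le (by positivity)
        _ = _ := by ring
    have h4 := Real.rpow_le_rpow (Real.exp_pos _).le h3 (by positivity : 0 ≤ 2 * δ)
    rw [Real.mul_rpow (by norm_num) (by positivity), Real.mul_rpow hJ10.le hJ00.le] at h4
    have h5 : (4 : ℝ) ^ (2 * δ) ≤ 4 := h2δ (by norm_num)
    have h6 : bracket s₀ ^ (2 * δ) ≤ bracket s₀ := h2δ (one_le_bracket _)
    have h7 : bracket s₁ ^ (2 * δ) ≤ (1 + r) ^ (2 * δ) :=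
      Real.rpow_le_rpow hJ10.le hJ1 (by positivity)
    calc _ ≤ bracket s₁ / bracket s₀ * (4 * ((1 + r) ^ (2 * δ) * bracket s₀)) := by
          refine mul_le_mul_of_nonneg_left (h4.trans ?_) (by positivity)
          gcongr
      _ = 4 * (bracket s₁ * (1 + r) ^ (2 * δ)) := by field_simp
      _ ≤ _ := by gcongr

/-- The base point `c` is the value of `arsinh` on the interval that is closest to `0`. On one side
of `0` it is attained at an end, whose factor becomes `1`. -/
theorem exists_clamp {s₀ s₁ : ℝ} (h : s₀ ≤ s₁) :
    ∃ c : ℝ, (∀ s ∈ Icc s₀ s₁, |Real.arsinh s - c| ≤ |Real.arsinh s|) ∧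
      bracket s₁ / bracket s₀ * ((1 + |Real.arsinh s₁ - c|) ^ 2 *
        (1 + |Real.arsinh s₀ - c|) ^ 2) ≤
      16 * ((1 + (s₁ - s₀)) ^ (1 / 2 : ℝ) * (1 + Real.log (1 + (s₁ - s₀)))) ^ 2 := by
  set r := s₁ - s₀ with hr
  have hr0 : 0 ≤ r := sub_nonneg.2 h
  have hr1 : 0 < 1 + r := by linarith
  have hlog : 0 ≤ Real.log (1 + r) := Real.log_nonneg (by linarith)
  have e1 : ((1 + r) ^ (1 / 2 : ℝ) * (1 + Real.log (1 + r))) ^ 2 =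
      (1 + r) * (1 + Real.log (1 + r)) ^ 2 := by
    rw [mul_pow, ← Real.sqrt_eq_rpow, Real.sq_sqrt hr1.le]
  rw [e1]
  set L := 1 + Real.log (1 + r) with hL
  have hlog2 : ∀ {x : ℝ}, Real.exp x ≤ 2 * (1 + r) → x ≤ L := fun {x} hx => by
    have h1 := (Real.le_log_iff_exp_le (by positivity)).2 hx
    rw [Real.log_mul two_ne_zero hr1.ne'] at h1
    linarith [Real.log_two_lt_d9]
  have hρ := bracket_div_le h
  have hρ0 : 0 < bracket s₁ / bracket s₀ := div_pos (bracket_pos _) (bracket_pos _)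
  have hmono : Real.arsinh s₀ ≤ Real.arsinh s₁ := Real.arsinh_le_arsinh.2 h
  have hsame : Real.exp (Real.arsinh s₁ - Real.arsinh s₀) ≤ 2 * (1 + r) →
      bracket s₁ / bracket s₀ * (1 + (Real.arsinh s₁ - Real.arsinh s₀)) ^ 2 ≤
        16 * ((1 + r) * L ^ 2) := fun h3 => by
    have h4 : 1 + (Real.arsinh s₁ - Real.arsinh s₀) ≤ 2 * L := by linarith [hlog2 h3]
    have h5 := pow_le_pow_left₀ (by linarith) h4 2
    calc _ ≤ (1 + r) * (2 * L) ^ 2 := mul_le_mul hρ h5 (by positivity) hr1.le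
      _ ≤ _ := by nlinarith [show 0 ≤ (1 + r) * L ^ 2 by positivity]
  rcases le_total 0 s₀ with h0 | h0
  · refine ⟨Real.arsinh s₀, fun s hs => ?_, ?_⟩
    · have h2 := Real.arsinh_nonneg_iff.2 h0
      have h3 := Real.arsinh_le_arsinh.2 hs.1
      rw [abs_of_nonneg (by linarith), abs_of_nonneg (by linarith)]
      linarith
    · rw [sub_self, abs_zero, abs_of_nonneg (by linarith)]
      simpa using hsame (exp_arsinh_sub_le_of_nonneg h h0)
  rcases le_total s₁ 0 with h1 | h1
  · refine ⟨Real.arsinh s₁, fun s hs => ?_, ?_⟩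
    · have h2 := Real.arsinh_nonpos_iff.2 h1
      have h3 := Real.arsinh_le_arsinh.2 hs.2
      rw [abs_of_nonpos (by linarith), abs_of_nonpos (by linarith)]
      linarith
    · rw [sub_self, abs_zero, abs_sub_comm, abs_of_nonneg (by linarith)]
      simpa using hsame (exp_arsinh_sub_le_of_nonpos h h1)
  -- Across `0`, the squared logarithm at `s₀` is at most a multiple of `⟨s₀⟩` and is cancelled by
  -- the quotient of brackets.
  · refine ⟨0, fun s _ => by rw [sub_zero], ?_⟩
    have hJ1 : bracket s₁ ≤ 1 + r := by
      have := bracket_le_one_add_abs s₁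
      rw [abs_of_nonneg h1] at this
      linarith
    have hJ10 := bracket_pos s₁
    have hJ00 := bracket_pos s₀
    rw [sub_zero, sub_zero]
    have h2 := hlog2 ((exp_abs_arsinh_le s₁).trans (by linarith))
    have h3 : (1 + |Real.arsinh s₁|) ^ 2 ≤ (2 * L) ^ 2 :=
      pow_le_pow_left₀ (by positivity) (by linarith) 2
    have h4 : (1 + |Real.arsinh s₀|) ^ 2 ≤ 4 * bracket s₀ := by
      have := one_add_arsinh_sq_le s₀
      rw [← sq_abs] at this
      nlinarith [sq_nonneg (|Real.arsinh s₀| - 1)]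
    calc _ ≤ bracket s₁ / bracket s₀ * ((2 * L) ^ 2 * (4 * bracket s₀)) := by gcongr
      _ = 16 * (bracket s₁ * L ^ 2) := by field_simp; ring
      _ ≤ _ := by gcongr

/-- Two weights are kept: `X` is used to bound `u(s₁)`, and `Y`, for which the quotient of brackets
is inverted, to bound `⟨s₀⟩ u'(s₁)`. The bound on `Y` is the bound on `X` for the reflected
interval. They differ only at `a = 1/4`, where each needs its own base point. -/
theorem exists_sq_scaleSize_le {a : ℝ} (ha : 0 < a) : ∃ K : ℝ, 0 < K ∧ ∀ s₀ s₁ : ℝ, s₀ ≤ s₁ →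
    ∃ X Y : ℝ, bracket s₁ / bracket s₀ * X ≤ K * intervalGrowth a (s₁ - s₀) ^ 2 ∧
      bracket s₀ / bracket s₁ * Y ≤ K * intervalGrowth a (s₁ - s₀) ^ 2 ∧
      ∀ u u' : ℝ → ℝ, IsTaylorGoldstein a u u' →
        scaleSize u u' s₁ ^ 2 ≤ bracket s₁ / bracket s₀ * X * scaleSize u u' s₀ ^ 2 ∧
        scaleSize u u' s₁ ^ 2 ≤ bracket s₁ / bracket s₀ * Y * scaleSize u u' s₀ ^ 2 := by
  by_cases h4 : a = 1 / 4
  · subst h4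
    obtain ⟨K, hK, h⟩ := sq_scaleSize_le_of_eq
    refine ⟨16 * K, by positivity, fun s₀ s₁ hs => ?_⟩
    obtain ⟨c, hc, hcb⟩ := exists_clamp hs
    obtain ⟨d, hd, hdb⟩ := exists_clamp (neg_le_neg hs)
    rw [bracket_neg, bracket_neg, Real.arsinh_neg, Real.arsinh_neg, neg_sub_neg] at hdb
    refine ⟨K * ((1 + |Real.arsinh s₁ - c|) ^ 2 * (1 + |Real.arsinh s₀ - c|) ^ 2),
      K * ((1 + |Real.arsinh s₁ - -d|) ^ 2 * (1 + |Real.arsinh s₀ - -d|) ^ 2), ?_, ?_,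
      fun u u' hu => ⟨?_, ?_⟩⟩
    · rw [intervalGrowth, if_pos rfl, mul_left_comm, mul_comm 16 K, mul_assoc]
      exact mul_le_mul_of_nonneg_left hcb hK.le
    · rw [intervalGrowth, if_pos rfl, mul_left_comm, mul_comm 16 K, mul_assoc]
      refine mul_le_mul_of_nonneg_left (le_trans (le_of_eq ?_) hdb) hK.le
      rw [← abs_neg (Real.arsinh s₁ - -d), ← abs_neg (Real.arsinh s₀ - -d),
        mul_comm ((1 + |-(Real.arsinh s₁ - -d)|) ^ 2)]
      congr 5 <;> ring_nf
    · refine (h u u' hu s₀ s₁ c hs hc).trans (le_of_eq ?_)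
      ring
    · refine (h u u' hu s₀ s₁ (-d) hs fun s hs' => ?_).trans (le_of_eq ?_)
      · have := hd (-s) ⟨neg_le_neg hs'.2, neg_le_neg hs'.1⟩
        rw [Real.arsinh_neg, abs_neg, ← abs_neg] at this
        convert this using 2
        ring
      · ring
  · obtain ⟨K, hK, h⟩ := sq_scaleSize_le_of_ne h4
    refine ⟨4 * K, by positivity, fun s₀ s₁ hs => ?_⟩
    set δ := √(1 - 4 * a) / 2 with hδ
    have hδ0 : 0 ≤ δ := by positivity
    have hδ1 : δ ≤ 1 / 2 := by
      have : √(1 - 4 * a) ≤ 1 := Real.sqrt_le_one.2 (by linarith)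
      linarith
    have h1 := bracket_div_mul_exp_le hδ0 hδ1 hs
    have h2 := bracket_div_mul_exp_le hδ0 hδ1 (neg_le_neg hs)
    rw [bracket_neg, bracket_neg, Real.arsinh_neg, Real.arsinh_neg, neg_sub_neg, neg_sub_neg] at h2
    set X := Real.exp (2 * δ * (Real.arsinh s₁ - Real.arsinh s₀))
    have h3 : ∀ u u' : ℝ → ℝ, IsTaylorGoldstein a u u' → scaleSize u u' s₁ ^ 2 ≤
        bracket s₁ / bracket s₀ * (K * X) * scaleSize u u' s₀ ^ 2 := fun u u' hu =>
      (h u u' hu s₀ s₁ hs).trans (le_of_eq (by ring))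
    rw [intervalGrowth, if_neg h4]
    refine ⟨K * X, K * X, ?_, ?_, fun u u' hu => ⟨h3 u u' hu, h3 u u' hu⟩⟩
    · rw [mul_left_comm, mul_comm 4 K, mul_assoc]
      exact mul_le_mul_of_nonneg_left h1 hK.le
    · rw [mul_left_comm, mul_comm 4 K, mul_assoc]
      exact mul_le_mul_of_nonneg_left h2 hK.le

/-- The derivative at `s₁` carries the weight `⟨s₀⟩` because the norms in moving coordinates use the
fixed frequency `(k, ξ)`, which corresponds to `s₀`. -/
theorem exists_growth_bound {a : ℝ} (ha : 0 < a) : ∃ K : ℝ, 0 < K ∧ ∀ u u' : ℝ → ℝ,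
    IsTaylorGoldstein a u u' → ∀ s₀ s₁ : ℝ, s₀ ≤ s₁ →
      |u s₁| + bracket s₀ * |u' s₁| ≤ K * intervalGrowth a (s₁ - s₀) * scaleSize u u' s₀ := by
  obtain ⟨K, hK, h⟩ := exists_sq_scaleSize_le ha
  refine ⟨2 * √K, by positivity, fun u u' hu s₀ s₁ hs => ?_⟩
  obtain ⟨X, Y, hX, hY, hXY⟩ := h s₀ s₁ hs
  obtain ⟨h1, h2⟩ := hXY u u' hu
  have hg := intervalGrowth_nonneg a (sub_nonneg.2 hs)
  set g := intervalGrowth a (s₁ - s₀)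
  have hS := scaleSize_nonneg u u' s₀
  have hJ0 := bracket_pos s₀
  have hJ1 := bracket_pos s₁
  have hR : 0 ≤ √K * g * scaleSize u u' s₀ := by positivity
  have hR2 : (√K * g * scaleSize u u' s₀) ^ 2 = K * g ^ 2 * scaleSize u u' s₀ ^ 2 := by
    rw [mul_pow, mul_pow, Real.sq_sqrt hK.le]
  have h3 : |u s₁| ≤ √K * g * scaleSize u u' s₀ := by
    refine le_trans ?_ (abs_le_of_sq_le_sq' (a := scaleSize u u' s₁) ?_ hR).2
    · rw [scaleSize]
      linarith [show 0 ≤ bracket s₁ * |u' s₁| by positivity]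
    · rw [hR2]
      exact h1.trans (mul_le_mul_of_nonneg_right hX (sq_nonneg _))
  have h4 : bracket s₀ * |u' s₁| ≤ √K * g * scaleSize u u' s₀ := by
    refine le_trans ?_ (abs_le_of_sq_le_sq' (a := bracket s₀ / bracket s₁ * scaleSize u u' s₁)
      ?_ hR).2
    · rw [scaleSize, mul_add, ← mul_assoc, div_mul_cancel₀ _ hJ1.ne']
      linarith [show 0 ≤ bracket s₀ / bracket s₁ * |u s₁| by positivity]
    · rw [hR2, mul_pow]
      calc (bracket s₀ / bracket s₁) ^ 2 * scaleSize u u' s₁ ^ 2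
          ≤ (bracket s₀ / bracket s₁) ^ 2 *
            (bracket s₁ / bracket s₀ * Y * scaleSize u u' s₀ ^ 2) :=
            mul_le_mul_of_nonneg_left h2 (by positivity)
        _ = bracket s₀ / bracket s₁ * Y * scaleSize u u' s₀ ^ 2 := by field_simp
        _ ≤ _ := mul_le_mul_of_nonneg_right hY (sq_nonneg _)
  linarith

/-! ### Upper bound for a single frequency -/

/-- A frequency `η = ξ / k` of the vorticity in the coordinates moving with the shear. -/
structure IsMode (α β η : ℝ) (w w' : ℝ → ℝ) : Prop where
  hasDerivAt : ∀ t, HasDerivAt w (w' t) t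
  hasDerivAt' : ∀ t, HasDerivAt w' (-(α / (1 + (η - β * t) ^ 2)) * w t) t

/-- The substitution is `s = s₀ + |β| t`, for which `s² = (η - βt)²`. Using `|β|` keeps the
direction of time for both signs of `β`. -/
theorem IsMode.isTaylorGoldstein {α β η : ℝ} (hβ : β ≠ 0) {w w' : ℝ → ℝ} (h : IsMode α β η w w')
    {s₀ : ℝ} (hs₀ : |β| * s₀ = -(β * η)) :
    IsTaylorGoldstein (α / β ^ 2) (fun s => w ((s - s₀) / |β|))
      (fun s => w' ((s - s₀) / |β|) / |β|) := by
  have hb : 0 < |β| := abs_pos.2 hβ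
  have hl : ∀ s, HasDerivAt (fun s => (s - s₀) / |β|) (1 / |β|) s := fun s =>
    ((hasDerivAt_id s).sub_const s₀).div_const |β|
  refine ⟨fun s => ?_, fun s => ?_⟩
  · refine ((h.hasDerivAt _).comp s (hl s)).congr_deriv ?_
    ring
  · refine (((h.hasDerivAt' _).comp s (hl s)).div_const |β|).congr_deriv ?_
    have e1 : (η - β * ((s - s₀) / |β|)) ^ 2 = s ^ 2 := by
      have h2 : |β| * (η - β * ((s - s₀) / |β|)) = |β| * η - β * s + β * s₀ := by
        field_simp
        ring
      have h3 : β * s₀ = -(|β| * η) := by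
        have h4 : |β| * (β * s₀) = |β| * -(|β| * η) := by
          calc |β| * (β * s₀) = β * (|β| * s₀) := by ring
            _ = -(β ^ 2 * η) := by rw [hs₀]; ring
            _ = |β| * -(|β| * η) := by rw [← sq_abs]; ring
        exact mul_left_cancel₀ hb.ne' h4
      have h5 : |β| * (η - β * ((s - s₀) / |β|)) = -(β * s) := by rw [h2, h3]; ring
      have h6 : |β| ^ 2 * (η - β * ((s - s₀) / |β|)) ^ 2 = |β| ^ 2 * s ^ 2 := by
        rw [← mul_pow, h5, sq_abs]
        ring
      exact mul_left_cancel₀ (by positivity) h6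
    rw [e1, ← sq_abs β]
    have : 0 < 1 + s ^ 2 := by positivity
    field_simp

theorem intervalGrowth_eq_growthRate (α : ℝ) {β : ℝ} (hβ : β ≠ 0) (t : ℝ) :
    intervalGrowth (α / β ^ 2) t = growthRate α β t := by
  have h0 : 0 < β ^ 2 := by positivity
  have hiff : α / β ^ 2 = 1 / 4 ↔ 4 * α = β ^ 2 := by
    rw [div_eq_div_iff h0.ne' (by norm_num)]
    constructor <;> intro h <;> linarith
  have e1 : growthExponent α β = 1 / 2 + √(1 - 4 * (α / β ^ 2)) / 2 := by
    rw [growthExponent, mul_div_assoc]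
    ring
  rw [intervalGrowth, growthRate, e1]
  by_cases h4 : 4 * α = β ^ 2
  · rw [if_pos (hiff.2 h4), if_pos h4, hiff.2 h4]
    norm_num
  · rw [if_neg (hiff.not.2 h4), if_neg h4]

theorem intervalGrowth_mul_le (a : ℝ) {b : ℝ} (hb : 0 < b) : ∃ K : ℝ, 0 < K ∧
    ∀ t, 0 ≤ t → intervalGrowth a (b * t) ≤ K * intervalGrowth a t := by
  have h1 : ∀ t : ℝ, 0 ≤ t → 1 + b * t ≤ (1 + b) * (1 + t) := fun t ht => by nlinarith
  have hpow : ∀ x : ℝ, 0 ≤ x → ∀ t : ℝ, 0 ≤ t → (1 + b * t) ^ x ≤ (1 + b) ^ x * (1 + t) ^ x :=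
    fun x hx t ht => by
      rw [← Real.mul_rpow (by positivity) (by positivity)]
      exact Real.rpow_le_rpow (by positivity) (h1 t ht) hx
  by_cases h4 : a = 1 / 4
  · have hl : 0 ≤ Real.log (1 + b) := Real.log_nonneg (by linarith)
    refine ⟨(1 + b) ^ (1 / 2 : ℝ) * (1 + Real.log (1 + b)), by positivity, fun t ht => ?_⟩
    have hlt : 0 ≤ Real.log (1 + t) := Real.log_nonneg (by linarith)
    rw [intervalGrowth, if_pos h4, intervalGrowth, if_pos h4]
    have h2 : Real.log (1 + b * t) ≤ Real.log (1 + b) + Real.log (1 + t) := by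
      rw [← Real.log_mul (by positivity) (by positivity)]
      exact Real.log_le_log (by positivity) (h1 t ht)
    have h5 : 1 + Real.log (1 + b * t) ≤ (1 + Real.log (1 + b)) * (1 + Real.log (1 + t)) := by
      nlinarith
    have h6 : 0 ≤ Real.log (1 + b * t) := Real.log_nonneg (by nlinarith)
    refine (mul_le_mul (hpow _ (by norm_num) t ht) h5 (by positivity) (by positivity)).trans
      (le_of_eq ?_)
    ring
  · refine ⟨(1 + b) ^ (1 / 2 + √(1 - 4 * a) / 2), by positivity, fun t ht => ?_⟩
    rw [intervalGrowth, if_neg h4, intervalGrowth, if_neg h4]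
    exact hpow _ (by positivity) t ht

theorem exists_shift {β : ℝ} (hβ : β ≠ 0) (η : ℝ) :
    ∃ s₀ : ℝ, |β| * s₀ = -(β * η) ∧ bracket s₀ = bracket η := by
  have hb : 0 < |β| := abs_pos.2 hβ
  refine ⟨-(β * η) / |β|, mul_div_cancel₀ _ hb.ne', ?_⟩
  rw [bracket, bracket, div_pow, sq_abs, neg_sq, mul_pow, mul_div_cancel_left₀ _ (by positivity)]

theorem exists_mode_bound {α β : ℝ} (hα : 0 < α) (hβ : β ≠ 0) : ∃ K : ℝ, 0 < K ∧
    ∀ (η : ℝ) (w w' : ℝ → ℝ), IsMode α β η w w' → ∀ t, 0 ≤ t →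
      |w t| + bracket η * |w' t| ≤ K * growthRate α β t * (|w 0| + bracket η * |w' 0|) := by
  have hb : 0 < |β| := abs_pos.2 hβ
  obtain ⟨K, hK, h⟩ := exists_growth_bound (a := α / β ^ 2) (by positivity)
  obtain ⟨M, hM, hg⟩ := intervalGrowth_mul_le (α / β ^ 2) hb
  refine ⟨K * M * ((1 + |β|) * (1 + |β|⁻¹)), by positivity, fun η w w' hw t ht => ?_⟩
  obtain ⟨s₀, hs₀, hJ⟩ := exists_shift hβ η
  have h1 := h _ _ (hw.isTaylorGoldstein hβ hs₀) s₀ (s₀ + |β| * t) (by nlinarith)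
  rw [scaleSize, add_sub_cancel_left, mul_div_cancel_left₀ _ hb.ne', sub_self, zero_div, hJ, abs_div,
    abs_div, abs_abs] at h1
  have h2 := hg t ht
  rw [intervalGrowth_eq_growthRate α hβ t] at h2
  have hJ0 := bracket_pos η
  have hA : 0 ≤ |w 0| + bracket η * (|w' 0| / |β|) := by positivity
  have h3 : |w t| + bracket η * |w' t| ≤ (1 + |β|) * (|w t| + bracket η * (|w' t| / |β|)) := by
    have e1 : (1 + |β|) * (|w t| + bracket η * (|w' t| / |β|)) = |w t| + bracket η * |w' t| +
        (|β| * |w t| + bracket η * (|w' t| / |β|)) := by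
      field_simp
      ring
    rw [e1]
    linarith [show 0 ≤ |β| * |w t| + bracket η * (|w' t| / |β|) by positivity]
  have h4 : |w 0| + bracket η * (|w' 0| / |β|) ≤ (1 + |β|⁻¹) * (|w 0| + bracket η * |w' 0|) := by
    have e1 : (1 + |β|⁻¹) * (|w 0| + bracket η * |w' 0|) = |w 0| + bracket η * (|w' 0| / |β|) +
        (|β|⁻¹ * |w 0| + bracket η * |w' 0|) := by
      field_simp
      ring
    rw [e1]
    linarith [show 0 ≤ |β|⁻¹ * |w 0| + bracket η * |w' 0| by positivity]
  have hgr : 0 ≤ M * growthRate α β t :=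
    (intervalGrowth_nonneg (α / β ^ 2) (by positivity : 0 ≤ |β| * t)).trans h2
  calc _ ≤ (1 + |β|) * (K * intervalGrowth (α / β ^ 2) (|β| * t) *
          (|w 0| + bracket η * (|w' 0| / |β|))) := h3.trans (mul_le_mul_of_nonneg_left h1 (by positivity))
    _ ≤ (1 + |β|) * (K * (M * growthRate α β t) *
          ((1 + |β|⁻¹) * (|w 0| + bracket η * |w' 0|))) := by gcongr
    _ = _ := by ring

/-! ### Lower bounds for the growth -/

/-- Grönwall's inequality from below. -/
theorem exp_mul_le_of_le_deriv {F F' Φ φ : ℝ → ℝ} {a b : ℝ} (hab : a ≤ b)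
    (hF : ∀ s ∈ Icc a b, HasDerivAt F (F' s) s) (hΦ : ∀ s ∈ Icc a b, HasDerivAt Φ (φ s) s)
    (h : ∀ s ∈ Icc a b, φ s * F s ≤ F' s) : Real.exp (Φ b - Φ a) * F a ≤ F b := by
  have := le_mul_exp_of_deriv_le hab (fun s hs => (hF s hs).neg) hΦ (fun s hs => by
    rw [Pi.neg_apply, mul_neg]
    exact neg_le_neg (h s hs))
  simp only [Pi.neg_apply, mul_neg] at this
  exact neg_le_neg_iff.1 this

section
variable {a γ : ℝ} {u u' : ℝ → ℝ}

theorem hasDerivAt_mul_log {s : ℝ} (hs : 0 < s) (γ : ℝ) :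
    HasDerivAt (fun s => γ * Real.log s) (γ / s) s := by
  have := (Real.hasDerivAt_log hs.ne').const_mul γ
  rwa [← div_eq_mul_inv] at this

/-- Where `u ≥ 0`, the equation gives `u'' ≥ -a u / s²`. Since `s^γ` solves the Euler equation, `D =
s u' - γ u` satisfies `D' ≥ (1 - γ) D / s`. -/
theorem IsTaylorGoldstein.le_euler (h : IsTaylorGoldstein a u u') (ha : 0 ≤ a) (hγ : γ * (1 - γ) = a)
    {s₀ s₁ : ℝ} (h0 : 0 < s₀) (hs : s₀ ≤ s₁) (hu : ∀ s ∈ Icc s₀ s₁, 0 ≤ u s) :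
    Real.exp ((1 - γ) * Real.log s₁ - (1 - γ) * Real.log s₀) * (s₀ * u' s₀ - γ * u s₀) ≤
      s₁ * u' s₁ - γ * u s₁ := by
  refine exp_mul_le_of_le_deriv (F := fun s => s * u' s - γ * u s) hs
    (fun s _ => ((hasDerivAt_id s).mul (h.hasDerivAt' s)).sub ((h.hasDerivAt s).const_mul γ))
    (fun s hs => hasDerivAt_mul_log (h0.trans_le hs.1) (1 - γ)) fun s hs' => ?_
  have hs0 : 0 < s := h0.trans_le hs'.1
  have hus := hu s hs'
  have e1 : 1 * u' s + id s * (-(a / (1 + s ^ 2)) * u s) - γ * u' s -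
      (1 - γ) / s * (s * u' s - γ * u s) = a / (s * (1 + s ^ 2)) * u s := by
    rw [← hγ]
    simp only [id]
    field_simp
    ring
  have e2 : 0 ≤ a / (s * (1 + s ^ 2)) * u s := by positivity
  linarith

theorem IsTaylorGoldstein.le_of_euler_nonneg (h : IsTaylorGoldstein a u u') {s₀ s₁ : ℝ}
    (h0 : 0 < s₀) (hs : s₀ ≤ s₁) (hD : ∀ s ∈ Icc s₀ s₁, 0 ≤ s * u' s - γ * u s) :
    Real.exp (γ * Real.log s₁ - γ * Real.log s₀) * u s₀ ≤ u s₁ := by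
  refine exp_mul_le_of_le_deriv hs (fun s _ => h.hasDerivAt s)
    (fun s hs => hasDerivAt_mul_log (h0.trans_le hs.1) γ) fun s hs' => ?_
  have hs0 : 0 < s := h0.trans_le hs'.1
  rw [div_mul_eq_mul_div, div_le_iff₀ hs0]
  linarith [hD s hs']

/-- Up to a first point `m` with `u ≤ 0` the Euler comparison applies and makes `u m` at least a
positive multiple of `u s₀`, a contradiction. -/
theorem IsTaylorGoldstein.pos (h : IsTaylorGoldstein a u u') (ha : 0 ≤ a) (hγ : γ * (1 - γ) = a)
    {s₀ : ℝ} (h0 : 0 < s₀) (hu0 : 0 < u s₀) (hD0 : 0 ≤ s₀ * u' s₀ - γ * u s₀) {s₁ : ℝ}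
    (hs : s₀ ≤ s₁) : 0 < u s₁ := by
  by_contra! hneg
  have hcu : Continuous u := continuous_iff_continuousAt.2 fun s => (h.hasDerivAt s).continuousAt
  obtain ⟨m, hm, hleast⟩ := (isCompact_Icc.inter_right (isClosed_Iic.preimage hcu) :
    IsCompact (Icc s₀ s₁ ∩ u ⁻¹' Iic 0)).exists_isLeast ⟨s₁, ⟨hs, le_rfl⟩, hneg⟩
  have hpos : ∀ s, s₀ ≤ s → s < m → 0 < u s := fun s h1 h2 => by
    by_contra! h3
    exact absurd (hleast ⟨⟨h1, h2.le.trans hm.1.2⟩, h3⟩) (not_le.2 h2)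
  have hnn : ∀ s ∈ Icc s₀ m, 0 ≤ u s := by
    have h1 : Icc s₀ m ⊆ closure (Ico s₀ m) := by
      have hne : s₀ ≠ m := fun h2 => by
        have := hm.2
        rw [← h2] at this
        exact absurd this (not_le.2 hu0)
      rw [closure_Ico hne]
    intro s hs'
    exact closure_minimal (s := Ico s₀ m) (t := u ⁻¹' Ici 0) (fun r hr => (hpos r hr.1 hr.2).le)
      (isClosed_Ici.preimage hcu) (h1 hs')
  have h1 := h.le_of_euler_nonneg (γ := γ) h0 hm.1.1 fun s hs' =>
    le_trans (mul_nonneg (Real.exp_pos _).le hD0)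
      (h.le_euler ha hγ h0 hs'.1 fun r hr => hnn r ⟨hr.1, hr.2.trans hs'.2⟩)
  have h2 : u m ≤ 0 := hm.2
  exact absurd (h1.trans h2) (not_le.2 (mul_pos (Real.exp_pos _) hu0))

theorem IsTaylorGoldstein.growth (h : IsTaylorGoldstein a u u') (ha : 0 ≤ a)
    (hγ : γ * (1 - γ) = a) {s₀ : ℝ} (h0 : 0 < s₀) (hu0 : 0 < u s₀)
    (hD0 : 0 ≤ s₀ * u' s₀ - γ * u s₀) {s₁ : ℝ} (hs : s₀ ≤ s₁) :
    Real.exp (γ * Real.log s₁ - γ * Real.log s₀) * u s₀ ≤ u s₁ :=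
  h.le_of_euler_nonneg h0 hs fun _ hs' => le_trans (mul_nonneg (Real.exp_pos _).le hD0)
    (h.le_euler ha hγ h0 hs'.1 fun _ hr => (h.pos ha hγ h0 hu0 hD0 hr.1).le)

/-- At the double exponent `1/2` the quantity `s u' - u / 2` itself grows like `s^{1/2}`. As a
source in `u' = u / (2s) + …` it is resonant and produces the logarithm. -/
theorem IsTaylorGoldstein.log_growth (h : IsTaylorGoldstein (1 / 4) u u') {s₀ : ℝ} (h0 : 0 < s₀)
    (hu0 : 0 < u s₀) {d : ℝ} (hd : 0 ≤ d) (hD0 : d * u s₀ ≤ s₀ * u' s₀ - 1 / 2 * u s₀) {s₁ : ℝ}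
    (hs : s₀ ≤ s₁) :
    Real.exp (1 / 2 * Real.log s₁ - 1 / 2 * Real.log s₀) *
      (1 + d * (Real.log s₁ - Real.log s₀)) * u s₀ ≤ u s₁ := by
  have hγ : (1 / 2 : ℝ) * (1 - 1 / 2) = 1 / 4 := by norm_num
  have hD0' : 0 ≤ s₀ * u' s₀ - 1 / 2 * u s₀ := (by positivity : 0 ≤ d * u s₀).trans hD0
  have hD : ∀ s ∈ Icc s₀ s₁, Real.exp (1 / 2 * Real.log s - 1 / 2 * Real.log s₀) * (d * u s₀) ≤
      s * u' s - 1 / 2 * u s := fun s hs' => by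
    have := h.le_euler (by norm_num) hγ h0 hs'.1
      fun r hr => (h.pos (by norm_num) hγ h0 hu0 hD0' hr.1).le
    norm_num at this ⊢
    refine le_trans (mul_le_mul_of_nonneg_left ?_ (Real.exp_pos _).le) this
    norm_num at hD0
    exact hD0
  -- The solution of the first-order equation with the lower bound of `s u' - u / 2` as source; `u -
  -- y` is then compared with zero.
  set y : ℝ → ℝ := fun s => Real.exp (1 / 2 * Real.log s - 1 / 2 * Real.log s₀) *
      (1 + d * (Real.log s - Real.log s₀)) * u s₀ with hy
  have hyd : ∀ s ∈ Icc s₀ s₁, HasDerivAt y (1 / 2 / s * y s +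
      Real.exp (1 / 2 * Real.log s - 1 / 2 * Real.log s₀) * (d * u s₀) / s) s := fun s hs' => by
    have hs0 : 0 < s := h0.trans_le hs'.1
    have h1 := ((((hasDerivAt_mul_log hs0 (1 / 2)).sub_const (1 / 2 * Real.log s₀)).exp.mul
      ((((Real.hasDerivAt_log hs0.ne').sub_const (Real.log s₀)).const_mul d).const_add 1)).mul_const
        (u s₀))
    refine h1.congr_deriv ?_
    simp only [hy]
    field_simp
  have h1 := exp_mul_le_of_le_deriv (F := fun s => u s - y s) hs
    (fun s hs' => (h.hasDerivAt s).sub (hyd s hs'))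
    (fun s hs => hasDerivAt_mul_log (h0.trans_le hs.1) (1 / 2)) fun s hs' => by
      have hs0 : 0 < s := h0.trans_le hs'.1
      have h2 := div_le_div_of_nonneg_right (hD s hs') hs0.le
      have h3 : (s * u' s - 1 / 2 * u s) / s = u' s - 1 / 2 / s * u s := by
        field_simp
      rw [h3] at h2
      linarith
  have h2 : y s₀ = u s₀ := by simp [hy]
  rw [h2, sub_self, mul_zero] at h1
  linarith

end

theorem IsTaylorGoldstein.wronskian {a : ℝ} {u u' v v' : ℝ → ℝ} (hu : IsTaylorGoldstein a u u')
    (hv : IsTaylorGoldstein a v v') (s₀ s₁ : ℝ) :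
    u s₁ * v' s₁ - u' s₁ * v s₁ = u s₀ * v' s₀ - u' s₀ * v s₀ := by
  have h1 : ∀ s, HasDerivAt (fun s => u s * v' s - u' s * v s) 0 s := fun s => by
    refine (((hu.hasDerivAt s).mul (hv.hasDerivAt' s)).sub
      ((hu.hasDerivAt' s).mul (hv.hasDerivAt s))).congr_deriv ?_
    ring
  exact is_const_of_deriv_eq_zero (fun s => (h1 s).differentiableAt) (fun s => (h1 s).deriv) s₁ s₀

theorem le_div_of_mem_Icc {s₀ r : ℝ} (h0 : s₀ ∈ Icc (1 : ℝ) 2) (hr : 0 ≤ r) :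
    1 + 1 / 2 * r ≤ (s₀ + r) / s₀ := by
  have hs0 : 0 < s₀ := one_pos.trans_le h0.1
  rw [le_div_iff₀ hs0]
  nlinarith [h0.2]

theorem exp_log_sub_log {x y : ℝ} (hx : 0 < x) (hy : 0 < y) (γ : ℝ) :
    Real.exp (γ * Real.log x - γ * Real.log y) = (x / y) ^ γ := by
  rw [Real.rpow_def_of_pos (div_pos hx hy), Real.log_div hx.ne' hy.ne']
  congr 1
  ring

theorem half_mul_rpow_le {s₀ r γ : ℝ} (h0 : s₀ ∈ Icc (1 : ℝ) 2) (hr : 0 ≤ r) (hγ : 0 ≤ γ)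
    (hγ1 : γ ≤ 1) : 1 / 2 * (1 + r) ^ γ ≤ ((s₀ + r) / s₀) ^ γ := by
  have h1 : (1 / 2 : ℝ) ≤ (1 / 2 : ℝ) ^ γ := by
    conv_lhs => rw [← Real.rpow_one (1 / 2)]
    exact Real.rpow_le_rpow_of_exponent_ge (by norm_num) (by norm_num) hγ1
  calc 1 / 2 * (1 + r) ^ γ ≤ (1 / 2 : ℝ) ^ γ * (1 + r) ^ γ := by gcongr
    _ = (1 / 2 * (1 + r)) ^ γ := (Real.mul_rpow (by norm_num) (by linarith)).symm
    _ ≤ _ := Real.rpow_le_rpow (by positivity)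
      (le_trans (by linarith) (le_div_of_mem_Icc h0 hr)) hγ

theorem half_mul_log_le {s₀ r : ℝ} (h0 : s₀ ∈ Icc (1 : ℝ) 2) (hr : 0 ≤ r) :
    1 / 2 * Real.log (1 + r) ≤ Real.log (s₀ + r) - Real.log s₀ := by
  have hs0 : 0 < s₀ := one_pos.trans_le h0.1
  rw [← Real.log_div (by positivity) hs0.ne', ← Real.log_rpow (by positivity)]
  refine Real.log_le_log (by positivity) (le_trans ?_ (le_div_of_mem_Icc h0 hr))
  exact rpow_one_add_le_one_add_mul_self (by linarith) (by norm_num) (by norm_num)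

/-- For `a ≤ 1/4` the solution `u` alone grows: `s₀ ≥ 1` makes `s₀ u' - γ u` nonnegative initially.
For `a > 1/4` a real solution may vanish, and the pair is needed. Its Wronskian is constant while
the derivatives decay like `s^{-1/2}`, so `u` and `v` cannot both be small. -/
theorem exists_lower_bound {a b : ℝ} (ha : 0 < a) (hb : 0 < b) : ∃ K : ℝ, 0 < K ∧
    ∀ u u' v v' : ℝ → ℝ, IsTaylorGoldstein a u u' → IsTaylorGoldstein a v v' →
      ∀ s₀ ∈ Icc (1 : ℝ) 2, u s₀ = 1 → u' s₀ = 1 → v s₀ = 0 → v' s₀ = b → ∀ r, 0 ≤ r →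
        (K * intervalGrowth a r) ^ 2 ≤ u (s₀ + r) ^ 2 + v (s₀ + r) ^ 2 := by
  rcases lt_trichotomy a (1 / 4) with h4 | h4 | h4
  · set δ := √(1 - 4 * a) / 2 with hδ
    have hδ0 : 0 ≤ δ := by positivity
    have hδ1 : δ ≤ 1 / 2 := by
      have : √(1 - 4 * a) ≤ 1 := Real.sqrt_le_one.2 (by linarith)
      linarith
    have hδ2 : δ ^ 2 = 1 / 4 - a := by
      rw [hδ, div_pow, Real.sq_sqrt (by linarith)]
      ring
    refine ⟨1 / 2, by norm_num, fun u u' v v' hu _ s₀ h0 hu0 hu0' _ _ r hr => ?_⟩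
    have hs0 : 0 < s₀ := one_pos.trans_le h0.1
    have h1 := hu.growth (γ := 1 / 2 + δ) ha.le (by linear_combination -hδ2) hs0
      (by rw [hu0]; exact one_pos) (by rw [hu0, hu0']; linarith [h0.1])
      (by linarith : s₀ ≤ s₀ + r)
    rw [exp_log_sub_log (by positivity) hs0, hu0, mul_one] at h1
    have h2 := (half_mul_rpow_le h0 hr (by positivity : 0 ≤ 1 / 2 + δ) (by linarith)).trans h1
    rw [intervalGrowth, if_neg h4.ne]
    exact (pow_le_pow_left₀ (by positivity) h2 2).trans (le_add_of_nonneg_right (sq_nonneg _))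
  · subst h4
    refine ⟨1 / 8, by norm_num, fun u u' v v' hu _ s₀ h0 hu0 hu0' _ _ r hr => ?_⟩
    have hs0 : 0 < s₀ := one_pos.trans_le h0.1
    have h1 := hu.log_growth hs0 (by rw [hu0]; exact one_pos) (d := 1 / 2) (by norm_num)
      (by rw [hu0, hu0']; linarith [h0.1]) (by linarith : s₀ ≤ s₀ + r)
    rw [exp_log_sub_log (by positivity) hs0, hu0, mul_one] at h1
    have h2 := half_mul_rpow_le h0 hr (by norm_num : (0 : ℝ) ≤ 1 / 2) (by norm_num)
    have h3 := half_mul_log_le h0 hr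
    have h5 : 0 ≤ Real.log (1 + r) := Real.log_nonneg (by linarith)
    rw [intervalGrowth, if_pos rfl]
    have h6 : 1 / 8 * ((1 + r) ^ (1 / 2 : ℝ) * (1 + Real.log (1 + r))) ≤ u (s₀ + r) := by
      refine le_trans ?_ h1
      calc _ = (1 / 2 * (1 + r) ^ (1 / 2 : ℝ)) * (1 / 4 * (1 + Real.log (1 + r))) := by ring
        _ ≤ _ := mul_le_mul h2 (by linarith) (by positivity) (by positivity)
    exact (pow_le_pow_left₀ (by positivity) h6 2).trans (le_add_of_nonneg_right (sq_nonneg _))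
  · obtain ⟨M, hM, h⟩ := sq_scaleSize_le_of_ne h4.ne'
    have hsq : √(1 - 4 * a) = 0 := Real.sqrt_eq_zero_of_nonpos (by linarith)
    have hJ3 : ∀ s₀ ∈ Icc (1 : ℝ) 2, bracket s₀ ≤ 3 := fun s₀ h0 => by
      have := bracket_le_one_add_abs s₀
      rw [abs_of_nonneg (by linarith [h0.1])] at this
      linarith [h0.2]
    have hdec : ∀ u u' : ℝ → ℝ, IsTaylorGoldstein a u u' → ∀ s₀ ∈ Icc (1 : ℝ) 2, ∀ r, 0 ≤ r →
        u' (s₀ + r) ^ 2 * bracket (s₀ + r) ≤ M * scaleSize u u' s₀ ^ 2 := by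
      intro u u' hu s₀ h0 r hr
      have h1 := h u u' hu s₀ (s₀ + r) (by linarith)
      rw [hsq] at h1
      simp only [zero_div, mul_zero, zero_mul, Real.exp_zero, mul_one] at h1
      have hJ1 := bracket_pos (s₀ + r)
      have hJ0 := one_le_bracket s₀
      have h2 : (bracket (s₀ + r) * |u' (s₀ + r)|) ^ 2 ≤ scaleSize u u' (s₀ + r) ^ 2 := by
        refine pow_le_pow_left₀ (by positivity) ?_ 2
        rw [scaleSize]
        linarith [abs_nonneg (u (s₀ + r))]
      have h3 : bracket (s₀ + r) / bracket s₀ ≤ bracket (s₀ + r) := div_le_self hJ1.le hJ0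
      have h5 : bracket (s₀ + r) * (u' (s₀ + r) ^ 2 * bracket (s₀ + r)) ≤
          bracket (s₀ + r) * (M * scaleSize u u' s₀ ^ 2) := by
        calc _ = (bracket (s₀ + r) * |u' (s₀ + r)|) ^ 2 := by rw [mul_pow, sq_abs]; ring
          _ ≤ M * (bracket (s₀ + r) / bracket s₀) * scaleSize u u' s₀ ^ 2 := h2.trans h1
          _ ≤ M * bracket (s₀ + r) * scaleSize u u' s₀ ^ 2 := by gcongr
          _ = _ := by ring
      exact le_of_mul_le_mul_left h5 hJ1
    set Q := M * 16 + M * (3 * b) ^ 2 with hQ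
    have hQ0 : 0 < Q := by positivity
    refine ⟨b / √Q, by positivity, fun u u' v v' hu hv s₀ h0 hu0 hu0' hv0 hv0' r hr => ?_⟩
    have hw := hu.wronskian hv s₀ (s₀ + r)
    rw [hu0, hv0', hv0, mul_zero, sub_zero, one_mul] at hw
    have h1 := hdec u u' hu s₀ h0 r hr
    have h2 := hdec v v' hv s₀ h0 r hr
    have hJ00 := bracket_pos s₀
    have hSu : scaleSize u u' s₀ ^ 2 ≤ 16 := by
      rw [scaleSize, hu0, hu0', abs_one, mul_one]
      nlinarith [hJ3 s₀ h0]
    have hSv : scaleSize v v' s₀ ^ 2 ≤ (3 * b) ^ 2 := by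
      rw [scaleSize, hv0, hv0', abs_zero, zero_add, abs_of_pos hb]
      exact pow_le_pow_left₀ (by positivity) (mul_le_mul_of_nonneg_right (hJ3 s₀ h0) hb.le) 2
    set U := u (s₀ + r)
    set V := v (s₀ + r)
    set U' := u' (s₀ + r)
    set V' := v' (s₀ + r)
    have hJr : 1 + r ≤ bracket (s₀ + r) := by
      have := (le_abs_self (s₀ + r)).trans (abs_le_bracket (s₀ + r))
      linarith [h0.1]
    have h3 : (U' ^ 2 + V' ^ 2) * (1 + r) ≤ Q := by
      calc (U' ^ 2 + V' ^ 2) * (1 + r) ≤ (U' ^ 2 + V' ^ 2) * bracket (s₀ + r) := by gcongr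
        _ ≤ M * scaleSize u u' s₀ ^ 2 + M * scaleSize v v' s₀ ^ 2 := by linarith
        _ ≤ Q := by rw [hQ]; gcongr
    -- Cauchy–Schwarz for the Wronskian `U V' - U' V = b`.
    have h5 : b ^ 2 ≤ (U ^ 2 + V ^ 2) * (U' ^ 2 + V' ^ 2) := by
      rw [← hw]
      nlinarith [sq_nonneg (U * U' + V * V')]
    have h6 : b ^ 2 * (1 + r) ≤ (U ^ 2 + V ^ 2) * Q := by
      calc b ^ 2 * (1 + r) ≤ (U ^ 2 + V ^ 2) * (U' ^ 2 + V' ^ 2) * (1 + r) := by gcongr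
        _ = (U ^ 2 + V ^ 2) * ((U' ^ 2 + V' ^ 2) * (1 + r)) := by ring
        _ ≤ _ := by gcongr
    rw [intervalGrowth, if_neg h4.ne', hsq, zero_div, add_zero, mul_pow, div_pow,
      Real.sq_sqrt hQ0.le, ← Real.sqrt_eq_rpow, Real.sq_sqrt (by linarith), div_mul_eq_mul_div,
      div_le_iff₀ hQ0]
    exact h6

theorem exists_mode_lower_bound {α β : ℝ} (hα : 0 < α) (hβ : β ≠ 0) : ∃ K : ℝ, 0 < K ∧
    ∀ (η : ℝ) (w w' v v' : ℝ → ℝ), -(β * η) ∈ Icc |β| (2 * |β|) → IsMode α β η w w' →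
      IsMode α β η v v' → w 0 = 1 → w' 0 = |β| → v 0 = 0 → v' 0 = 1 → ∀ t, 0 ≤ t →
        (K * growthRate α β t) ^ 2 ≤ w t ^ 2 + v t ^ 2 := by
  have hb : 0 < |β| := abs_pos.2 hβ
  obtain ⟨K, hK, h⟩ := exists_lower_bound (a := α / β ^ 2) (b := 1 / |β|) (by positivity)
    (by positivity)
  obtain ⟨M, hM, hg⟩ := intervalGrowth_mul_le (α / β ^ 2) (inv_pos.2 hb)
  refine ⟨K / M, by positivity, fun η w w' v v' hη hw hv hw0 hw0' hv0 hv0' t ht => ?_⟩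
  obtain ⟨s₀, hs₀, -⟩ := exists_shift hβ η
  have hs1 : s₀ ∈ Icc (1 : ℝ) 2 := by
    rw [← hs₀] at hη
    constructor
    · nlinarith [hη.1]
    · nlinarith [hη.2]
  have h1 := h _ _ _ _ (hw.isTaylorGoldstein hβ hs₀) (hv.isTaylorGoldstein hβ hs₀) s₀ hs1
    (by simpa using hw0) (by simp [hw0', hb.ne']) (by simpa using hv0) (by simp [hv0'])
    (|β| * t) (by positivity)
  simp only [add_sub_cancel_left, mul_div_cancel_left₀ _ hb.ne'] at h1
  have h2 := hg (|β| * t) (by positivity)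
  rw [inv_mul_cancel_left₀ hb.ne', intervalGrowth_eq_growthRate α hβ t] at h2
  have h3 : 0 ≤ growthRate α β t := by
    rw [← intervalGrowth_eq_growthRate α hβ]
    exact intervalGrowth_nonneg _ ht
  refine (pow_le_pow_left₀ (by positivity) ?_ 2).trans h1
  rw [div_mul_eq_mul_div, div_le_iff₀ hM, mul_assoc]
  refine mul_le_mul_of_nonneg_left (h2.trans (le_of_eq (mul_comm _ _))) hK.le

/-! ### From frequency estimates to weighted norms -/

/-- The norm of `L²(ℤ × ℝ)`. -/
def freqNorm (f : ℤ → ℝ → ℝ≥0∞) : ℝ≥0∞ := (∑' k, ∫⁻ ξ, f k ξ ^ (2 : ℝ)) ^ (1 / 2 : ℝ)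

theorem freqNorm_mono {f g : ℤ → ℝ → ℝ≥0∞} (h : ∀ k, ∀ᵐ ξ, f k ξ ≤ g k ξ) :
    freqNorm f ≤ freqNorm g := by
  refine ENNReal.rpow_le_rpow (ENNReal.tsum_le_tsum fun k => lintegral_mono_ae ?_) (by norm_num)
  filter_upwards [h k] with ξ h1
  exact ENNReal.rpow_le_rpow h1 two_pos.le

theorem freqNorm_const_mul {c : ℝ≥0∞} (hc : c ≠ ∞) (f : ℤ → ℝ → ℝ≥0∞) :
    freqNorm (fun k ξ => c * f k ξ) = c * freqNorm f := by
  simp only [freqNorm, ENNReal.mul_rpow_of_nonneg _ _ (two_pos.le : (0 : ℝ) ≤ 2)]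
  simp_rw [lintegral_const_mul' _ _ (ENNReal.rpow_ne_top_of_nonneg two_pos.le hc)]
  rw [ENNReal.tsum_mul_left, ENNReal.mul_rpow_of_nonneg _ _ (by norm_num), ← ENNReal.rpow_mul]
  norm_num

theorem sq_rpow_half (x : ℝ≥0∞) : (x ^ (1 / 2 : ℝ)) ^ (2 : ℝ) = x := by
  rw [← ENNReal.rpow_mul]
  norm_num

theorem freqNorm_add_le {f g : ℤ → ℝ → ℝ≥0∞} (hf : ∀ k, AEMeasurable (f k) volume)
    (hg : ∀ k, AEMeasurable (g k) volume) :
    freqNorm (fun k ξ => f k ξ + g k ξ) ≤ freqNorm f + freqNorm g := by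
  set A : ℤ → ℝ≥0∞ := fun k => (∫⁻ ξ, f k ξ ^ (2 : ℝ)) ^ (1 / 2 : ℝ) with hA
  set B : ℤ → ℝ≥0∞ := fun k => (∫⁻ ξ, g k ξ ^ (2 : ℝ)) ^ (1 / 2 : ℝ) with hB
  have h1 : ∀ k, ∫⁻ ξ, (f k ξ + g k ξ) ^ (2 : ℝ) ≤ (A + B) k ^ (2 : ℝ) := fun k => by
    have := ENNReal.rpow_le_rpow (ENNReal.lintegral_Lp_add_le (hf k) (hg k) one_le_two)
      (two_pos.le : (0 : ℝ) ≤ 2)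
    rw [sq_rpow_half] at this
    exact this
  have h2 := ENNReal.lintegral_Lp_add_le (μ := Measure.count) (f := A) (g := B)
    (measurable_of_countable _).aemeasurable (measurable_of_countable _).aemeasurable
    (one_le_two : (1 : ℝ) ≤ 2)
  simp only [lintegral_count] at h2
  have h3 : ∀ k, A k ^ (2 : ℝ) = ∫⁻ ξ, f k ξ ^ (2 : ℝ) := fun k => sq_rpow_half _
  have h4 : ∀ k, B k ^ (2 : ℝ) = ∫⁻ ξ, g k ξ ^ (2 : ℝ) := fun k => sq_rpow_half _
  simp only [h3, h4] at h2
  exact (ENNReal.rpow_le_rpow (ENNReal.tsum_le_tsum h1) (by norm_num)).trans h2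

theorem weightedNorm_eq_freqNorm {p l : ℤ → ℝ → ℝ} (hp : ∀ k ξ, 0 ≤ p k ξ) (hl : ∀ k ξ, 0 ≤ l k ξ)
    (f : Channel → ℝ) : weightedNorm (fun k ξ => p k ξ * l k ξ ^ 2) f =
      freqNorm fun k ξ => ENNReal.ofReal (√(p k ξ) * (l k ξ * ‖channelFourier f k ξ‖)) := by
  rw [weightedNorm, freqNorm]
  congr 2
  funext k
  congr 1
  funext ξ
  have h1 := hl k ξ
  rw [ENNReal.ofReal_rpow_of_nonneg (by positivity) two_pos.le]
  congr 1
  rw [Real.rpow_two, mul_pow, mul_pow, Real.sq_sqrt (hp k ξ)]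
  ring

/-- Minkowski's inequality on `L²(ℤ × ℝ)`. The common weight `p` will be `(1 + k² + ξ²)^N`, and the
factors `l` hold the one derivative by which the norms differ. -/
theorem weightedNorm_le {p l l₁ l₂ : ℤ → ℝ → ℝ} (hp : ∀ k ξ, 0 ≤ p k ξ) (hl : ∀ k ξ, 0 ≤ l k ξ)
    (hl₁ : ∀ k ξ, 0 ≤ l₁ k ξ) (hl₂ : ∀ k ξ, 0 ≤ l₂ k ξ) (hpm : ∀ k, Measurable (p k))
    (hm₁ : ∀ k, Measurable (l₁ k)) (hm₂ : ∀ k, Measurable (l₂ k)) {A B : ℝ} (hA : 0 ≤ A)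
    (hB : 0 ≤ B) {F f g : Channel → ℝ}
    (h : ∀ k, ∀ᵐ ξ, l k ξ * ‖channelFourier F k ξ‖ ≤
      A * (l₁ k ξ * ‖channelFourier f k ξ‖) + B * (l₂ k ξ * ‖channelFourier g k ξ‖)) :
    weightedNorm (fun k ξ => p k ξ * l k ξ ^ 2) F ≤
      ENNReal.ofReal A * weightedNorm (fun k ξ => p k ξ * l₁ k ξ ^ 2) f +
        ENNReal.ofReal B * weightedNorm (fun k ξ => p k ξ * l₂ k ξ ^ 2) g := by
  rw [weightedNorm_eq_freqNorm hp hl, weightedNorm_eq_freqNorm hp hl₁,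
    weightedNorm_eq_freqNorm hp hl₂, ← freqNorm_const_mul ENNReal.ofReal_ne_top,
    ← freqNorm_const_mul ENNReal.ofReal_ne_top]
  have hmeas : ∀ (l : ℤ → ℝ → ℝ) (f : Channel → ℝ), (∀ k, Measurable (l k)) → ∀ (c : ℝ≥0∞) (k : ℤ),
      AEMeasurable (fun ξ => c * ENNReal.ofReal (√(p k ξ) * (l k ξ * ‖channelFourier f k ξ‖)))
        volume := fun l f hm c k =>
    ((((hpm k).sqrt.aemeasurable).mul ((hm k).aemeasurable.mul
      (aestronglyMeasurable_channelFourier f k).norm.aemeasurable)).ennreal_ofReal).const_mul c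
  refine (freqNorm_mono fun k => ?_).trans (freqNorm_add_le (hmeas l₁ f hm₁ _) (hmeas l₂ g hm₂ _))
  filter_upwards [h k] with ξ h1
  have := hl₁ k ξ
  have := hl₂ k ξ
  rw [← ENNReal.ofReal_mul hA, ← ENNReal.ofReal_mul hB, ← ENNReal.ofReal_add (by positivity)
    (by positivity)]
  refine ENNReal.ofReal_le_ofReal ((mul_le_mul_of_nonneg_left h1 (Real.sqrt_nonneg _)).trans
    (le_of_eq ?_))
  ring

/-- The weight `1 + k² + ξ²`. -/
def sobolevWeight (k : ℤ) (ξ : ℝ) : ℝ := 1 + (k : ℝ) ^ 2 + ξ ^ 2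

/-- The modulus `√(k² + ξ²)` of the frequency. -/
def freqModulus (k : ℤ) (ξ : ℝ) : ℝ := √((k : ℝ) ^ 2 + ξ ^ 2)

theorem sobolevWeight_pos (k : ℤ) (ξ : ℝ) : 0 < sobolevWeight k ξ := by
  rw [sobolevWeight]
  positivity

theorem measurable_sobolevWeight (k : ℤ) : Measurable (sobolevWeight k) := by
  unfold sobolevWeight
  fun_prop

theorem measurable_freqModulus (k : ℤ) : Measurable (freqModulus k) := by
  unfold freqModulus
  fun_prop

theorem sobolevNorm_eq (N : ℕ) (f : Channel → ℝ) :
    sobolevNorm N f = weightedNorm (fun k ξ => sobolevWeight k ξ ^ N * 1 ^ 2) f := by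
  simp [sobolevNorm, sobolevWeight]

theorem sobolevNorm_succ_eq (N : ℕ) (f : Channel → ℝ) :
    sobolevNorm (N + 1) f =
      weightedNorm (fun k ξ => sobolevWeight k ξ ^ N * √(sobolevWeight k ξ) ^ 2) f := by
  simp only [Real.sq_sqrt (sobolevWeight_pos _ _).le, ← pow_succ]
  rfl

theorem gradSobolevNorm_eq (N : ℕ) (f : Channel → ℝ) :
    gradSobolevNorm N f =
      weightedNorm (fun k ξ => sobolevWeight k ξ ^ N * freqModulus k ξ ^ 2) f := by
  have h : ∀ (k : ℤ) (ξ : ℝ), freqModulus k ξ ^ 2 = (k : ℝ) ^ 2 + ξ ^ 2 := fun k ξ =>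
    Real.sq_sqrt (by positivity)
  simp only [h, gradSobolevNorm, sobolevWeight, mul_comm]

theorem abs_mul_bracket {k : ℤ} (hk : k ≠ 0) (ξ : ℝ) :
    |(k : ℝ)| * bracket (ξ / k) = freqModulus k ξ := by
  have hk' : (k : ℝ) ≠ 0 := by exact_mod_cast hk
  rw [bracket, freqModulus, ← Real.sqrt_sq_eq_abs, ← Real.sqrt_mul (sq_nonneg _)]
  congr 1
  field_simp

theorem sqrt_sobolevWeight_le {k : ℤ} (hk : k ≠ 0) (ξ : ℝ) :
    √(sobolevWeight k ξ) ≤ √2 * freqModulus k ξ := by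
  have h1 : (1 : ℝ) ≤ (k : ℝ) ^ 2 := by
    have : (1 : ℤ) ≤ k ^ 2 := by nlinarith [Int.one_le_abs hk, sq_abs k, abs_nonneg k]
    exact_mod_cast this
  rw [freqModulus, ← Real.sqrt_mul two_pos.le]
  refine Real.sqrt_le_sqrt ?_
  rw [sobolevWeight]
  nlinarith [sq_nonneg ξ]

theorem freqModulus_le (k : ℤ) (ξ : ℝ) : freqModulus k ξ ≤ √(sobolevWeight k ξ) :=
  Real.sqrt_le_sqrt (by rw [sobolevWeight]; linarith)

/-! ### Estimates of the propagator at each frequency -/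

namespace Propagator
variable {α β : ℝ} (P : Propagator α β)

/-- The vorticity at the frequency `(k, ξ)` that evolves from the data `x`, `y`. -/
def vorticity (t : ℝ) (k : ℤ) (ξ : ℝ) (x y : ℂ) : ℂ :=
  (P.c t (symbolPoint k ξ) : ℂ) * x + Complex.I * k * (P.s t (symbolPoint k ξ) : ℂ) * y

/-- The temperature at the frequency `(k, ξ)` that evolves from the data `x`, `y`. -/
def temperature (t : ℝ) (k : ℤ) (ξ : ℝ) (x y : ℂ) : ℂ :=
  -(Complex.I / k) * (P.c' t (symbolPoint k ξ) : ℂ) * x + (P.s' t (symbolPoint k ξ) : ℂ) * y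

theorem isMode_c (η : ℝ) : IsMode α β η (fun t => P.c t (η, true)) fun t => P.c' t (η, true) := by
  refine ⟨fun t => hasDerivAt_symbol_apply (P.hasDerivAt_c t) _, fun t => ?_⟩
  refine (hasDerivAt_symbol_apply (P.hasDerivAt_c' t) (η, true)).congr_deriv ?_
  simp [stratification_apply, div_eq_mul_inv]

theorem isMode_s (η : ℝ) : IsMode α β η (fun t => P.s t (η, true)) fun t => P.s' t (η, true) := by
  refine ⟨fun t => hasDerivAt_symbol_apply (P.hasDerivAt_s t) _, fun t => ?_⟩
  refine (hasDerivAt_symbol_apply (P.hasDerivAt_s' t) (η, true)).congr_deriv ?_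
  simp [stratification_apply, div_eq_mul_inv]

theorem vorticity_zero (t ξ : ℝ) (x y : ℂ) : P.vorticity t 0 ξ x y = x := by
  simp [vorticity, symbolPoint, P.c_apply_false]

theorem temperature_zero (t ξ : ℝ) (x y : ℂ) : P.temperature t 0 ξ x y = y := by
  simp [temperature, symbolPoint, P.s'_apply_false]

theorem symbolPoint_eq {k : ℤ} (hk : k ≠ 0) (ξ : ℝ) : symbolPoint k ξ = (ξ / k, true) := by
  simp [symbolPoint, hk]

theorem norm_vorticity_le {k : ℤ} (hk : k ≠ 0) (t ξ : ℝ) (x y : ℂ) :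
    ‖P.vorticity t k ξ x y‖ ≤
      |P.c t (ξ / k, true)| * ‖x‖ + |(k : ℝ)| * |P.s t (ξ / k, true)| * ‖y‖ := by
  rw [vorticity, symbolPoint_eq hk]
  refine (norm_add_le _ _).trans (le_of_eq ?_)
  simp [Complex.norm_intCast]

theorem norm_temperature_le {k : ℤ} (hk : k ≠ 0) (t ξ : ℝ) (x y : ℂ) :
    ‖P.temperature t k ξ x y‖ ≤
      |P.c' t (ξ / k, true)| / |(k : ℝ)| * ‖x‖ + |P.s' t (ξ / k, true)| * ‖y‖ := by
  rw [temperature, symbolPoint_eq hk]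
  refine (norm_add_le _ _).trans (le_of_eq ?_)
  simp [Complex.norm_intCast, div_eq_mul_inv, mul_comm]

end Propagator

theorem one_le_growthRate {α β t : ℝ} (ht : 0 ≤ t) : 1 ≤ growthRate α β t := by
  have h0 : 0 ≤ growthExponent α β := by
    rw [growthExponent]
    positivity
  have h1 : 1 ≤ (1 + t) ^ growthExponent α β := Real.one_le_rpow (by linarith) h0
  have h2 : 0 ≤ Real.log (1 + t) := Real.log_nonneg (by linarith)
  rw [growthRate]
  split_ifs
  · nlinarith
  · exact h1

theorem exists_frequency_bound {α β : ℝ} (hα : 0 < α) (hβ : β ≠ 0) : ∃ K : ℝ, 0 < K ∧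
    ∀ (P : Propagator α β) (t : ℝ), 0 ≤ t → ∀ (k : ℤ) (ξ : ℝ) (x y : ℂ),
      ‖P.vorticity t k ξ x y‖ ≤ K * growthRate α β t * (‖x‖ + √(sobolevWeight k ξ) * ‖y‖) ∧
      √(sobolevWeight k ξ) * ‖P.temperature t k ξ x y‖ ≤
        K * growthRate α β t * (‖x‖ + √(sobolevWeight k ξ) * ‖y‖) := by
  obtain ⟨K, hK, h⟩ := exists_mode_bound hα hβ
  refine ⟨1 + √2 * K, by positivity, fun P t ht k ξ x y => ?_⟩
  have hg := one_le_growthRate (α := α) (β := β) ht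
  set g := growthRate α β t
  set W := √(sobolevWeight k ξ) with hW
  have hW0 : 0 ≤ W := Real.sqrt_nonneg _
  have hR : 0 ≤ ‖x‖ + W * ‖y‖ := by positivity
  by_cases hk : k = 0
  · subst hk
    rw [P.vorticity_zero, P.temperature_zero]
    have h1 : 1 ≤ (1 + √2 * K) * g := by nlinarith [show 0 ≤ √2 * K by positivity]
    have h2 := le_mul_of_one_le_left hR h1
    constructor
    · linarith [show 0 ≤ W * ‖y‖ by positivity]
    · linarith [norm_nonneg x]
  · have hk0 : 0 < |(k : ℝ)| := abs_pos.2 (by exact_mod_cast hk)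
    set η := ξ / (k : ℝ) with hη
    have hJ := bracket_pos η
    have hm := abs_mul_bracket hk ξ
    have hmW := freqModulus_le k ξ
    have hWm := sqrt_sobolevWeight_le hk ξ
    rw [← hm, ← hη] at hmW hWm
    have hc := h η _ _ (P.isMode_c η) t ht
    have hs := h η _ _ (P.isMode_s η) t ht
    simp only [P.c_zero, P.c'_zero, P.s_zero, P.s'_zero, BoundedContinuousFunction.coe_one,
      BoundedContinuousFunction.coe_zero, Pi.one_apply, Pi.zero_apply, abs_one, abs_zero, mul_zero,
      add_zero, mul_one, zero_add] at hc hs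
    have hω := P.norm_vorticity_le hk t ξ x y
    have hθ := P.norm_temperature_le hk t ξ x y
    rw [← hη] at hω hθ
    set c := |P.c t (η, true)|
    set c' := |P.c' t (η, true)|
    set s := |P.s t (η, true)|
    set s' := |P.s' t (η, true)|
    have hc0 : 0 ≤ c := abs_nonneg _
    have hc'0 : 0 ≤ c' := abs_nonneg _
    have hs0 : 0 ≤ s := abs_nonneg _
    have hs'0 : 0 ≤ s' := abs_nonneg _
    have hJc' : 0 ≤ bracket η * c' := by positivity
    have hJs' : 0 ≤ bracket η * s' := by positivity
    have hx := norm_nonneg x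
    have hy := norm_nonneg y
    have hKg : 0 ≤ K * g := by positivity
    have h2 : (1 : ℝ) ≤ √2 := Real.one_le_sqrt.2 one_le_two
    have e1 : √2 * (K * g) * (‖x‖ + W * ‖y‖) ≤ (1 + √2 * K) * g * (‖x‖ + W * ‖y‖) := by
      refine mul_le_mul_of_nonneg_right ?_ hR
      linarith
    constructor
    · refine le_trans ?_ e1
      calc _ ≤ c * ‖x‖ + |(k : ℝ)| * s * ‖y‖ := hω
        _ ≤ K * g * ‖x‖ + |(k : ℝ)| * (K * g * bracket η) * ‖y‖ := by
          gcongr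
          · linarith
          · linarith
        _ = K * g * (‖x‖ + |(k : ℝ)| * bracket η * ‖y‖) := by ring
        _ ≤ K * g * (‖x‖ + W * ‖y‖) := by gcongr
        _ ≤ √2 * (K * g) * (‖x‖ + W * ‖y‖) :=
          mul_le_mul_of_nonneg_right (le_mul_of_one_le_left hKg h2) hR
    · refine le_trans ?_ e1
      calc _ ≤ W * (c' / |(k : ℝ)| * ‖x‖ + s' * ‖y‖) := mul_le_mul_of_nonneg_left hθ hW0
        _ ≤ √2 * (|(k : ℝ)| * bracket η) * (c' / |(k : ℝ)| * ‖x‖ + s' * ‖y‖) := by gcongr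
        _ = √2 * ((bracket η * c') * ‖x‖ + |(k : ℝ)| * (bracket η * s') * ‖y‖) := by
          field_simp
        _ ≤ √2 * ((K * g) * ‖x‖ + |(k : ℝ)| * (K * g * bracket η) * ‖y‖) :=
          mul_le_mul_of_nonneg_left (add_le_add
            (mul_le_mul_of_nonneg_right ((le_add_of_nonneg_left hc0).trans hc) hx)
            (mul_le_mul_of_nonneg_right (mul_le_mul_of_nonneg_left
              ((le_add_of_nonneg_left hs0).trans hs) hk0.le) hy)) (Real.sqrt_nonneg _)
        _ = √2 * (K * g) * (‖x‖ + |(k : ℝ)| * bracket η * ‖y‖) := by ring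
        _ ≤ _ := by gcongr

/-- Without shear each mode is a harmonic oscillator of frequency `√α / ⟨η⟩`. -/
theorem IsMode.energy {α η : ℝ} {w w' : ℝ → ℝ} (h : IsMode α 0 η w w') (t : ℝ) :
    bracket η ^ 2 * w' t ^ 2 + α * w t ^ 2 = bracket η ^ 2 * w' 0 ^ 2 + α * w 0 ^ 2 := by
  have h1 : ∀ s, HasDerivAt (fun t => bracket η ^ 2 * w' t ^ 2 + α * w t ^ 2) 0 s := fun s => by
    refine ((((h.hasDerivAt' s).pow 2).const_mul (bracket η ^ 2)).add
      (((h.hasDerivAt s).pow 2).const_mul α)).congr_deriv ?_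
    rw [zero_mul, sub_zero, bracket_sq]
    have : 0 < 1 + η ^ 2 := by positivity
    field_simp
    ring
  exact is_const_of_deriv_eq_zero (fun s => (h1 s).differentiableAt) (fun s => (h1 s).deriv) t 0

theorem frequency_bound_of_no_shear {α : ℝ} (hα : 0 < α) (P : Propagator α 0) (t : ℝ) (k : ℤ)
    (ξ : ℝ) (x y : ℂ) :
    ‖P.vorticity t k ξ x y‖ ≤ ‖x‖ + 1 / √α * (freqModulus k ξ * ‖y‖) ∧
    freqModulus k ξ * ‖P.temperature t k ξ x y‖ ≤ √α * ‖x‖ + freqModulus k ξ * ‖y‖ ∧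
    √(sobolevWeight k ξ) * ‖P.temperature t k ξ x y‖ ≤
      √(2 * α) * ‖x‖ + √(sobolevWeight k ξ) * ‖y‖ := by
  have hx := norm_nonneg x
  have hy := norm_nonneg y
  have hm0 : 0 ≤ freqModulus k ξ := Real.sqrt_nonneg _
  set W := √(sobolevWeight k ξ) with hW
  have hW0 : 0 ≤ W := Real.sqrt_nonneg _
  have hsα : 0 < √α := Real.sqrt_pos.2 hα
  have hα2 : √α ^ 2 = α := Real.sq_sqrt hα.le
  by_cases hk : k = 0
  · subst hk
    rw [P.vorticity_zero, P.temperature_zero]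
    refine ⟨?_, ?_, ?_⟩
    · linarith [show 0 ≤ 1 / √α * (freqModulus 0 ξ * ‖y‖) by positivity]
    · linarith [show 0 ≤ √α * ‖x‖ by positivity]
    · linarith [show 0 ≤ √(2 * α) * ‖x‖ by positivity]
  · have hk0 : 0 < |(k : ℝ)| := abs_pos.2 (by exact_mod_cast hk)
    set η := ξ / (k : ℝ) with hη
    have hJ := bracket_pos η
    have hm := abs_mul_bracket hk ξ
    have hWm := sqrt_sobolevWeight_le hk ξ
    rw [← hη] at hm
    have hc := (P.isMode_c η).energy t
    have hs := (P.isMode_s η).energy t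
    simp only [P.c_zero, P.c'_zero, P.s_zero, P.s'_zero, BoundedContinuousFunction.coe_one,
      BoundedContinuousFunction.coe_zero, Pi.one_apply, Pi.zero_apply, one_pow, mul_one,
      ne_eq, OfNat.ofNat_ne_zero, not_false_eq_true, zero_pow, mul_zero, add_zero, zero_add] at hc hs
    have hω := P.norm_vorticity_le hk t ξ x y
    have hθ := P.norm_temperature_le hk t ξ x y
    rw [← hη] at hω hθ
    have h1 : |P.c t (η, true)| ≤ 1 := by
      refine abs_le_of_sq_le_sq (a := P.c t (η, true)) ?_ zero_le_one
      have : 0 ≤ bracket η ^ 2 * P.c' t (η, true) ^ 2 := by positivity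
      rw [one_pow]
      exact le_of_mul_le_mul_left (by linarith) hα
    have h2 : bracket η * |P.c' t (η, true)| ≤ √α := by
      rw [← abs_of_pos hJ, ← abs_mul]
      refine abs_le_of_sq_le_sq ?_ hsα.le
      rw [mul_pow, hα2]
      linarith [show 0 ≤ α * P.c t (η, true) ^ 2 by positivity]
    have h3 : √α * |P.s t (η, true)| ≤ bracket η := by
      rw [← abs_of_pos hsα, ← abs_mul]
      refine abs_le_of_sq_le_sq ?_ hJ.le
      rw [mul_pow, hα2]
      linarith [show 0 ≤ bracket η ^ 2 * P.s' t (η, true) ^ 2 by positivity]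
    have h4 : |P.s' t (η, true)| ≤ 1 := by
      refine abs_le_of_sq_le_sq (a := P.s' t (η, true)) ?_ zero_le_one
      have : 0 ≤ α * P.s t (η, true) ^ 2 := by positivity
      rw [one_pow]
      exact le_of_mul_le_mul_left (by linarith) (by positivity : 0 < bracket η ^ 2)
    set c := |P.c t (η, true)|
    set c' := |P.c' t (η, true)|
    set s := |P.s t (η, true)|
    set s' := |P.s' t (η, true)|
    have h5 : freqModulus k ξ * (c' / |(k : ℝ)|) ≤ √α := by
      rw [← hm]
      refine le_trans (le_of_eq ?_) h2
      field_simp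
    refine ⟨?_, ?_, ?_⟩
    · refine hω.trans (add_le_add (mul_le_of_le_one_left hx h1) ?_)
      rw [← mul_assoc, ← hm]
      refine mul_le_mul_of_nonneg_right ?_ hy
      rw [one_div_mul_eq_div, le_div_iff₀ hsα]
      calc |(k : ℝ)| * s * √α = |(k : ℝ)| * (√α * s) := by ring
        _ ≤ _ := by gcongr
    · calc _ ≤ freqModulus k ξ * (c' / |(k : ℝ)| * ‖x‖ + s' * ‖y‖) :=
            mul_le_mul_of_nonneg_left hθ hm0
        _ = freqModulus k ξ * (c' / |(k : ℝ)|) * ‖x‖ + freqModulus k ξ * (s' * ‖y‖) := by ring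
        _ ≤ _ := add_le_add (mul_le_mul_of_nonneg_right h5 hx)
            (mul_le_mul_of_nonneg_left (mul_le_of_le_one_left hy h4) hm0)
    -- For `k ≠ 0` the weight `1 + k² + ξ²` is at most `2(k² + ξ²)`; this is the source of the
    -- factor `√2`.
    · have h6 : W * (c' / |(k : ℝ)|) ≤ √(2 * α) := by
        rw [Real.sqrt_mul two_pos.le]
        calc W * (c' / |(k : ℝ)|) ≤ √2 * freqModulus k ξ * (c' / |(k : ℝ)|) :=
              mul_le_mul_of_nonneg_right hWm (by positivity)
          _ = √2 * (freqModulus k ξ * (c' / |(k : ℝ)|)) := by ring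
          _ ≤ _ := by gcongr
      calc _ ≤ W * (c' / |(k : ℝ)| * ‖x‖ + s' * ‖y‖) := mul_le_mul_of_nonneg_left hθ hW0
        _ = W * (c' / |(k : ℝ)|) * ‖x‖ + W * (s' * ‖y‖) := by ring
        _ ≤ _ := add_le_add (mul_le_mul_of_nonneg_right h6 hx)
            (mul_le_mul_of_nonneg_left (mul_le_of_le_one_left hy h4) hW0)

/-! ### The estimates for solutions -/

theorem MemSobolev.tsum_dx_ne_top {N : ℕ} {f : Channel → ℝ} (hf : MemSobolev (N + 1) f) :
    ∑' k : ℤ, ∫⁻ ξ, ‖Complex.I * k * channelFourier f k ξ‖ₑ ^ 2 ≠ ∞ := by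
  have h1 : ∑' k : ℤ, ∫⁻ ξ : ℝ, ENNReal.ofReal ((1 + (k : ℝ) ^ 2 + ξ ^ 2) ^ (N + 1) *
      ‖channelFourier f k ξ‖ ^ 2) < ∞ := by
    have := hf.2
    rw [sobolevNorm, weightedNorm] at this
    by_contra h
    rw [not_lt_top_iff.1 h, ENNReal.top_rpow_of_pos (by norm_num)] at this
    exact lt_irrefl _ this
  refine ne_of_lt (lt_of_le_of_lt (ENNReal.tsum_le_tsum fun k => lintegral_mono fun ξ => ?_) h1)
  rw [← ofReal_norm, ← ENNReal.ofReal_pow (norm_nonneg _), norm_mul, norm_mul,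
    Complex.norm_I, one_mul, Complex.norm_intCast, mul_pow, sq_abs]
  refine ENNReal.ofReal_le_ofReal (mul_le_mul_of_nonneg_right ?_ (sq_nonneg _))
  have h2 : 1 ≤ 1 + (k : ℝ) ^ 2 + ξ ^ 2 := by nlinarith [sq_nonneg (k : ℝ), sq_nonneg ξ]
  refine le_trans (by nlinarith [sq_nonneg ξ]) (le_self_pow₀ h2 (Nat.succ_ne_zero N))

theorem exists_isSolution_of_memSobolev {α β : ℝ} (hα : 0 < α) (P : Propagator α β) {N : ℕ}
    {ω₀ θ₀ : Channel → ℝ} (hω₀ : MemSobolev N ω₀) (hθ₀ : MemSobolev (N + 1) θ₀) :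
    ∃ ω θ : ℝ → Channel → ℝ, IsSolution α β ω₀ θ₀ ω θ ∧ ∀ (t : ℝ) (k : ℤ), ∀ᵐ ξ : ℝ,
      channelFourier (sheared β ω t) k ξ =
        P.vorticity t k ξ (channelFourier ω₀ k ξ) (channelFourier θ₀ k ξ) ∧
      channelFourier (sheared β θ t) k ξ =
        P.temperature t k ξ (channelFourier ω₀ k ξ) (channelFourier θ₀ k ξ) := by
  have e1 := hω₀.1.coeFn_toLp
  have e2 := hθ₀.1.coeFn_toLp
  obtain ⟨ω, θ, h1, h2⟩ := exists_isSolution hα P hω₀.1.toLp hθ₀.1.toLp (by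
    simp only [channelFourier_congr_ae e2]
    exact hθ₀.tsum_dx_ne_top)
  simp only [channelFourier_congr_ae e1, channelFourier_congr_ae e2] at h2
  exact ⟨ω, θ, { h1 with
    initial_vorticity := h1.initial_vorticity.trans e1
    initial_temperature := h1.initial_temperature.trans e2 }, h2⟩

/-- By uniqueness every solution agrees with the constructed one, whose transform is known. -/
theorem IsSolution.channelFourier_sheared {α β : ℝ} (hα : 0 < α) (P : Propagator α β) {N : ℕ}
    {ω₀ θ₀ : Channel → ℝ} (hω₀ : MemSobolev N ω₀) (hθ₀ : MemSobolev (N + 1) θ₀)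
    {ω θ : ℝ → Channel → ℝ} (h : IsSolution α β ω₀ θ₀ ω θ) {t : ℝ} (ht : 0 ≤ t) (k : ℤ) :
    ∀ᵐ ξ : ℝ, channelFourier (sheared β ω t) k ξ =
        P.vorticity t k ξ (channelFourier ω₀ k ξ) (channelFourier θ₀ k ξ) ∧
      channelFourier (sheared β θ t) k ξ =
        P.temperature t k ξ (channelFourier ω₀ k ξ) (channelFourier θ₀ k ξ) := by
  obtain ⟨ω', θ', h1, h2⟩ := exists_isSolution_of_memSobolev hα P hω₀ hθ₀
  obtain ⟨h3, h4⟩ := isSolution_unique hα h h1 ht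
  have h5 := h2 t k
  rw [sheared_eq_shearBy, sheared_eq_shearBy, channelFourier_congr_ae (shearBy_congr_ae h3 _),
    channelFourier_congr_ae (shearBy_congr_ae h4 _)] at h5
  exact h5

theorem sheared_zero (u : ℝ → Channel → ℝ) (t : ℝ) : sheared 0 u t = u t := by
  rw [sheared_eq_shearBy, zero_mul, shearBy_zero]

theorem stability_of_no_shear {α : ℝ} (hα : 0 < α) {N : ℕ} {ω₀ θ₀ : Channel → ℝ}
    (hω₀ : MemSobolev N ω₀) (hθ₀ : MemSobolev (N + 1) θ₀) {ω θ : ℝ → Channel → ℝ}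
    (h : IsSolution α 0 ω₀ θ₀ ω θ) {t : ℝ} (ht : 0 ≤ t) :
    sobolevNorm N (ω t) ≤
        sobolevNorm N ω₀ + ENNReal.ofReal (1 / √α) * gradSobolevNorm N θ₀ ∧
      gradSobolevNorm N (θ t) ≤
        ENNReal.ofReal (√α) * sobolevNorm N ω₀ + gradSobolevNorm N θ₀ ∧
      sobolevNorm (N + 1) (θ t) ≤
        ENNReal.ofReal (√(2 * α)) * sobolevNorm N ω₀ + sobolevNorm (N + 1) θ₀ := by
  obtain ⟨P⟩ := nonempty_propagator α 0
  have hF := h.channelFourier_sheared hα P hω₀ hθ₀ ht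
  rw [sheared_zero, sheared_zero] at hF
  have hp : ∀ (k : ℤ) (ξ : ℝ), 0 ≤ sobolevWeight k ξ ^ N := fun k ξ =>
    pow_nonneg (sobolevWeight_pos k ξ).le N
  have hpm : ∀ k : ℤ, Measurable fun ξ => sobolevWeight k ξ ^ N := fun k =>
    (measurable_sobolevWeight k).pow_const N
  have h1 : ∀ (k : ℤ) (ξ : ℝ), (0 : ℝ) ≤ 1 := fun _ _ => zero_le_one
  have hm : ∀ (k : ℤ) (ξ : ℝ), 0 ≤ freqModulus k ξ := fun _ _ => Real.sqrt_nonneg _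
  have hW : ∀ (k : ℤ) (ξ : ℝ), 0 ≤ √(sobolevWeight k ξ) := fun _ _ => Real.sqrt_nonneg _
  refine ⟨?_, ?_, ?_⟩
  · rw [sobolevNorm_eq, sobolevNorm_eq, gradSobolevNorm_eq]
    have := weightedNorm_le (A := 1) (B := 1 / √α) (F := ω t) (f := ω₀) (g := θ₀) hp h1 h1 hm hpm
      (fun _ => measurable_const) measurable_freqModulus zero_le_one (by positivity) fun k => by
        filter_upwards [hF k] with ξ h2
        rw [h2.1, one_mul, one_mul, one_mul]
        exact (frequency_bound_of_no_shear hα P t k ξ _ _).1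
    rwa [ENNReal.ofReal_one, one_mul] at this
  · rw [sobolevNorm_eq, gradSobolevNorm_eq, gradSobolevNorm_eq]
    have := weightedNorm_le (A := √α) (B := 1) (F := θ t) (f := ω₀) (g := θ₀) hp hm h1 hm hpm
      (fun _ => measurable_const) measurable_freqModulus (by positivity) zero_le_one fun k => by
        filter_upwards [hF k] with ξ h2
        rw [h2.2, one_mul, one_mul]
        exact (frequency_bound_of_no_shear hα P t k ξ _ _).2.1
    rwa [ENNReal.ofReal_one, one_mul] at this
  · rw [sobolevNorm_succ_eq, sobolevNorm_succ_eq, sobolevNorm_eq]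
    have := weightedNorm_le (A := √(2 * α)) (B := 1) (F := θ t) (f := ω₀) (g := θ₀) hp hW h1 hW hpm
      (fun _ => measurable_const) (fun k => (measurable_sobolevWeight k).sqrt) (by positivity)
      zero_le_one fun k => by
        filter_upwards [hF k] with ξ h2
        rw [h2.2, one_mul, one_mul]
        exact (frequency_bound_of_no_shear hα P t k ξ _ _).2.2
    rwa [ENNReal.ofReal_one, one_mul] at this

theorem exists_shear_upper_bound {α β : ℝ} (hα : 0 < α) (hβ : β ≠ 0) (N : ℕ) :
    ∃ C : ℝ, 0 < C ∧ ∀ ω₀ θ₀ : Channel → ℝ, MemSobolev N ω₀ → MemSobolev (N + 1) θ₀ →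
      ∀ ω θ : ℝ → Channel → ℝ, IsSolution α β ω₀ θ₀ ω θ → ∀ t : ℝ, 0 ≤ t →
        sobolevNorm N (sheared β ω t) + sobolevNorm (N + 1) (sheared β θ t) ≤
          ENNReal.ofReal (C * growthRate α β t) *
            (sobolevNorm N ω₀ + sobolevNorm (N + 1) θ₀) := by
  obtain ⟨K, hK, hKb⟩ := exists_frequency_bound hα hβ
  obtain ⟨P⟩ := nonempty_propagator α β
  refine ⟨2 * K, by positivity, fun ω₀ θ₀ hω₀ hθ₀ ω θ h t ht => ?_⟩
  have hF := h.channelFourier_sheared hα P hω₀ hθ₀ ht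
  have hg : 0 ≤ K * growthRate α β t :=
    mul_nonneg hK.le (zero_le_one.trans (one_le_growthRate ht))
  have hp : ∀ (k : ℤ) (ξ : ℝ), 0 ≤ sobolevWeight k ξ ^ N := fun k ξ =>
    pow_nonneg (sobolevWeight_pos k ξ).le N
  have hpm : ∀ k : ℤ, Measurable fun ξ => sobolevWeight k ξ ^ N := fun k =>
    (measurable_sobolevWeight k).pow_const N
  have h1 : ∀ (k : ℤ) (ξ : ℝ), (0 : ℝ) ≤ 1 := fun _ _ => zero_le_one
  have hW : ∀ (k : ℤ) (ξ : ℝ), 0 ≤ √(sobolevWeight k ξ) := fun _ _ => Real.sqrt_nonneg _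
  rw [sobolevNorm_succ_eq, sobolevNorm_succ_eq, sobolevNorm_eq, sobolevNorm_eq]
  have hω := weightedNorm_le (A := K * growthRate α β t) (B := K * growthRate α β t)
    (F := sheared β ω t) (f := ω₀) (g := θ₀) hp h1 h1 hW hpm (fun _ => measurable_const)
    (fun k => (measurable_sobolevWeight k).sqrt) hg hg fun k => by
      filter_upwards [hF k] with ξ h2
      rw [h2.1, one_mul, one_mul, ← mul_add]
      exact (hKb P t ht k ξ _ _).1
  have hθ := weightedNorm_le (A := K * growthRate α β t) (B := K * growthRate α β t)
    (F := sheared β θ t) (f := ω₀) (g := θ₀) hp hW h1 hW hpm (fun _ => measurable_const)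
    (fun k => (measurable_sobolevWeight k).sqrt) hg hg fun k => by
      filter_upwards [hF k] with ξ h2
      rw [h2.2, one_mul, ← mul_add]
      exact (hKb P t ht k ξ _ _).2
  rw [← mul_add] at hω hθ
  refine (add_le_add hω hθ).trans (le_of_eq ?_)
  rw [mul_assoc, ENNReal.ofReal_mul two_pos.le, ENNReal.ofReal_ofNat, mul_assoc, two_mul]

/-- Compact support in frequency gives all Sobolev norms. The amplitude `2z` compensates for the
half that goes to the mode `-1`. -/
theorem exists_memSobolev_data (z : ℂ) (p : ℝ) : ∃ f : Channel → ℝ, (∀ N, MemSobolev N f) ∧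
    ∀ᵐ ξ : ℝ, ξ ∈ Icc p (p + 1) → channelFourier f 1 ξ = z := by
  set F : ℝ → ℂ := (Icc p (p + 1)).indicator fun _ => 2 * z with hF
  have hFb : ∀ ξ, ‖F ξ‖ ≤ 2 * ‖z‖ ∧ (|p| + 1 < |ξ| → F ξ = 0) := fun ξ => by
    refine ⟨(norm_indicator_le_norm_self _ _).trans (by simp), fun h => ?_⟩
    refine indicator_of_notMem (fun h1 => absurd h (not_lt.2 ?_)) _
    exact abs_le.2 ⟨by linarith [neg_abs_le p, h1.1], by linarith [le_abs_self p, h1.2]⟩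
  obtain ⟨u, hu⟩ := exists_channelFourier_eq_single (F := F)
    (memLp_indicator_const 2 measurableSet_Icc _ (Or.inr (by simp))) 1
  refine ⟨u, fun N => ⟨Lp.memLp u, ?_⟩, ?_⟩
  · rw [sobolevNorm, weightedNorm]
    refine ENNReal.rpow_lt_top_of_nonneg (by norm_num) (ne_of_lt ?_)
    rw [tsum_eq_sum (s := {1, -1}) (fun k hk => ?_)]
    · refine ENNReal.sum_lt_top.2 fun k _ => ?_
      have hb : ∀ᵐ ξ : ℝ, ENNReal.ofReal ((1 + (k : ℝ) ^ 2 + ξ ^ 2) ^ N *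
          ‖channelFourier u k ξ‖ ^ 2) ≤ (Icc (-(|p| + 1)) (|p| + 1)).indicator (fun _ =>
            ENNReal.ofReal ((1 + (k : ℝ) ^ 2 + (|p| + 1) ^ 2) ^ N * (2 * ‖z‖) ^ 2)) ξ := by
        filter_upwards [hu k] with ξ h1
        by_cases h2 : ξ ∈ Icc (-(|p| + 1)) (|p| + 1)
        · rw [indicator_of_mem h2]
          have h3 : ξ ^ 2 ≤ (|p| + 1) ^ 2 := sq_le_sq' h2.1 h2.2
          have h4 : ‖channelFourier u k ξ‖ ≤ 2 * ‖z‖ := by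
            rw [h1]
            refine (norm_add_le _ _).trans ?_
            rw [norm_div, norm_div, Complex.norm_two]
            have e1 : ‖if k = 1 then F ξ else 0‖ ≤ 2 * ‖z‖ := by
              split_ifs
              · exact (hFb ξ).1
              · simp
            have e2 : ‖if k = -1 then starRingEnd ℂ (F (-ξ)) else 0‖ ≤ 2 * ‖z‖ := by
              split_ifs
              · rw [RCLike.norm_conj]
                exact (hFb _).1
              · simp
            linarith
          gcongr
        · have h3 : |p| + 1 < |ξ| := by
            by_contra h4
            exact h2 (abs_le.1 (not_lt.1 h4))
          rw [h1, (hFb ξ).2 h3, (hFb (-ξ)).2 (by rwa [abs_neg])]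
          simp
      refine (lintegral_mono_ae hb).trans_lt ?_
      rw [lintegral_indicator_const measurableSet_Icc]
      exact ENNReal.mul_lt_top ENNReal.ofReal_lt_top (by simp)
    · rw [lintegral_eq_zero_iff' ?_]
      · filter_upwards [hu k] with ξ h1
        simp only [Finset.mem_insert, Finset.mem_singleton, not_or] at hk
        rw [h1, if_neg hk.1, if_neg hk.2]
        simp
      · exact ((by fun_prop : Measurable fun ξ : ℝ => (1 + (k : ℝ) ^ 2 + ξ ^ 2) ^ N).aemeasurable.mul
          ((aestronglyMeasurable_channelFourier u k).norm.aemeasurable.pow_const 2)).ennreal_ofReal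
  · filter_upwards [hu 1] with ξ h1 h2
    rw [h1, if_pos rfl, if_neg (by norm_num), hF, indicator_of_mem h2]
    ring

/-- The interval of `ξ` is chosen so that `s₀ ∈ [1, 2]`, past the critical time `s = 0`. -/
theorem exists_shear_lower_bound {α β : ℝ} (hα : 0 < α) (hβ : β ≠ 0) (N : ℕ) :
    ∃ ω₀ θ₀ : Channel → ℝ, MemSobolev N ω₀ ∧ MemSobolev (N + 1) θ₀ ∧
      ∃ c : ℝ, 0 < c ∧ ∀ ω θ : ℝ → Channel → ℝ, IsSolution α β ω₀ θ₀ ω θ → ∀ t : ℝ, 0 ≤ t →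
        ENNReal.ofReal (c * growthRate α β t) ≤ sobolevNorm N (sheared β ω t) := by
  obtain ⟨P⟩ := nonempty_propagator α β
  obtain ⟨p, hp⟩ : ∃ p : ℝ, ∀ ξ ∈ Icc p (p + 1), -(β * ξ) ∈ Icc |β| (2 * |β|) := by
    rcases lt_or_gt_of_ne hβ with hb | hb
    · refine ⟨1, fun ξ hξ => ?_⟩
      rw [abs_of_neg hb]
      constructor <;> nlinarith [hξ.1, hξ.2]
    · refine ⟨-2, fun ξ hξ => ?_⟩
      rw [abs_of_pos hb]
      constructor <;> nlinarith [hξ.1, hξ.2]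
  obtain ⟨ω₀, hω₀, hω₀'⟩ := exists_memSobolev_data 1 p
  -- With `ω̂₀ = 1` and this `θ̂₀`, `Ŵ = c + i s (1 - i|β|) = (c + |β| s) + i s`. Real and imaginary
  -- part are the two solutions of `exists_mode_lower_bound`.
  obtain ⟨θ₀, hθ₀, hθ₀'⟩ := exists_memSobolev_data (1 - Complex.I * |β|) p
  obtain ⟨c, hc, hcb⟩ := exists_mode_lower_bound hα hβ
  refine ⟨ω₀, θ₀, hω₀ N, hθ₀ (N + 1), c, hc, fun ω θ h t ht => ?_⟩
  have hF := h.channelFourier_sheared hα P (hω₀ N) (hθ₀ (N + 1)) ht 1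
  have hg : 0 ≤ c * growthRate α β t :=
    mul_nonneg hc.le (zero_le_one.trans (one_le_growthRate ht))
  have hlow : ∀ᵐ ξ : ℝ, (Icc p (p + 1)).indicator
      (fun _ => ENNReal.ofReal ((c * growthRate α β t) ^ 2)) ξ ≤
      ENNReal.ofReal ((1 + ((1 : ℤ) : ℝ) ^ 2 + ξ ^ 2) ^ N *
        ‖channelFourier (sheared β ω t) 1 ξ‖ ^ 2) := by
    filter_upwards [hF, hω₀', hθ₀'] with ξ h1 h2 h3
    by_cases hξ : ξ ∈ Icc p (p + 1)
    · rw [indicator_of_mem hξ]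
      refine ENNReal.ofReal_le_ofReal ?_
      have hc := P.isMode_c ξ
      have hs := P.isMode_s ξ
      have h4 := hcb ξ (fun t => P.c t (ξ, true) + |β| * P.s t (ξ, true))
        (fun t => P.c' t (ξ, true) + |β| * P.s' t (ξ, true)) _ _ (hp ξ hξ)
        ⟨fun t => (hc.hasDerivAt t).add ((hs.hasDerivAt t).const_mul |β|), fun t =>
          ((hc.hasDerivAt' t).add ((hs.hasDerivAt' t).const_mul |β|)).congr_deriv (by ring)⟩ hs
        (by simp [P.c_zero, P.s_zero]) (by simp [P.c'_zero, P.s'_zero]) (by simp [P.s_zero])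
        (by simp [P.s'_zero]) t ht
      have h5 : ‖channelFourier (sheared β ω t) 1 ξ‖ ^ 2 =
          (P.c t (ξ, true) + |β| * P.s t (ξ, true)) ^ 2 + P.s t (ξ, true) ^ 2 := by
        have e1 : channelFourier (sheared β ω t) 1 ξ =
            ((P.c t (ξ, true) + |β| * P.s t (ξ, true) : ℝ) : ℂ) +
              (P.s t (ξ, true) : ℝ) * Complex.I := by
          rw [h1.1, h2 hξ, h3 hξ, Propagator.vorticity, Propagator.symbolPoint_eq one_ne_zero]
          push_cast
          rw [div_one]
          linear_combination (-(P.s t (ξ, true) : ℂ) * ((|β| : ℝ) : ℂ)) * Complex.I_sq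
        rw [e1, ← Complex.normSq_eq_norm_sq, Complex.normSq_add_mul_I]
      rw [h5]
      refine h4.trans (le_mul_of_one_le_left (by positivity) (one_le_pow₀ ?_))
      nlinarith [sq_nonneg ξ, sq_nonneg (((1 : ℤ) : ℝ))]
    · rw [indicator_of_notMem hξ]
      exact zero_le
  -- The frequency interval has length `1`, so no constant is lost on integration.
  have h6 : ENNReal.ofReal (c * growthRate α β t) =
      (∫⁻ ξ, (Icc p (p + 1)).indicator
        (fun _ => ENNReal.ofReal ((c * growthRate α β t) ^ 2)) ξ) ^ (1 / 2 : ℝ) := by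
    rw [lintegral_indicator_const measurableSet_Icc, Real.volume_Icc, add_sub_cancel_left,
      ENNReal.ofReal_one, mul_one, ENNReal.ofReal_rpow_of_nonneg (sq_nonneg _) (by norm_num),
      ← Real.sqrt_eq_rpow, Real.sqrt_sq hg]
  rw [h6, sobolevNorm, weightedNorm]
  exact ENNReal.rpow_le_rpow ((lintegral_mono_ae hlow).trans (ENNReal.le_tsum 1)) (by norm_num)

end

end BoussinesqLinear

theorem mainTheorem10 (α : ℝ) (hα : 0 < α) (N : ℕ) :
    -- the evolution is a well-defined map on `H^N × H^{N+1}`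
    (∀ (β : ℝ) (ω₀ θ₀ : Channel → ℝ), MemSobolev N ω₀ → MemSobolev (N + 1) θ₀ →
      ∃ ω θ : ℝ → Channel → ℝ, IsSolution α β ω₀ θ₀ ω θ ∧
        ∀ ω' θ' : ℝ → Channel → ℝ, IsSolution α β ω₀ θ₀ ω' θ' →
          ∀ t : ℝ, 0 ≤ t → ω' t =ᵐ[volume] ω t ∧ θ' t =ᵐ[volume] θ t) ∧
    -- no shear: stability
    (∀ ω₀ θ₀ : Channel → ℝ, MemSobolev N ω₀ → MemSobolev (N + 1) θ₀ →
      ∀ ω θ : ℝ → Channel → ℝ, IsSolution α 0 ω₀ θ₀ ω θ → ∀ t : ℝ, 0 ≤ t →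
        sobolevNorm N (ω t) ≤
            sobolevNorm N ω₀ + ENNReal.ofReal (1 / √α) * gradSobolevNorm N θ₀ ∧
          gradSobolevNorm N (θ t) ≤
            ENNReal.ofReal (√α) * sobolevNorm N ω₀ + gradSobolevNorm N θ₀ ∧
          sobolevNorm (N + 1) (θ t) ≤
            ENNReal.ofReal (√(2 * α)) * sobolevNorm N ω₀ + sobolevNorm (N + 1) θ₀) ∧
    -- shear: instability with the exact algebraic growth rate
    (∀ β : ℝ, β ≠ 0 →
      (∃ C : ℝ, 0 < C ∧ ∀ ω₀ θ₀ : Channel → ℝ, MemSobolev N ω₀ → MemSobolev (N + 1) θ₀ →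
        ∀ ω θ : ℝ → Channel → ℝ, IsSolution α β ω₀ θ₀ ω θ → ∀ t : ℝ, 0 ≤ t →
          sobolevNorm N (sheared β ω t) + sobolevNorm (N + 1) (sheared β θ t) ≤
            ENNReal.ofReal (C * growthRate α β t) *
              (sobolevNorm N ω₀ + sobolevNorm (N + 1) θ₀)) ∧
      (∃ ω₀ θ₀ : Channel → ℝ, MemSobolev N ω₀ ∧ MemSobolev (N + 1) θ₀ ∧
        ∃ c : ℝ, 0 < c ∧ ∃ T : ℝ, 0 ≤ T ∧
          ∀ ω θ : ℝ → Channel → ℝ, IsSolution α β ω₀ θ₀ ω θ → ∀ t : ℝ, T ≤ t →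
            ENNReal.ofReal (c * growthRate α β t) ≤ sobolevNorm N (sheared β ω t))) := by
  refine ⟨fun β ω₀ θ₀ hω₀ hθ₀ => ?_, fun ω₀ θ₀ hω₀ hθ₀ ω θ h t ht =>
    stability_of_no_shear hα hω₀ hθ₀ h ht, fun β hβ => ⟨exists_shear_upper_bound hα hβ N, ?_⟩⟩
  · obtain ⟨P⟩ := nonempty_propagator α β
    obtain ⟨ω, θ, h, -⟩ := exists_isSolution_of_memSobolev hα P hω₀ hθ₀
    exact ⟨ω, θ, h, fun ω' θ' h' t ht => isSolution_unique hα h h' ht⟩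
  · obtain ⟨ω₀, θ₀, hω₀, hθ₀, c, hc, h⟩ := exists_shear_lower_bound hα hβ N
    exact ⟨ω₀, θ₀, hω₀, hθ₀, c, hc, 0, le_rfl, h⟩
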